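/- Let $N,l\ge 1$ and put $n=2l-1$. Agents $1,\dots,N$ are followers and agent $N+1$ is the leader. The communication network $\bar{\mathcal G}$ is a directed graph without loops on $\{1,\dots,N+1\}$, where an edge $(j,i)$ means that agent $i$ receives information from agent $j$. Its restriction to the followers is undirected, and it contains a spanning arborescence rooted at $N+1$. Let $\bar{\mathcal N}_i=\{j:(j,i)\text{ is an edge}\}$, let $\bar{\mathcal L}$ be the Laplacian of $\bar{\mathcal G}$ (with $\bar{\mathcal L}_{ii}=|\bar{\mathcal N}_i|$, and for $j\neq i$, $\bar{\mathcal L}_{ij}=-1$ if $j\in\bar{\mathcal N}_i$ and $0$ otherwise), let $H$ be $\bar{\mathcal L}$ without its last row and column, and let $\lambda_1$ be the smallest eigenvalue of $H$. The leader's signal is $y_{N+1}(t)=\sum_{k=1}^l\varphi_k\sin(\omega_kt+\psi_k)$ with $0<\omega_k<\bar\omega$. Let $\theta=(\theta_1,\dots,\theta_l)$ be given by $\prod_{k=1}^l(s^2+\omega_k^2)=s^{2l}+\sum_{k=1}^l\theta_ks^{2(l-k)}$, and let $\pi=\sum_{k=1}^l\binom lk^2\bar\omega^{4k}$. For $i=1,\dots,N$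 let $a_i=(a_{i,1},\dots,a_{i,n})\in\mathbb R^n$ be such that all roots of $\lambda^n+a_{i,1}\lambda^{n-1}+\dots+a_{i,n}$ have negative real part. Let $A_i\in\mathbb R^{n\times n}$ be the matrix with first column $-a_i$ whose remaining columns are those of $I_{n-1}$ above a zero row. Let $B_i\in\mathbb R^n$ have entries $(B_i)_j=a_{i,j+1}-a_{i,j}a_{i,1}$ for $j<n$ and $(B_i)_n=-a_{i,n}a_{i,1}$. Let $E=(1,0,\dots,0)^T\in\mathbb R^n$, and let $F\in\mathbb R^{l\times n}$ be the matrix $\mathrm{blkdiag}(I_{l-1}\otimes[-1,0],-1)$. Let $\kappa>0$ and $$\mu>\frac{2\bar a\lambda_1+(1+\pi)\lambda_1^2+\bar\gamma_1^2+\bar\gamma_2^2}{2\lambda_1^2},$$ where $\bar a=\max_ia_{i,1}$, $\bar\gamma_1=\max_i\|E^T(sI-A_i)^{-1}B_i\|_\infty$ and $\bar\gamma_2=\max_i\|F(sI-A_i^T)^{-1}E\|_\infty$, with $\|\cdot\|_\infty$ the $H_\infty$ norm (the supremum over the imaginary axis of the largest singular value). For $i=1,\dots,N$ let $\eta_i,\chi_i:[0,\infty)\to\mathbb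 R^n$ be any solutions of $$\dot\eta_i=A_i\eta_i+B_iy_{N+1},\qquad \dot\chi_i=A_i^T\chi_i+Ey_{N+1}.$$ Consider the distributed adaptive observer, where $\hat y_{N+1}=y_{N+1}$ and $i=1,\dots,N$: $$\dot{\hat\eta}_i=A_i\hat\eta_i+B_i\hat y_i,\qquad \dot{\hat\chi}_i=A_i^T\hat\chi_i+E\hat y_i,\qquad \dot{\hat\theta}_i=\kappa F\hat\chi_i\sum_{j\in\bar{\mathcal N}_i}(\hat y_j-\hat y_i),$$ $$\dot{\hat y}_i=E^T\hat\eta_i+a_{i,1}\hat y_i+\hat\chi_i^TF^T\hat\theta_i+\mu\sum_{j\in\bar{\mathcal N}_i}(\hat y_j-\hat y_i).$$ Then for all initial values $\hat\eta_i(0),\hat\chi_i(0)\in\mathbb R^n$, $\hat\theta_i(0)\in\mathbb R^l$, $\hat y_i(0)\in\mathbb R$ the observer has a solution on $[0,\infty)$ with these initial values. For every such solution and every $i=1,\dots,N$, the functions $\hat y_i$, $\hat\eta_i$, $\hat\eta_i-\eta_i$, $\hat\chi_i$ and $\hat\theta_i$ are bounded on $[0,\infty)$, and as $t\to\infty$ $$\hat\eta_i(t)-\eta_i(t)\to0,\quad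 \hat\chi_i(t)-\chi_i(t)\to0,\quad \hat y_i(t)-y_{N+1}(t)\to0,\quad \hat\chi_i(t)^TF^T\bigl(\hat\theta_i(t)-\theta\bigr)\to0.$$ -/

import Mathlib

open scoped Matrix

/-! ### The communication network: followers `0, …, N - 1` and the leader `Fin.last N` -/

/-- `T` is an arborescence with root `r`: no edge enters `r`, exactly one edge enters every other
vertex, and every vertex is reached from `r` by a directed path. -/
structure IsArborescence {V : Type*} (T : Digraph V) (r : V) : Prop where
  root_no_in : ∀ v, ¬ T.Adj v r
  unique_in : ∀ v, v ≠ r → ∃! u, T.Adj u v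
  reachable : ∀ v, Relation.ReflTransGen T.Adj r v

/-- A leader-follower network with `N` followers; `G.Adj j i` means that agent `i` receives
information from agent `j`. There are no loops, the subgraph induced by the followers is undirected,
and the network contains a spanning arborescence whose root is the leader. -/
structure IsLeaderFollowerNetwork {N : ℕ} (G : Digraph (Fin (N + 1))) : Prop where
  loopless : ∀ v, ¬ G.Adj v v
  follower_symm : ∀ i j : Fin N, G.Adj i.castSucc j.castSucc → G.Adj j.castSucc i.castSucc
  spanning : ∃ T : Digraph (Fin (N + 1)), T ≤ G ∧ IsArborescence T (Fin.last N)

open Classical in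
/-- The neighbourhood `{j | (j, i) is an edge}` of agent `i`. -/
noncomputable def nbhd {N : ℕ} (G : Digraph (Fin (N + 1))) (i : Fin (N + 1)) :
    Finset (Fin (N + 1)) :=
  Finset.univ.filter fun j => G.Adj j i

open Classical in
/-- The Laplacian matrix of the network. -/
noncomputable def networkLaplacian {N : ℕ} (G : Digraph (Fin (N + 1))) :
    Matrix (Fin (N + 1)) (Fin (N + 1)) ℝ :=
  Matrix.of fun i j =>
    if i = j then ((nbhd G i).card : ℝ) else if j ∈ nbhd G i then -1 else 0

/-- The matrix `H`: the Laplacian without the row and the column of the leader. -/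
noncomputable def followerMatrix {N : ℕ} (G : Digraph (Fin (N + 1))) :
    Matrix (Fin N) (Fin N) ℝ :=
  (networkLaplacian G).submatrix Fin.castSucc Fin.castSucc

/-- The smallest eigenvalue of `H`. -/
noncomputable def lambdaOne {N : ℕ} (G : Digraph (Fin (N + 1))) : ℝ :=
  sInf (spectrum ℝ (followerMatrix G))

/-- `z_i = ∑_{j ∈ nbhd i} (ŷ_j - ŷ_i)` for follower `i`, where `yh` lists the outputs `ŷ_j` of the
followers and the output of the leader is its signal `y`. -/
noncomputable def relativeOutput {N : ℕ} (G : Digraph (Fin (N + 1))) (yh : Fin N → ℝ) (y : ℝ)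
    (i : Fin N) : ℝ :=
  ∑ j ∈ nbhd G i.castSucc, (Fin.snoc (α := fun _ => ℝ) yh y j - yh i)

/-! ### The leader -/

/-- The signal `∑ k, φ_k sin (ω_k t + ψ_k)` of the leader. -/
noncomputable def leaderSignal {l : ℕ} (φ ω ψ : Fin l → ℝ) (t : ℝ) : ℝ :=
  ∑ k, φ k * Real.sin (ω k * t + ψ k)

/-- The parameters `θ_1, …, θ_l` of the leader (indexed from `0`), determined by
`∏ k, (s² + ω_k²) = s^{2l} + θ_1 s^{2(l-1)} + θ_2 s^{2(l-2)} + ⋯ + θ_l`. -/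
noncomputable def leaderTheta {l : ℕ} (ω : Fin l → ℝ) : Fin l → ℝ := fun k =>
  (∏ j, ((Polynomial.X : Polynomial ℝ) ^ 2 + Polynomial.C (ω j ^ 2))).coeff
    (2 * (l - ((k : ℕ) + 1)))

/-- The bound `π = ∑_{k=1}^{l} (l choose k)² ω̄^{4k}`. -/
noncomputable def thetaBound (l : ℕ) (ωbar : ℝ) : ℝ :=
  ∑ k ∈ Finset.Icc 1 l, ((l.choose k : ℕ) : ℝ) ^ 2 * ωbar ^ (4 * k)

/-! ### The matrices of the observer -/

instance neZero_two_mul_sub_one (l : ℕ) [NeZero l] : NeZero (2 * l - 1) :=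
  ⟨by have := NeZero.pos l; omega⟩

/-- All complex roots of `s^n + a_1 s^{n-1} + ⋯ + a_n` (coefficients indexed from `0`) have negative
real part. -/
def IsHurwitzCoeffs {n : ℕ} (a : Fin n → ℝ) : Prop :=
  ∀ s : ℂ, s ^ n + ∑ j : Fin n, (a j : ℂ) * s ^ (n - 1 - (j : ℕ)) = 0 → s.re < 0

/-- The `n × n` matrix with first column `-a`, followed by the columns of `I_{n-1}` over a zero
row. -/
def obsA {n : ℕ} (a : Fin n → ℝ) : Matrix (Fin n) (Fin n) ℝ :=
  Matrix.of fun i j =>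
    if (j : ℕ) = 0 then -a i else if (j : ℕ) = (i : ℕ) + 1 then 1 else 0

/-- The vector `(a_2 - a_1 a_1, a_3 - a_2 a_1, …, a_n - a_{n-1} a_1, -a_n a_1)`. -/
def obsB {n : ℕ} [NeZero n] (a : Fin n → ℝ) : Fin n → ℝ := fun i =>
  (if h : (i : ℕ) + 1 < n then a ⟨(i : ℕ) + 1, h⟩ else 0) - a i * a 0

/-- The vector `(1, 0, …, 0)`. -/
def obsE (n : ℕ) : Fin n → ℝ := fun i => if (i : ℕ) = 0 then 1 else 0

/-- The `l × (2l - 1)` matrix `blkdiag (I_{l-1} ⊗ [-1, 0], -1)`. -/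
def obsF (l : ℕ) : Matrix (Fin l) (Fin (2 * l - 1)) ℝ :=
  Matrix.of fun k j => if (j : ℕ) = 2 * (k : ℕ) then -1 else 0

/-! ### The `H∞` norms and the lower bound of the gain `μ` -/

/-- The transfer matrix `s ↦ C (s I - A)⁻¹ B`. -/
noncomputable def transferMatrix {p n q : ℕ} (C : Matrix (Fin p) (Fin n) ℝ)
    (A : Matrix (Fin n) (Fin n) ℝ) (B : Matrix (Fin n) (Fin q) ℝ) (s : ℂ) :
    Matrix (Fin p) (Fin q) ℂ :=
  C.map Complex.ofReal * (s • (1 : Matrix (Fin n) (Fin n) ℂ) - A.map Complex.ofReal)⁻¹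
    * B.map Complex.ofReal

open scoped Matrix.Norms.L2Operator in
/-- The `H∞` norm of a stable proper rational transfer matrix: the supremum over real `w` of the
largest singular value of `G (i w)`. -/
noncomputable def hInfNorm {p q : ℕ} (G : ℂ → Matrix (Fin p) (Fin q) ℂ) : ℝ :=
  ⨆ w : ℝ, ‖G (Complex.I * (w : ℂ))‖

/-- `γ_{i,1} = ‖Eᵀ (s I - A_i)⁻¹ B_i‖_∞`, as a function of `a_i`. -/
noncomputable def gammaOne {n : ℕ} [NeZero n] (a : Fin n → ℝ) : ℝ :=
  hInfNorm (transferMatrix (Matrix.replicateRow (Fin 1) (obsE n)) (obsA a)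
    (Matrix.replicateCol (Fin 1) (obsB a)))

/-- `γ_{i,2} = ‖F (s I - A_iᵀ)⁻¹ E‖_∞`, as a function of `a_i`. -/
noncomputable def gammaTwo {l : ℕ} (a : Fin (2 * l - 1) → ℝ) : ℝ :=
  hInfNorm (transferMatrix (obsF l) (obsA a)ᵀ
    (Matrix.replicateCol (Fin 1) (obsE (2 * l - 1))))

/-- `(2 ā λ₁ + (1 + π) λ₁² + γ̄₁² + γ̄₂²) / (2 λ₁²)`, where `ā`, `γ̄₁`, `γ̄₂` are the maxima over the
followers of `a_{i,1}`, `γ_{i,1}`, `γ_{i,2}`. -/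
noncomputable def gainBound {N l : ℕ} [NeZero l] (G : Digraph (Fin (N + 1))) (ωbar : ℝ)
    (a : Fin N → Fin (2 * l - 1) → ℝ) : ℝ :=
  (2 * (⨆ i, a i 0) * lambdaOne G + (1 + thetaBound l ωbar) * lambdaOne G ^ 2
      + (⨆ i, gammaOne (a i)) ^ 2 + (⨆ i, gammaTwo (a i)) ^ 2) / (2 * lambdaOne G ^ 2)

/-! ### Trajectories on `[0, ∞)` -/

/-- `η' = A η + B y` and `χ' = Aᵀ χ + E y` on `[0, ∞)`, with the matrices of the vector `a`:
the filtered transformation of the signal `y`. -/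
structure IsFilterTrajectory {n : ℕ} [NeZero n] (a : Fin n → ℝ) (y : ℝ → ℝ)
    (η χ : ℝ → Fin n → ℝ) : Prop where
  eta : ∀ t, 0 ≤ t → HasDerivWithinAt η (obsA a *ᵥ η t + y t • obsB a) (Set.Ici 0) t
  chi : ∀ t, 0 ≤ t → HasDerivWithinAt χ ((obsA a)ᵀ *ᵥ χ t + y t • obsE n) (Set.Ici 0) t

/-- A solution on `[0, ∞)` of the distributed adaptive observer, driven by the leader's signal
`y`. -/
structure IsObserverTrajectory {N l : ℕ} [NeZero l] (G : Digraph (Fin (N + 1)))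
    (a : Fin N → Fin (2 * l - 1) → ℝ) (κ μ : ℝ) (y : ℝ → ℝ)
    (ηh χh : Fin N → ℝ → Fin (2 * l - 1) → ℝ) (θh : Fin N → ℝ → Fin l → ℝ)
    (yh : Fin N → ℝ → ℝ) : Prop where
  eta : ∀ i t, 0 ≤ t → HasDerivWithinAt (ηh i)
    (obsA (a i) *ᵥ ηh i t + yh i t • obsB (a i)) (Set.Ici 0) t
  chi : ∀ i t, 0 ≤ t → HasDerivWithinAt (χh i)
    ((obsA (a i))ᵀ *ᵥ χh i t + yh i t • obsE (2 * l - 1)) (Set.Ici 0) t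
  theta : ∀ i t, 0 ≤ t → HasDerivWithinAt (θh i)
    ((κ * relativeOutput G (fun j => yh j t) (y t) i) • (obsF l *ᵥ χh i t)) (Set.Ici 0) t
  out : ∀ i t, 0 ≤ t → HasDerivWithinAt (yh i)
    (obsE (2 * l - 1) ⬝ᵥ ηh i t + a i 0 * yh i t + χh i t ⬝ᵥ ((obsF l)ᵀ *ᵥ θh i t)
      + μ * relativeOutput G (fun j => yh j t) (y t) i) (Set.Ici 0) t

/-- `f` is bounded on `[0, ∞)`. -/
def BoundedOnNonneg {E : Type*} [Norm E] (f : ℝ → E) : Prop :=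
  ∃ C : ℝ, ∀ t, 0 ≤ t → ‖f t‖ ≤ C

/-!
Every follower runs two filters `η`, `χ` that would reconstruct the leader's signal `y` from `y`
itself. For a sum of sinusoids the filters have a bounded steady state `(η*, χ*)`, and for it
`y' = Eᵀ η* + a₁ y + (χ*)ᵀ Fᵀ θ` holds exactly (`exists_isSteadyState`). It suffices to check this for
one harmonic at a time (`exists_harmonic_steady_state`): there it says that `i ω_k` is a root of the
polynomial `∏ (s² + ω_k²)` with coefficients `θ`. Any filter trajectory tends to the steady state,
because the filters are stable.

Let `e = ŷ - y`, let `η`, `χ` now be the deviations of the estimates from the steady states, and let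
`ϑ = θ̂ - θ`. With the follower matrix `H`, which is positive definite because the leader reaches
every follower (`followerMatrix_posDef`), the relative outputs are `-H e`, and
`IsObserverOn.isErrorTrajectory` gives

* `η_i' = A_i η_i + B_i e_i`, `χ_i' = A_iᵀ χ_i + E e_i`, `ϑ_i' = -κ (H e)_i F χ̂_i`,
* `e_i' = Eᵀ η_i + a_{i,1} e_i + (F χ_i)ᵀ θ - μ (H e)_i + (F χ̂_i)ᵀ ϑ_i`.

Along this system `½ eᵀ H e + (2 κ)⁻¹ ∑ |ϑ_i|²` has a derivative in which `ϑ` no longer occurs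
(`IsErrorTrajectory.hasDerivWithinAt_storage`). Young's inequality, the bound `|θ|² ≤ π`
(`sum_leaderTheta_sq_le`) and `λ₁ |e| ≤ |H e|` estimate it by a negative multiple of `|H e|²` plus
`½ ∑ (Eᵀ η_i)² + ½ ∑ |F χ_i|²` (`supplyRate_le`). The time integrals of the last two sums are at most
`(1 + δ) γ² ∫ |e|²` plus a constant, with `γ` the corresponding `H∞` norm, and the condition on `μ`
is what makes the total coefficient of `∫ |e|²` negative. So the storage function and `∫ |e|²` are
bounded (`exists_storage_bound`), hence so are all components of the error
(`exists_error_bound`), by constants that do not depend on the length of the time interval.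

That the `H∞` norm bounds the `L²` gain is proved without the Fourier transform on the line
(`exists_integral_sq_le`). After time `T` the input is switched off, and a free motion is added that
makes the trajectory periodic with a long period. The Fourier coefficients of a periodic trajectory
are those of its input multiplied by values of the transfer function on the imaginary axis, so
Parseval's identity gives the bound (`integral_sq_le_of_periodic`). The free motion costs the factor
`1 + δ` and the additive constant.

The a priori bound yields global solutions of the observer (`exists_global_solution`,
`exists_isObserverTrajectory`). All components of the error are bounded with bounded derivatives, so
Barbalat's lemma (`BoundedLipschitz.tendsto_zero`) applied to `∫ |e|²` gives `e → 0`; the stable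
filters follow, `η, χ → 0`. Barbalat's lemma applied to `e_i` gives `e_i' → 0`, and in the equation
for `e_i'` all terms but `(F χ̂_i)ᵀ ϑ_i` are already known to vanish in the limit
(`IsErrorTrajectory.convergence`).
-/

/-! ### Exponential stability of linear systems -/

open Filter Topology Set in
/-- If every eigenvalue of `L` has negative real part, some `exp (T L)` with `T > 0` is a strict
contraction: the eigenvalues of `exp L` are the `exp s`, and Gelfand's formula applies. -/
theorem exists_norm_exp_pow_lt {E : Type*} [NormedAddCommGroup E] [NormedSpace ℂ E]
    [FiniteDimensional ℂ E] (L : E →L[ℂ] E)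
    (hL : ∀ (s : ℂ) (v : E), L v = s • v → v ≠ 0 → s.re < 0) :
    ∃ k : ℕ, 0 < k ∧ ‖NormedSpace.exp L ^ k‖ < 1 := by
  have : CompleteSpace E := FiniteDimensional.complete ℂ E
  rcases subsingleton_or_nontrivial E with hE | hE
  · refine ⟨1, one_pos, ?_⟩
    have : NormedSpace.exp L ^ 1 = 0 := by ext x; exact Subsingleton.elim _ _
    rw [this]; simp
  have key : ∀ z ∈ spectrum ℂ (NormedSpace.exp L), ‖z‖₊ < 1 := by
    intro z hz
    set S := NormedSpace.exp L with hS
    have hcomm : Commute L S := (Commute.refl L).exp_right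
    -- the eigenspace of `exp L` is nonzero and invariant under `L`
    let W : Submodule ℂ E := LinearMap.ker ((algebraMap ℂ (E →L[ℂ] E) z - S : E →L[ℂ] E) : E →ₗ[ℂ] E)
    have hW : W ≠ ⊥ := by
      intro hbot
      apply hz
      have hinj : Function.Injective ((algebraMap ℂ (E →L[ℂ] E) z - S : E →L[ℂ] E) : E →ₗ[ℂ] E) :=
        LinearMap.ker_eq_bot.1 hbot
      refine ContinuousLinearMap.isUnit_iff_bijective.2 ?_
      exact ⟨hinj, LinearMap.injective_iff_surjective.1 hinj⟩
    have hmem : ∀ x : E, x ∈ W ↔ S x = z • x := by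
      intro x
      simp only [W, LinearMap.mem_ker]
      constructor
      · intro h
        have : z • x - S x = 0 := by simpa [Algebra.algebraMap_eq_smul_one] using h
        exact (sub_eq_zero.1 this).symm
      · intro h
        simp [Algebra.algebraMap_eq_smul_one, h]
    have hinv : ∀ x ∈ W, (L : E →ₗ[ℂ] E) x ∈ W := by
      intro x hx
      rw [hmem] at hx ⊢
      have : S (L x) = L (S x) := by
        have := congrArg (fun f : E →L[ℂ] E => f x) hcomm.eq
        simpa using this.symm
      simp [this, hx]
    have : Nontrivial W := Submodule.nontrivial_iff_ne_bot.2 hW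
    obtain ⟨s, hs⟩ := Module.End.exists_eigenvalue ((L : E →ₗ[ℂ] E).restrict hinv)
    obtain ⟨v, hv⟩ := hs.exists_hasEigenvector
    have hv1 : L v = s • (v : E) := by
      have := congrArg (Subtype.val) hv.apply_eq_smul
      simpa using this
    have hv0 : (v : E) ≠ 0 := by simpa using hv.2
    have hre := hL s v hv1 hv0
    have hSv : S v = NormedSpace.exp s • (v : E) := by
      have hpow : ∀ m : ℕ, (L ^ m) (v : E) = s ^ m • (v : E) := by
        intro m
        induction m with
        | zero => simp
        | succ m ih => rw [pow_succ']; simp [ih, hv1, pow_succ, smul_smul]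
      have h1 := (NormedSpace.exp_series_hasSum_exp' (𝕂 := ℂ) L)
      have h2 := h1.mapL (ContinuousLinearMap.apply ℂ E (v : E))
      have h3 := (NormedSpace.exp_series_hasSum_exp' (𝕂 := ℂ) s).smul_const (v : E)
      refine h2.unique ?_
      convert h3 using 2 with m
      simp [hpow, smul_smul]
    have hz' : z = Complex.exp s := by
      have h1 : S v = z • (v : E) := (hmem _).1 v.2
      rw [hSv, ← Complex.exp_eq_exp_ℂ] at h1
      exact (smul_left_injective ℂ hv0 h1).symm
    have : ‖z‖ < 1 := by
      rw [hz', Complex.norm_exp]; exact Real.exp_lt_one_iff.2 hre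
    exact_mod_cast this
  have hrad : spectralRadius ℂ (NormedSpace.exp L) < 1 := by
    have := spectrum.spectralRadius_lt_of_forall_lt (NormedSpace.exp L) (r := 1) key
    simpa using this
  have hG := spectrum.pow_nnnorm_pow_one_div_tendsto_nhds_spectralRadius (NormedSpace.exp L)
  obtain ⟨k, hk1, hk2⟩ := ((hG.eventually (gt_mem_nhds hrad)).and (eventually_gt_atTop 0)).exists
  refine ⟨k, hk2, ?_⟩
  have hk3 : (‖NormedSpace.exp L ^ k‖₊ : ENNReal) < 1 := by
    by_contra! h
    have := ENNReal.one_le_rpow h (z := 1 / (k : ℝ)) (by positivity)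
    exact absurd hk1 (not_lt.2 this)
  exact_mod_cast hk3

open Set in
/-- Exponential decay of `exp (t L)` when every eigenvalue of `L` has negative real part. -/
theorem exists_norm_exp_le {E : Type*} [NormedAddCommGroup E] [NormedSpace ℂ E]
    [FiniteDimensional ℂ E] (L : E →L[ℂ] E)
    (hL : ∀ (s : ℂ) (v : E), L v = s • v → v ≠ 0 → s.re < 0) :
    ∃ M α : ℝ, 0 < M ∧ 0 < α ∧ ∀ t : ℝ, 0 ≤ t →
      ‖NormedSpace.exp (t • L)‖ ≤ M * Real.exp (-(α * t)) := by
  have : CompleteSpace E := FiniteDimensional.complete ℂ E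
  obtain ⟨k, hk, hlt⟩ := exists_norm_exp_pow_lt L hL
  let : NormedAlgebra ℚ (E →L[ℂ] E) := .restrictScalars ℚ ℂ _
  -- enlarge the contraction factor to make it positive
  obtain ⟨q, hq1, hq2⟩ := exists_between (max_lt hlt (zero_lt_one))
  have hq0 : 0 < q := (le_max_right _ _).trans_lt hq1
  have hqk : ‖NormedSpace.exp L ^ k‖ ≤ q := ((le_max_left _ _).trans_lt hq1).le
  have hk' : (0 : ℝ) < k := by exact_mod_cast hk
  set α : ℝ := -Real.log q / k with hα
  have hα0 : 0 < α := div_pos (neg_pos.2 (Real.log_neg hq0 hq2)) hk'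
  have hcont : Continuous fun t : ℝ => NormedSpace.exp (t • L) := by
    have := NormedSpace.exp_continuous (𝔸 := E →L[ℂ] E)
    exact this.comp (by fun_prop)
  obtain ⟨M, hM⟩ := (isCompact_Icc (a := (0 : ℝ)) (b := k)).exists_bound_of_continuousOn
    hcont.continuousOn
  have hM0 : 0 ≤ M := (norm_nonneg _).trans (hM 0 ⟨le_rfl, hk'.le⟩)
  refine ⟨(M + 1) * Real.exp (α * k), α, by positivity, hα0, fun t ht => ?_⟩
  set m := ⌊t / k⌋₊ with hm
  have hm1 : (m : ℝ) * k ≤ t := by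
    have := Nat.floor_le (div_nonneg ht hk'.le)
    rwa [← hm, le_div_iff₀ hk'] at this
  have hm2 : t < (m + 1 : ℝ) * k := by
    have := Nat.lt_floor_add_one (t / k)
    rwa [← hm, div_lt_iff₀ hk'] at this
  have hsplit : NormedSpace.exp (t • L)
      = (NormedSpace.exp L ^ k) ^ m * NormedSpace.exp ((t - m * k) • L) := by
    have h1 : (NormedSpace.exp L ^ k) ^ m = NormedSpace.exp (((m : ℝ) * k) • L) := by
      rw [← pow_mul, ← NormedSpace.exp_nsmul]
      congr 1
      rw [← Nat.cast_smul_eq_nsmul ℝ]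
      push_cast; rw [mul_comm]
    rw [h1, ← NormedSpace.exp_add_of_commute]
    · rw [← add_smul]; congr 2; ring
    · exact (Commute.refl L).smul_left _ |>.smul_right _
  have h2 : ‖NormedSpace.exp ((t - m * k) • L)‖ ≤ M := hM _ ⟨by linarith, by nlinarith⟩
  have h3 : ‖(NormedSpace.exp L ^ k) ^ m‖ ≤ q ^ m := by
    rcases Nat.eq_zero_or_pos m with h0 | h0
    · rw [h0, pow_zero, pow_zero]; exact ContinuousLinearMap.norm_id_le
    · exact (norm_pow_le' _ h0).trans (pow_le_pow_left₀ (norm_nonneg _) hqk m)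
  have h4 : q ^ m ≤ Real.exp (α * k) * Real.exp (-(α * t)) := by
    rw [← Real.exp_add]
    have : q ^ m = Real.exp (Real.log q * m) := by
      rw [mul_comm, Real.exp_nat_mul, Real.exp_log hq0]
    rw [this]
    apply Real.exp_le_exp.2
    have hlog : Real.log q = -(α * k) := by rw [hα]; field_simp
    rw [hlog]
    nlinarith
  calc ‖NormedSpace.exp (t • L)‖ ≤ q ^ m * M := by
        rw [hsplit]
        exact (norm_mul_le _ _).trans (mul_le_mul h3 h2 (norm_nonneg _) (by positivity))
    _ ≤ (Real.exp (α * k) * Real.exp (-(α * t))) * (M + 1) :=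
        mul_le_mul h4 (by linarith) hM0 (by positivity)
    _ = _ := by ring

open Set in
/-- Input-to-state estimate for `x' = L x + r`: variation of constants, with the integral replaced
by a comparison function. -/
theorem norm_le_of_hasDeriv_right_linear {E : Type*} [NormedAddCommGroup E] [NormedSpace ℂ E]
    [CompleteSpace E] {L : E →L[ℂ] E} {M α : ℝ} (hM : 0 < M) (hα : 0 < α)
    (hL : ∀ t : ℝ, 0 ≤ t → ‖NormedSpace.exp (t • L)‖ ≤ M * Real.exp (-(α * t)))
    {x r : ℝ → E} {a b U : ℝ} (hab : a ≤ b) (hx : ContinuousOn x (Icc a b))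
    (hx' : ∀ t ∈ Ico a b, HasDerivWithinAt x (L (x t) + r t) (Ici t) t)
    (hU : ∀ t ∈ Ico a b, ‖r t‖ ≤ U) (hU0 : 0 ≤ U) :
    ‖x b‖ ≤ M * Real.exp (-(α * (b - a))) * ‖x a‖ + M * U / α := by
  have hexp : ∀ s : ℝ, HasDerivAt (fun s : ℝ => NormedSpace.exp ((b - s) • L))
      (-(NormedSpace.exp ((b - s) • L) * L)) s := by
    intro s
    have h1 := hasDerivAt_exp_smul_const (𝕂 := ℝ) L (b - s)
    have h2 : HasDerivAt (fun s : ℝ => b - s) (-1) s := by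
      simpa using (hasDerivAt_id s).const_sub b
    refine HasDerivAt.congr_deriv (f := fun s : ℝ => NormedSpace.exp ((b - s) • L))
      (h1.scomp s h2) ?_
    simp
  have hexpc : Continuous fun s : ℝ => NormedSpace.exp ((b - s) • L) :=
    continuous_iff_continuousAt.2 fun s => (hexp s).continuousAt
  set g : ℝ → E := fun s => NormedSpace.exp ((b - s) • L) (x s) with hg
  have hgc : ContinuousOn g (Icc a b) := hexpc.continuousOn.clm_apply hx
  have hg' : ∀ s ∈ Ico a b,
      HasDerivWithinAt g (NormedSpace.exp ((b - s) • L) (r s)) (Ici s) s := by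
    intro s hs
    have h1 : HasDerivWithinAt (fun s : ℝ => (NormedSpace.exp ((b - s) • L)).restrictScalars ℝ)
        ((-(NormedSpace.exp ((b - s) • L) * L)).restrictScalars ℝ) (Ici s) s := by
      have := (ContinuousLinearMap.restrictScalarsL ℂ E E ℝ ℝ).hasFDerivAt.comp_hasDerivAt s
        (hexp s)
      exact this.hasDerivWithinAt
    have h2 := h1.clm_apply (hx' s hs)
    refine HasDerivWithinAt.congr_deriv (f := g) h2 ?_
    change -(NormedSpace.exp ((b - s) • L)) (L (x s))
      + (NormedSpace.exp ((b - s) • L)) (L (x s) + r s) = _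
    rw [map_add]; abel
  have hB : ∀ s : ℝ, HasDerivAt (fun s : ℝ => M * Real.exp (-(α * (b - a))) * ‖x a‖
      + M * U / α * (Real.exp (-(α * (b - s))) - Real.exp (-(α * (b - a)))))
      (M * U * Real.exp (-(α * (b - s)))) s := by
    intro s
    have h2 : HasDerivAt (fun s : ℝ => -(α * (b - s))) α s := by
      refine HasDerivAt.congr_deriv (f := fun s : ℝ => -(α * (b - s)))
        (((hasDerivAt_id s).const_sub b).const_mul α).neg ?_
      simp
    have h3 := ((h2.exp.sub_const (Real.exp (-(α * (b - a))))).const_mul (M * U / α)).const_add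
      (M * Real.exp (-(α * (b - a))) * ‖x a‖)
    refine h3.congr_deriv ?_
    field_simp
  have key := image_norm_le_of_norm_deriv_right_le_deriv_boundary hgc hg' (B := fun s : ℝ =>
      M * Real.exp (-(α * (b - a))) * ‖x a‖
      + M * U / α * (Real.exp (-(α * (b - s))) - Real.exp (-(α * (b - a)))))
      (by
        simp only [sub_self, mul_zero, add_zero, hg]
        exact (ContinuousLinearMap.le_opNorm _ _).trans
          (mul_le_mul_of_nonneg_right (hL _ (by linarith)) (norm_nonneg _)))
      hB
      (by
        intro s hs
        have h1 := hL (b - s) (by linarith [hs.2])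
        calc _ ≤ ‖NormedSpace.exp ((b - s) • L)‖ * ‖r s‖ := ContinuousLinearMap.le_opNorm _ _
          _ ≤ (M * Real.exp (-(α * (b - s)))) * U :=
            mul_le_mul h1 (hU s hs) (norm_nonneg _) (by positivity)
          _ = _ := by ring)
      (right_mem_Icc.2 hab)
  have hgb : g b = x b := by simp [hg]
  rw [hgb] at key
  refine key.trans (add_le_add le_rfl ?_)
  have h1 : Real.exp (-(α * (b - b))) - Real.exp (-(α * (b - a))) ≤ 1 := by
    have := Real.exp_pos (-(α * (b - a)))
    simp; linarith
  calc _ ≤ M * U / α * 1 := mul_le_mul_of_nonneg_left h1 (by positivity)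
    _ = _ := mul_one _

/-- `exp (t L) v` solves the homogeneous equation. -/
theorem hasDerivAt_exp_smul_apply {E : Type*} [NormedAddCommGroup E] [NormedSpace ℂ E]
    [CompleteSpace E] (L : E →L[ℂ] E) (v : E) (t : ℝ) :
    HasDerivAt (fun t : ℝ => NormedSpace.exp (t • L) v) (L (NormedSpace.exp (t • L) v)) t := by
  have h1 := hasDerivAt_exp_smul_const' (𝕂 := ℝ) L t
  have h2 := (((ContinuousLinearMap.apply ℂ E v).restrictScalars ℝ).hasFDerivAt).comp_hasDerivAt t h1
  exact h2

/-! ### The `L²` gain of a stable linear system -/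

open MeasureTheory Set in
/-- The `L²` gain of a periodic solution: by Parseval's identity it suffices to compare Fourier
coefficients, and those of `x` are obtained from those of the input by the resolvent of `L`. -/
theorem integral_sq_le_of_periodic {E ι : Type*} [NormedAddCommGroup E] [NormedSpace ℂ E]
    [CompleteSpace E] [Fintype ι] {L : E →L[ℂ] E} {b : E} {C : ι → E →L[ℂ] ℂ} {γ : ℝ}
    (hγ : ∀ (w : ℝ) (v : E) (c : ℂ), (Complex.I * w) • v - L v = c • b →
      ∑ k, ‖C k v‖ ^ 2 ≤ γ ^ 2 * ‖c‖ ^ 2)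
    {P : ℝ} (hP : 0 < P) {x : ℝ → E} {u : ℝ → ℂ} (hx : ContinuousOn x (Icc 0 P))
    (hu : MemLp u 2 (volume.restrict (Ioc 0 P)))
    (hx' : ∀ t ∈ Ico 0 P, HasDerivWithinAt x (L (x t) + u t • b) (Ici t) t)
    (hper : x P = x 0) :
    ∫ t in 0..P, ∑ k, ‖C k (x t)‖ ^ 2 ≤ γ ^ 2 * ∫ t in 0..P, ‖u t‖ ^ 2 := by
  have hxI : uIcc 0 P = Icc 0 P := uIcc_of_le hP.le
  have hui : IntervalIntegrable u volume 0 P := by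
    rw [intervalIntegrable_iff_integrableOn_Ioc_of_le hP.le]
    exact hu.integrable (by norm_num)
  have hCx : ∀ k, ContinuousOn (fun t => C k (x t)) (Icc 0 P) := fun k =>
    (C k).continuous.comp_continuousOn hx
  have hmem : ∀ k, MemLp (fun t => C k (x t)) 2 (volume.restrict (Ioc 0 P)) := by
    intro k
    obtain ⟨c, hc⟩ := isCompact_Icc.exists_bound_of_continuousOn (hCx k)
    refine MemLp.of_bound (((hCx k).mono Ioc_subset_Icc_self).aestronglyMeasurable
      measurableSet_Ioc) c ?_
    exact (ae_restrict_iff' measurableSet_Ioc).2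
      (Filter.Eventually.of_forall fun t ht => hc t (Ioc_subset_Icc_self ht))
  have hsum := hasSum_sum (s := Finset.univ) fun k _ => hasSum_sq_fourierCoeffOn hP (hmem k)
  have hsumu := (hasSum_sq_fourierCoeffOn hP hu).mul_left (γ ^ 2)
  have hle := hasSum_le (fun n => ?_) hsum hsumu
  · have h1 : ∫ t in 0..P, ∑ k, ‖C k (x t)‖ ^ 2 = ∑ k, ∫ t in 0..P, ‖C k (x t)‖ ^ 2 := by
      refine intervalIntegral.integral_finsetSum fun k _ => ?_
      refine ContinuousOn.intervalIntegrable ?_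
      rw [hxI]; exact ((hCx k).norm.pow 2)
    rw [h1]
    simp only [sub_zero, smul_eq_mul, ← Finset.mul_sum] at hle
    rw [mul_left_comm] at hle
    exact le_of_mul_le_mul_left hle (inv_pos.2 hP)
  · set w : ℝ := 2 * Real.pi * n / P with hw
    set e : ℝ → ℂ := fun t => Complex.exp (-(Complex.I * w) * t) with he
    have hfour : ∀ t : ℝ, (fourier (-n) (t : AddCircle (P - 0)) : ℂ) = e t := by
      intro t
      rw [fourier_coe_apply, he]
      congr 1
      push_cast [hw]
      ring_nf
    have hec : Continuous e := by rw [he]; fun_prop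
    have he' : ∀ t : ℝ, HasDerivAt e (-(Complex.I * w) * e t) t := by
      intro t
      have h1 : HasDerivAt (fun t : ℝ => -(Complex.I * w) * (t : ℂ)) (-(Complex.I * w)) t := by
        simpa using (Complex.ofRealCLM.hasDerivAt (x := t)).const_mul (-(Complex.I * w))
      have := h1.cexp
      rw [mul_comm]
      exact this
    -- up to the factor `1 / P`, the `n`-th Fourier coefficients of `x` and `u`; periodicity kills the
    -- boundary term in the integration by parts, so that `(i w - L) X = V b`
    set X : E := ∫ t in 0..P, e t • x t with hX
    set V : ℂ := ∫ t in 0..P, e t • u t with hV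
    have hXi : IntervalIntegrable (fun t => e t • x t) volume 0 P := by
      refine ContinuousOn.intervalIntegrable ?_
      rw [hxI]; exact hec.continuousOn.smul hx
    have hVi : IntervalIntegrable (fun t => e t • u t) volume 0 P :=
      hui.continuousOn_mul hec.continuousOn
    have hLX : L X = ∫ t in 0..P, e t • L (x t) := by
      rw [hX, ← ContinuousLinearMap.intervalIntegral_comp_comm L hXi]
      exact intervalIntegral.integral_congr fun t _ => L.map_smul _ _
    have hVbi : IntervalIntegrable (fun t => (e t • u t) • b) volume 0 P :=
      ⟨hVi.1.smul_const b, hVi.2.smul_const b⟩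
    have hLXi : IntervalIntegrable (fun t => e t • L (x t)) volume 0 P := by
      refine ContinuousOn.intervalIntegrable ?_
      rw [hxI]; exact hec.continuousOn.smul (L.continuous.comp_continuousOn hx)
    have hFTC : (0 : E) = -((Complex.I * w) • X) + L X + V • b := by
      have h1 : ∫ t in 0..P, (-((Complex.I * w) • (e t • x t)) + e t • L (x t) + (e t • u t) • b)
          = e P • x P - e 0 • x 0 := by
        refine intervalIntegral.integral_eq_sub_of_hasDeriv_right (f := fun t => e t • x t) ?_ ?_ ?_
        · rw [hxI]; exact hec.continuousOn.smul hx
        · intro t ht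
          rw [min_eq_left hP.le, max_eq_right hP.le] at ht
          have h2 := ((he' t).hasDerivWithinAt (s := Ioi t)).smul
            ((hx' t ⟨ht.1.le, ht.2⟩).mono Ioi_subset_Ici_self)
          refine h2.congr_deriv ?_
          simp only [smul_add, smul_smul, smul_eq_mul, neg_mul, neg_smul]
          abel
        · exact ((hXi.smul (Complex.I * w)).neg.add hLXi).add hVbi
      have h3 : e P = 1 := by
        have := Complex.exp_int_mul_two_pi_mul_I (-n)
        rw [he]
        simp only
        rw [← this]
        congr 1
        have : (P : ℂ) ≠ 0 := by exact_mod_cast hP.ne'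
        push_cast [hw]
        field_simp
      have h4 : e 0 = 1 := by simp [he]
      rw [h3, h4, hper, sub_self, intervalIntegral.integral_add, intervalIntegral.integral_add,
        intervalIntegral.integral_neg, intervalIntegral.integral_smul,
        intervalIntegral.integral_smul_const, ← hLX] at h1
      · exact h1.symm
      · exact (hXi.smul (Complex.I * w)).neg
      · exact hLXi
      · exact (hXi.smul (Complex.I * w)).neg.add hLXi
      · exact hVbi
    have hgain := hγ w X V (by
      have : V • b = (Complex.I * w) • X - L X := by
        rw [eq_sub_iff_add_eq, ← sub_eq_zero, hFTC]; abel
      exact this.symm)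
    have hcx : ∀ k, fourierCoeffOn hP (fun t => C k (x t)) n = (P⁻¹ : ℂ) * C k X := by
      intro k
      rw [fourierCoeffOn_eq_integral, hX, ← ContinuousLinearMap.intervalIntegral_comp_comm _ hXi]
      simp only [hfour]
      simp
    have hcu : fourierCoeffOn hP u n = (P⁻¹ : ℂ) * V := by
      rw [fourierCoeffOn_eq_integral, hV]
      simp only [hfour]
      simp
    simp only [hcx, hcu, norm_mul, mul_pow, ← Finset.mul_sum]
    calc _ ≤ ‖(P⁻¹ : ℂ)‖ ^ 2 * (γ ^ 2 * ‖V‖ ^ 2) := mul_le_mul_of_nonneg_left hgain (by positivity)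
      _ = _ := by ring

open MeasureTheory Set in
/-- The `L²` gain on `[0, T]`, up to a constant that depends only on the size of the initial value.
The input is continued by `0` up to a large period `P`, at which the state has decayed; a free
motion `exp (t L) v` then makes the solution periodic, and its energy is bounded uniformly. -/
theorem exists_integral_sq_le {E ι : Type*} [NormedAddCommGroup E] [NormedSpace ℂ E]
    [FiniteDimensional ℂ E] [Fintype ι] {L : E →L[ℂ] E}
    (hL : ∀ (s : ℂ) (v : E), L v = s • v → v ≠ 0 → s.re < 0)
    {b : E} {C : ι → E →L[ℂ] ℂ} {γ : ℝ}
    (hγ : ∀ (w : ℝ) (v : E) (c : ℂ), (Complex.I * w) • v - L v = c • b →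
      ∑ k, ‖C k v‖ ^ 2 ≤ γ ^ 2 * ‖c‖ ^ 2) (R : ℝ) {δ : ℝ} (hδ : 0 < δ) :
    ∃ K : ℝ, ∀ (T : ℝ) (x : ℝ → E) (u : ℝ → ℂ), 0 ≤ T → ContinuousOn x (Icc 0 T) →
      ContinuousOn u (Icc 0 T) →
      (∀ t ∈ Ico 0 T, HasDerivWithinAt x (L (x t) + u t • b) (Ici t) t) → ‖x 0‖ ≤ R →
      ∫ t in 0..T, ∑ k, ‖C k (x t)‖ ^ 2 ≤ (1 + δ) * γ ^ 2 * (∫ t in 0..T, ‖u t‖ ^ 2) + K := by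
  have : CompleteSpace E := FiniteDimensional.complete ℂ E
  obtain ⟨M, α, hM, hα, hexp⟩ := exists_norm_exp_le L hL
  set S : ℝ := ∑ k, ‖C k‖ ^ 2 with hS
  have hS0 : 0 ≤ S := Finset.sum_nonneg fun k _ => by positivity
  have hR' : 0 ≤ max R 0 := le_max_right _ _
  set Q : ℝ := S * (M * (2 * (1 + max R 0))) ^ 2 with hQ
  refine ⟨(1 + δ⁻¹) * (Q / (2 * α)), fun T x u hT hx hu hx' hxR => ?_⟩
  -- the period `P` is so long that `exp (P L)` halves every norm and the free motion of `x T` has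
  -- entered the unit ball: this makes the correction `v` below independent of `T` and `x`
  have htend : Filter.Tendsto (fun P : ℝ => M * Real.exp (-(α * P))) Filter.atTop (nhds 0) := by
    have h1 : Filter.Tendsto (fun P : ℝ => -(α * P)) Filter.atTop Filter.atBot :=
      Filter.tendsto_neg_atTop_atBot.comp (Filter.tendsto_id.const_mul_atTop hα)
    simpa using (Real.tendsto_exp_atBot.comp h1).const_mul M
  have htend2 : Filter.Tendsto (fun P : ℝ => M * Real.exp (-(α * (P - T))) * ‖x T‖)
      Filter.atTop (nhds 0) := by
    simpa [sub_eq_add_neg] using (htend.comp (Filter.tendsto_atTop_add_const_right _ (-T) Filter.tendsto_id)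
      ).mul_const ‖x T‖
  obtain ⟨P, ⟨hP1, hP2⟩, hP3⟩ := (((htend.eventually_le_const (by norm_num : (0 : ℝ) < 1 / 2)).and
    (htend2.eventually_le_const one_pos)).and
    (Filter.eventually_gt_atTop T)).exists
  have hP0 : 0 < P := hT.trans_lt hP3
  -- with the input switched off after `T`, the trajectory goes on as a free motion
  set X : ℝ → E := fun t => if t ≤ T then x t else NormedSpace.exp ((t - T) • L) (x T) with hX
  have hXle : ∀ t, t ≤ T → X t = x t := fun t ht => if_pos ht
  have hXge : ∀ t, T ≤ t → X t = NormedSpace.exp ((t - T) • L) (x T) := by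
    intro t ht
    rcases ht.eq_or_lt with h | h
    · simp [hX, ← h]
    · simp [hX, not_le.2 h]
  have hfree : ∀ t : ℝ, HasDerivAt (fun t : ℝ => NormedSpace.exp ((t - T) • L) (x T))
      (L (NormedSpace.exp ((t - T) • L) (x T))) t := by
    intro t
    simpa using (hasDerivAt_exp_smul_apply L (x T) (t - T)).comp_sub_const t T
  have hXP : ‖X P‖ ≤ 1 := by
    rw [hXge P hP3.le]
    refine (ContinuousLinearMap.le_opNorm _ _).trans (le_trans ?_ hP2)
    exact mul_le_mul_of_nonneg_right (hexp _ (by linarith)) (norm_nonneg _)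
  -- the free motion that closes up the solution
  have hlt : ‖NormedSpace.exp (P • L)‖ < 1 := (hexp P hP0.le).trans_lt (by linarith)
  obtain ⟨v, hv⟩ : ∃ v : E, v - NormedSpace.exp (P • L) v = X P - x 0 := by
    have h1 : IsUnit (1 - NormedSpace.exp (P • L)) := isUnit_one_sub_of_norm_lt_one hlt
    obtain ⟨v, hv⟩ := (ContinuousLinearMap.isUnit_iff_bijective.1 h1).2 (X P - x 0)
    exact ⟨v, by simpa using hv⟩
  have hvnorm : ‖v‖ ≤ 2 * (1 + max R 0) := by
    have h1 : ‖NormedSpace.exp (P • L) v‖ ≤ 1 / 2 * ‖v‖ :=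
      (ContinuousLinearMap.le_opNorm _ _).trans
        (mul_le_mul_of_nonneg_right ((hexp P hP0.le).trans hP1) (norm_nonneg _))
    have h2 : ‖v‖ ≤ ‖X P - x 0‖ + ‖NormedSpace.exp (P • L) v‖ := by
      rw [← hv]; simpa using norm_add_le (v - NormedSpace.exp (P • L) v) (NormedSpace.exp (P • L) v)
    have h3 := norm_sub_le (X P) (x 0)
    have h4 := le_max_left R 0
    linarith
  set Y : ℝ → E := fun t => X t + NormedSpace.exp (t • L) v with hY
  set u1 : ℝ → ℂ := (Iio T).indicator u with hu1
  have hfv : Continuous fun t : ℝ => NormedSpace.exp (t • L) v :=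
    continuous_iff_continuousAt.2 fun t => (hasDerivAt_exp_smul_apply L v t).continuousAt
  have hXc : ContinuousOn X (Icc 0 P) := by
    rw [← Icc_union_Icc_eq_Icc hT hP3.le]
    refine ContinuousOn.union_of_isClosed ?_ ?_ isClosed_Icc isClosed_Icc
    · exact hx.congr fun t ht => hXle t ht.2
    · refine ContinuousOn.congr (f := fun t : ℝ => NormedSpace.exp ((t - T) • L) (x T)) ?_
        fun t ht => hXge t ht.1
      exact fun t _ => (hfree t).continuousAt.continuousWithinAt
  have hYc : ContinuousOn Y (Icc 0 P) := hXc.add hfv.continuousOn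
  have hY' : ∀ t ∈ Ico 0 P, HasDerivWithinAt Y (L (Y t) + u1 t • b) (Ici t) t := by
    intro t ht
    have hX' : HasDerivWithinAt X (L (X t) + u1 t • b) (Ici t) t := by
      rcases lt_or_ge t T with h | h
      · have h1 := hx' t ⟨ht.1, h⟩
        rw [hXle t h.le, hu1, indicator_of_mem (mem_Iio.2 h)]
        refine h1.congr_of_eventuallyEq ?_ (hXle t h.le)
        filter_upwards [mem_nhdsWithin_of_mem_nhds (Iio_mem_nhds h)] with s hs
        exact hXle s (le_of_lt hs)
      · rw [hXge t h, hu1, indicator_of_notMem (by simpa using h), zero_smul, add_zero]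
        exact (hfree t).hasDerivWithinAt.congr (fun s hs => hXge s (h.trans hs)) (hXge t h)
    refine (hX'.add (hasDerivAt_exp_smul_apply L v t).hasDerivWithinAt).congr_deriv ?_
    simp only [hY, map_add]; abel
  have hper : Y P = Y 0 := by
    have h0 : X 0 = x 0 := hXle 0 hT
    have h1 : X P = x 0 + (v - NormedSpace.exp (P • L) v) := by rw [hv]; abel
    simp only [hY, h0, zero_smul, NormedSpace.exp_zero, one_apply_eq_self]
    rw [h1]; abel
  obtain ⟨cu, hcu⟩ := isCompact_Icc.exists_bound_of_continuousOn hu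
  have hu1m : MemLp u1 2 (volume.restrict (Ioc 0 P)) := by
    have h1 : u1 =ᵐ[volume.restrict (Ioc 0 P)] (Icc 0 T).indicator u := by
      filter_upwards [ae_restrict_mem measurableSet_Ioc,
        ae_restrict_of_ae (Measure.ae_ne volume T)] with t ht htT
      by_cases h : t < T
      · rw [hu1, indicator_of_mem (mem_Iio.2 h), indicator_of_mem (mem_Icc.2 ⟨ht.1.le, h.le⟩)]
      · have h2 : T < t := lt_of_le_of_ne (not_lt.1 h) (Ne.symm htT)
        rw [hu1, indicator_of_notMem (by simpa using h2.le),
          indicator_of_notMem (by simp [h2])]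
    refine MemLp.ae_eq h1.symm ?_
    refine MemLp.of_bound ?_ (max cu 0) ?_
    · refine AEStronglyMeasurable.mono_measure ?_ Measure.restrict_le_self
      rw [aestronglyMeasurable_indicator_iff measurableSet_Icc]
      exact hu.aestronglyMeasurable measurableSet_Icc
    · refine Filter.Eventually.of_forall fun t => ?_
      by_cases h : t ∈ Icc 0 T
      · rw [indicator_of_mem h]; exact (hcu t h).trans (le_max_left _ _)
      · rw [indicator_of_notMem h]; simp
  have hmain := integral_sq_le_of_periodic hγ hP0 hYc hu1m hY' hper
  have hYi : IntervalIntegrable (fun t => ∑ k, ‖C k (Y t)‖ ^ 2) volume 0 P := by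
    refine ContinuousOn.intervalIntegrable ?_
    rw [uIcc_of_le hP0.le]
    exact continuousOn_finsetSum _ fun k _ =>
      (((C k).continuous.comp_continuousOn hYc).norm.pow 2)
  have hYT : ∫ t in 0..T, ∑ k, ‖C k (Y t)‖ ^ 2 ≤ ∫ t in 0..P, ∑ k, ‖C k (Y t)‖ ^ 2 :=
    intervalIntegral.integral_mono_interval le_rfl hT hP3.le
      (Filter.Eventually.of_forall fun t => Finset.sum_nonneg fun k _ => by positivity) hYi
  have hu1T : ∫ t in 0..P, ‖u1 t‖ ^ 2 = ∫ t in 0..T, ‖u t‖ ^ 2 := by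
    rw [intervalIntegral.integral_of_le hP0.le, intervalIntegral.integral_of_le hT,
      integral_Ioc_eq_integral_Ioo, integral_Ioc_eq_integral_Ioo (y := T)]
    have h1 : (fun t => ‖u1 t‖ ^ 2) = (Iio T).indicator fun t => ‖u t‖ ^ 2 := by
      funext t
      by_cases h : t ∈ Iio T
      · rw [hu1, indicator_of_mem h, indicator_of_mem h]
      · rw [hu1, indicator_of_notMem h, indicator_of_notMem h]; simp
    rw [h1, setIntegral_indicator measurableSet_Iio]
    congr 2
    ext t
    simp only [mem_inter_iff, mem_Ioo, mem_Iio]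
    exact ⟨fun h => ⟨h.1.1, h.2⟩, fun h => ⟨⟨h.1, h.2.trans hP3⟩, h.2⟩⟩
  -- Young's inequality for `x = Y - exp (t L) v`; the energy of the free motion is at most
  -- `Q / (2 α)`
  have hpoint : ∀ t ∈ Icc 0 T, ∑ k, ‖C k (x t)‖ ^ 2
      ≤ (1 + δ) * ∑ k, ‖C k (Y t)‖ ^ 2 + (1 + δ⁻¹) * (Q * Real.exp (-(2 * α) * t)) := by
    intro t ht
    have h1 : ∀ k, ‖C k (x t)‖ ^ 2 ≤ (1 + δ) * ‖C k (Y t)‖ ^ 2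
        + (1 + δ⁻¹) * ‖C k (NormedSpace.exp (t • L) v)‖ ^ 2 := by
      intro k
      have h2 : C k (x t) = C k (Y t) - C k (NormedSpace.exp (t • L) v) := by
        rw [← map_sub, hY]; simp [hXle t ht.2]
      have h3 := norm_sub_le (C k (Y t)) (C k (NormedSpace.exp (t • L) v))
      rw [← h2] at h3
      set p := ‖C k (Y t)‖
      set q := ‖C k (NormedSpace.exp (t • L) v)‖
      have h4 : ‖C k (x t)‖ ^ 2 ≤ (p + q) ^ 2 := pow_le_pow_left₀ (norm_nonneg _) h3 2
      have h5 : 0 ≤ δ⁻¹ * (δ * p - q) ^ 2 := by positivity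
      have h6 : δ⁻¹ * (δ * p - q) ^ 2 = δ * p ^ 2 - 2 * p * q + δ⁻¹ * q ^ 2 := by
        field_simp; ring
      nlinarith
    have h7 : ‖NormedSpace.exp (t • L) v‖
        ≤ M * Real.exp (-(α * t)) * (2 * (1 + max R 0)) :=
      (ContinuousLinearMap.le_opNorm _ _).trans
        (mul_le_mul (hexp t ht.1) hvnorm (norm_nonneg _) (by positivity))
    have h8 : ∀ k, ‖C k (NormedSpace.exp (t • L) v)‖ ^ 2 ≤
        ‖C k‖ ^ 2 * ((M * (2 * (1 + max R 0))) ^ 2 * Real.exp (-(2 * α) * t)) := by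
      intro k
      calc _ ≤ (‖C k‖ * (M * Real.exp (-(α * t)) * (2 * (1 + max R 0)))) ^ 2 :=
            pow_le_pow_left₀ (norm_nonneg _) (((C k).le_opNorm _).trans
              (mul_le_mul_of_nonneg_left h7 (norm_nonneg _))) 2
        _ = ‖C k‖ ^ 2 * ((M * (2 * (1 + max R 0))) ^ 2 * Real.exp (-(α * t)) ^ 2) := by ring
        _ = _ := by rw [← Real.exp_nat_mul]; push_cast; ring_nf
    calc _ ≤ ∑ k, ((1 + δ) * ‖C k (Y t)‖ ^ 2 + (1 + δ⁻¹) *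
            (‖C k‖ ^ 2 * ((M * (2 * (1 + max R 0))) ^ 2 * Real.exp (-(2 * α) * t)))) :=
          Finset.sum_le_sum fun k _ => (h1 k).trans
            (add_le_add le_rfl (mul_le_mul_of_nonneg_left (h8 k) (by positivity)))
      _ = _ := by
          rw [Finset.sum_add_distrib, ← Finset.mul_sum, ← Finset.mul_sum, ← Finset.sum_mul, hQ, hS]
          ring
  have hQ0 : 0 ≤ Q := by positivity
  have hexpi : ∫ t in 0..T, Q * Real.exp (-(2 * α) * t) ≤ Q / (2 * α) := by
    have h1 : ∀ t ∈ uIcc 0 T, HasDerivAt (fun t : ℝ => -(Q / (2 * α)) * Real.exp (-(2 * α) * t))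
        (Q * Real.exp (-(2 * α) * t)) t := by
      intro t _
      have h2 : HasDerivAt (fun t : ℝ => -(2 * α) * t) (-(2 * α)) t := by
        simpa using (hasDerivAt_id t).const_mul (-(2 * α))
      refine (h2.exp.const_mul _).congr_deriv ?_
      field_simp
    rw [intervalIntegral.integral_eq_sub_of_hasDerivAt h1
      ((by fun_prop : Continuous fun t : ℝ => Q * Real.exp (-(2 * α) * t)).intervalIntegrable _ _)]
    have h3 : 0 ≤ Q / (2 * α) * Real.exp (-(2 * α) * T) := by positivity
    simp only [mul_zero, Real.exp_zero]
    linarith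
  have hxi : IntervalIntegrable (fun t => ∑ k, ‖C k (x t)‖ ^ 2) volume 0 T := by
    refine ContinuousOn.intervalIntegrable ?_
    rw [uIcc_of_le hT]
    exact continuousOn_finsetSum _ fun k _ =>
      (((C k).continuous.comp_continuousOn hx).norm.pow 2)
  have hYi' : IntervalIntegrable (fun t => ∑ k, ‖C k (Y t)‖ ^ 2) volume 0 T := by
    refine hYi.mono_set ?_
    rw [uIcc_of_le hT, uIcc_of_le hP0.le]
    exact Icc_subset_Icc le_rfl hP3.le
  have hei : IntervalIntegrable (fun t : ℝ => Q * Real.exp (-(2 * α) * t)) volume 0 T :=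
    (by fun_prop : Continuous fun t : ℝ => Q * Real.exp (-(2 * α) * t)).intervalIntegrable _ _
  calc _ ≤ ∫ t in 0..T, ((1 + δ) * ∑ k, ‖C k (Y t)‖ ^ 2
          + (1 + δ⁻¹) * (Q * Real.exp (-(2 * α) * t))) :=
        intervalIntegral.integral_mono_on hT hxi
          ((hYi'.const_mul _).add (hei.const_mul _)) hpoint
    _ = (1 + δ) * (∫ t in 0..T, ∑ k, ‖C k (Y t)‖ ^ 2)
          + (1 + δ⁻¹) * ∫ t in 0..T, Q * Real.exp (-(2 * α) * t) := by
        rw [intervalIntegral.integral_add (hYi'.const_mul _) (hei.const_mul _),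
          intervalIntegral.integral_const_mul, intervalIntegral.integral_const_mul]
    _ ≤ (1 + δ) * (γ ^ 2 * ∫ t in 0..T, ‖u t‖ ^ 2) + (1 + δ⁻¹) * (Q / (2 * α)) := by
        refine add_le_add (mul_le_mul_of_nonneg_left ?_ (by positivity))
          (mul_le_mul_of_nonneg_left hexpi (by positivity))
        rw [← hu1T]; exact hYT.trans hmain
    _ = _ := by ring

/-! ### The follower matrix -/

theorem mem_nbhd {N : ℕ} {G : Digraph (Fin (N + 1))} {i j : Fin (N + 1)} :
    j ∈ nbhd G i ↔ G.Adj j i := by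
  simp [nbhd]

/-- In the errors `e = ŷ - y`, the relative outputs are the entries of `-H e`. -/
theorem relativeOutput_eq {N : ℕ} {G : Digraph (Fin (N + 1))} (hG : IsLeaderFollowerNetwork G)
    (yh : Fin N → ℝ) (y : ℝ) (i : Fin N) :
    relativeOutput G yh y i = -(followerMatrix G *ᵥ fun j => yh j - y) i := by
  classical
  have hi : i.castSucc ∉ nbhd G i.castSucc := by
    rw [mem_nbhd]; exact hG.loopless _
  have h1 : ∀ j : Fin N, followerMatrix G i j * (yh j - y)
      = (if i = j then ((nbhd G i.castSucc).card : ℝ) * (yh i - y) else 0)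
        - if j.castSucc ∈ nbhd G i.castSucc then yh j - y else 0 := by
    intro j
    by_cases hij : i = j
    · subst hij
      simp [followerMatrix, networkLaplacian, hi]
    · have : i.castSucc ≠ j.castSucc := fun h => hij (Fin.castSucc_injective _ h)
      by_cases hj : j.castSucc ∈ nbhd G i.castSucc <;>
        simp [followerMatrix, networkLaplacian, hij, this, hj]
  have h2 : ∀ j : Fin (N + 1), Fin.snoc (α := fun _ => ℝ) yh y j - yh i
      = (Fin.snoc (α := fun _ => ℝ) yh y j - y) - (yh i - y) := fun j => by ring
  have h3 : ∑ j ∈ nbhd G i.castSucc, (Fin.snoc (α := fun _ => ℝ) yh y j - y)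
      = ∑ j : Fin N, if j.castSucc ∈ nbhd G i.castSucc then yh j - y else 0 := by
    rw [nbhd, Finset.sum_filter, Fin.sum_univ_castSucc]
    simp
  simp only [relativeOutput, Matrix.mulVec, dotProduct]
  rw [Finset.sum_congr rfl fun j _ => h1 j, Finset.sum_congr rfl fun j _ => h2 j,
    Finset.sum_sub_distrib _ (fun _ => yh i - y), h3, Finset.sum_sub_distrib]
  simp
  ring

theorem followerMatrix_isHermitian {N : ℕ} {G : Digraph (Fin (N + 1))}
    (hG : IsLeaderFollowerNetwork G) : (followerMatrix G).IsHermitian := by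
  classical
  ext i j
  by_cases hij : i = j
  · subst hij; simp
  · have h1 : i.castSucc ≠ j.castSucc := fun h => hij (Fin.castSucc_injective _ h)
    have h2 : j.castSucc ∈ nbhd G i.castSucc ↔ i.castSucc ∈ nbhd G j.castSucc := by
      rw [mem_nbhd, mem_nbhd]; exact ⟨hG.follower_symm _ _, hG.follower_symm _ _⟩
    simp [followerMatrix, networkLaplacian, h1, h1.symm, h2]

open Classical in
/-- The quadratic form of `H` as a sum over the edges that enter followers. -/
theorem dotProduct_followerMatrix_mulVec {N : ℕ} {G : Digraph (Fin (N + 1))}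
    (hG : IsLeaderFollowerNetwork G) (e : Fin N → ℝ) :
    e ⬝ᵥ followerMatrix G *ᵥ e
      = 1 / 2 * ∑ i : Fin N, ∑ j : Fin N,
          (if G.Adj j.castSucc i.castSucc then (e i - e j) ^ 2 else 0)
        + ∑ i : Fin N, if G.Adj (Fin.last N) i.castSucc then e i ^ 2 else 0 := by
  have h1 : ∀ i : Fin N, (followerMatrix G *ᵥ e) i
      = (∑ j : Fin N, if G.Adj j.castSucc i.castSucc then e i - e j else 0)
        + if G.Adj (Fin.last N) i.castSucc then e i else 0 := by
    intro i
    have h := relativeOutput_eq hG e 0 i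
    simp only [sub_zero] at h
    rw [← neg_eq_iff_eq_neg] at h
    rw [← h, relativeOutput, nbhd, Finset.sum_filter, Fin.sum_univ_castSucc]
    simp only [Fin.snoc_castSucc, Fin.snoc_last, zero_sub]
    rw [neg_add, ← Finset.sum_neg_distrib]
    congr 1
    · refine Finset.sum_congr rfl fun j _ => ?_
      split_ifs <;> simp
    · split_ifs <;> simp
  have hsw : ∑ i : Fin N, ∑ j : Fin N, (if G.Adj j.castSucc i.castSucc then e i * (e i - e j) else 0)
      = ∑ i : Fin N, ∑ j : Fin N, (if G.Adj j.castSucc i.castSucc then e j * (e j - e i) else 0) := by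
    rw [Finset.sum_comm]
    refine Finset.sum_congr rfl fun i _ => Finset.sum_congr rfl fun j _ => ?_
    have : G.Adj i.castSucc j.castSucc ↔ G.Adj j.castSucc i.castSucc :=
      ⟨hG.follower_symm _ _, hG.follower_symm _ _⟩
    simp only [this]
  have hsum : ∑ i : Fin N, ∑ j : Fin N, (if G.Adj j.castSucc i.castSucc then (e i - e j) ^ 2 else 0)
      = ∑ i : Fin N, ∑ j : Fin N, (if G.Adj j.castSucc i.castSucc then e i * (e i - e j) else 0)
        + ∑ i : Fin N, ∑ j : Fin N,
          (if G.Adj j.castSucc i.castSucc then e j * (e j - e i) else 0) := by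
    simp only [← Finset.sum_add_distrib]
    refine Finset.sum_congr rfl fun i _ => Finset.sum_congr rfl fun j _ => ?_
    split_ifs <;> ring
  rw [hsum, ← hsw, ← two_mul, ← mul_assoc, one_div, inv_mul_cancel₀ two_ne_zero, one_mul]
  simp only [dotProduct, h1, mul_add, Finset.sum_add_distrib, Finset.mul_sum, mul_ite, mul_zero,
    sq]

/-- `H` is positive definite: a vector of energy zero is constant along edges and vanishes at the
leader, from which every follower is reached. -/
theorem followerMatrix_posDef {N : ℕ} {G : Digraph (Fin (N + 1))}
    (hG : IsLeaderFollowerNetwork G) : (followerMatrix G).PosDef := by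
  classical
  refine Matrix.PosDef.of_dotProduct_mulVec_pos (followerMatrix_isHermitian hG) fun e he => ?_
  rw [star_trivial, dotProduct_followerMatrix_mulVec hG]
  have hA : ∀ i j : Fin N,
      0 ≤ (if G.Adj j.castSucc i.castSucc then (e i - e j) ^ 2 else 0) := fun i j => by
    split_ifs <;> positivity
  have hB : ∀ i : Fin N, 0 ≤ (if G.Adj (Fin.last N) i.castSucc then e i ^ 2 else 0) := fun i => by
    split_ifs <;> positivity
  have hA' := Finset.sum_nonneg fun i (_ : i ∈ Finset.univ) =>
    Finset.sum_nonneg fun j (_ : j ∈ Finset.univ) => hA i j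
  have hB' := Finset.sum_nonneg fun i (_ : i ∈ Finset.univ) => hB i
  by_contra hcon
  have hA0 : ∑ i : Fin N, ∑ j : Fin N,
      (if G.Adj j.castSucc i.castSucc then (e i - e j) ^ 2 else 0) = 0 := by linarith
  have hB0 : ∑ i : Fin N, (if G.Adj (Fin.last N) i.castSucc then e i ^ 2 else 0) = 0 := by linarith
  have hedge : ∀ i j : Fin N, G.Adj j.castSucc i.castSucc → e i = e j := by
    intro i j hij
    have h1 := (Finset.sum_eq_zero_iff_of_nonneg fun i _ => Finset.sum_nonneg fun j _ => hA i j).1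
      hA0 i (Finset.mem_univ _)
    have h2 := (Finset.sum_eq_zero_iff_of_nonneg fun j _ => hA i j).1 h1 j (Finset.mem_univ _)
    rw [if_pos hij] at h2
    exact sub_eq_zero.1 (pow_eq_zero_iff two_ne_zero |>.1 h2)
  have hlead : ∀ i : Fin N, G.Adj (Fin.last N) i.castSucc → e i = 0 := by
    intro i hi
    have h1 := (Finset.sum_eq_zero_iff_of_nonneg fun i _ => hB i).1 hB0 i (Finset.mem_univ _)
    rw [if_pos hi] at h1
    exact pow_eq_zero_iff two_ne_zero |>.1 h1
  obtain ⟨T, hTG, hT⟩ := hG.spanning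
  have hreach : ∀ v, Relation.ReflTransGen T.Adj (Fin.last N) v →
      Fin.snoc (α := fun _ => ℝ) e 0 v = 0 := by
    intro v hv
    induction hv with
    | refl => simp
    | @tail u v _ huv ih =>
      have huv' : G.Adj u v := hTG huv
      induction v using Fin.lastCases with
      | last => simp
      | cast i =>
        rw [Fin.snoc_castSucc]
        induction u using Fin.lastCases with
        | last => exact hlead i huv'
        | cast j =>
          rw [Fin.snoc_castSucc] at ih
          rw [hedge i j huv', ih]
  apply he
  funext i
  simpa using hreach i.castSucc (hT.reachable _)

/-- The infimum in `lambdaOne` is attained, the spectrum of a Hermitian matrix being finite and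
nonempty. -/
theorem lambdaOne_mem {N : ℕ} [NeZero N] {G : Digraph (Fin (N + 1))}
    (hG : IsLeaderFollowerNetwork G) :
    lambdaOne G ∈ spectrum ℝ (followerMatrix G) ∧
      ∀ z ∈ spectrum ℝ (followerMatrix G), lambdaOne G ≤ z := by
  have hfin : (spectrum ℝ (followerMatrix G)).Finite := by
    rw [(followerMatrix_isHermitian hG).spectrum_real_eq_range_eigenvalues]
    exact Set.finite_range _
  have hne : (spectrum ℝ (followerMatrix G)).Nonempty := by
    rw [(followerMatrix_isHermitian hG).spectrum_real_eq_range_eigenvalues]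
    exact Set.range_nonempty _
  exact ⟨hne.csInf_mem hfin, fun z hz => csInf_le hfin.bddBelow hz⟩

theorem lambdaOne_pos {N : ℕ} [NeZero N] {G : Digraph (Fin (N + 1))}
    (hG : IsLeaderFollowerNetwork G) : 0 < lambdaOne G := by
  have h := (lambdaOne_mem hG).1
  rw [(followerMatrix_isHermitian hG).spectrum_real_eq_range_eigenvalues] at h
  obtain ⟨i, hi⟩ := h
  rw [← hi]
  exact (followerMatrix_posDef hG).eigenvalues_pos i

/-- The Rayleigh quotients of `H` are at least `λ₁`. -/
theorem lambdaOne_mul_le {N : ℕ} [NeZero N] {G : Digraph (Fin (N + 1))}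
    (hG : IsLeaderFollowerNetwork G) (e : Fin N → ℝ) :
    lambdaOne G * (e ⬝ᵥ e) ≤ e ⬝ᵥ followerMatrix G *ᵥ e := by
  have hH := followerMatrix_isHermitian hG
  have hherm : (followerMatrix G - algebraMap ℝ _ (lambdaOne G)).IsHermitian := by
    refine hH.sub ?_
    rw [Algebra.algebraMap_eq_smul_one]
    ext i j
    simp [Matrix.one_apply, eq_comm]
  have hps : (followerMatrix G - algebraMap ℝ _ (lambdaOne G)).PosSemidef := by
    rw [hherm.posSemidef_iff_eigenvalues_nonneg]
    intro i
    have h1 : hherm.eigenvalues i ∈ spectrum ℝ (followerMatrix G - algebraMap ℝ _ (lambdaOne G)) := by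
      rw [hherm.spectrum_real_eq_range_eigenvalues]; exact ⟨i, rfl⟩
    rw [← spectrum.sub_singleton_eq] at h1
    obtain ⟨z, hz, c, hc, hzc⟩ := h1
    have h2 := (lambdaOne_mem hG).2 z hz
    rw [Set.mem_singleton_iff] at hc
    rw [← hzc, hc]
    simpa using h2
  have h := hps.dotProduct_mulVec_nonneg e
  rw [star_trivial, Matrix.sub_mulVec, dotProduct_sub, Algebra.algebraMap_eq_smul_one,
    Matrix.smul_mulVec, Matrix.one_mulVec, dotProduct_smul, smul_eq_mul] at h
  linarith

/-- `λ₁² |e|² ≤ |H e|²`: expand `0 ≤ |H e - λ₁ e|²` and use the Rayleigh bound. -/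
theorem lambdaOne_sq_mul_le {N : ℕ} [NeZero N] {G : Digraph (Fin (N + 1))}
    (hG : IsLeaderFollowerNetwork G) (e : Fin N → ℝ) :
    lambdaOne G ^ 2 * (e ⬝ᵥ e)
      ≤ (followerMatrix G *ᵥ e) ⬝ᵥ (followerMatrix G *ᵥ e) := by
  set w := followerMatrix G *ᵥ e with hw
  have h1 := lambdaOne_mul_le hG e
  have h2 : 0 ≤ (w - lambdaOne G • e) ⬝ᵥ (w - lambdaOne G • e) := by
    simp only [dotProduct]
    exact Finset.sum_nonneg fun i _ => mul_self_nonneg _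
  rw [sub_dotProduct, dotProduct_sub, dotProduct_sub, smul_dotProduct, smul_dotProduct,
    dotProduct_smul, dotProduct_smul, dotProduct_comm w e] at h2
  simp only [smul_eq_mul] at h2
  have h3 := mul_le_mul_of_nonneg_left h1 (lambdaOne_pos hG).le
  nlinarith

/-! ### Real trajectories of a stable matrix -/

/-- A real square matrix all of whose complex eigenvalues have negative real part. -/
def IsStableMatrix {n : ℕ} (A : Matrix (Fin n) (Fin n) ℝ) : Prop :=
  ∀ (s : ℂ) (v : Fin n → ℂ), A.map Complex.ofReal *ᵥ v = s • v → v ≠ 0 → s.re < 0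

/-- The complexification of a real vector. -/
def complexify {n : ℕ} (x : Fin n → ℝ) : Fin n → ℂ := fun j => (x j : ℂ)

/-- The operator on `ℂⁿ` of a real matrix. -/
noncomputable def complexOp {n : ℕ} (A : Matrix (Fin n) (Fin n) ℝ) :
    (Fin n → ℂ) →L[ℂ] (Fin n → ℂ) :=
  (A.map Complex.ofReal).mulVecLin.toContinuousLinearMap

theorem complexOp_apply {n : ℕ} (A : Matrix (Fin n) (Fin n) ℝ) (v : Fin n → ℂ) :
    complexOp A v = A.map Complex.ofReal *ᵥ v := rfl

theorem norm_complexify {n : ℕ} (x : Fin n → ℝ) : ‖complexify x‖ = ‖x‖ := by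
  simp [complexify, Pi.norm_def]

theorem map_mulVec_complexify {m n : ℕ} (A : Matrix (Fin m) (Fin n) ℝ) (x : Fin n → ℝ) :
    A.map Complex.ofReal *ᵥ complexify x = complexify (A *ᵥ x) := by
  funext i
  simp [complexify, Matrix.mulVec, dotProduct]

theorem HasDerivWithinAt.complexify {n : ℕ} {x : ℝ → Fin n → ℝ} {x' : Fin n → ℝ} {s : Set ℝ}
    {t : ℝ} (h : HasDerivWithinAt x x' s t) :
    HasDerivWithinAt (fun t => complexify (x t)) (complexify x') s t := by
  rw [hasDerivWithinAt_pi] at h ⊢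
  exact fun j => (h j).ofReal_comp

theorem ContinuousOn.complexify {n : ℕ} {x : ℝ → Fin n → ℝ} {s : Set ℝ}
    (h : ContinuousOn x s) : ContinuousOn (fun t => complexify (x t)) s := by
  rw [continuousOn_pi] at h ⊢
  exact fun j => Complex.continuous_ofReal.comp_continuousOn (h j)

open Set in
theorem IsStableMatrix.exists_norm_le {n : ℕ} {A : Matrix (Fin n) (Fin n) ℝ}
    (hA : IsStableMatrix A) :
    ∃ M α : ℝ, 0 < M ∧ 0 < α ∧ ∀ (x r : ℝ → Fin n → ℝ) (a b U : ℝ), a ≤ b →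
      ContinuousOn x (Icc a b) →
      (∀ t ∈ Ico a b, HasDerivWithinAt x (A *ᵥ x t + r t) (Ici t) t) →
      (∀ t ∈ Ico a b, ‖r t‖ ≤ U) → 0 ≤ U →
      ‖x b‖ ≤ M * Real.exp (-(α * (b - a))) * ‖x a‖ + M * U / α := by
  obtain ⟨M, α, hM, hα, h⟩ := exists_norm_exp_le (complexOp A) hA
  refine ⟨M, α, hM, hα, fun x r a b U hab hx hx' hU hU0 => ?_⟩
  have := norm_le_of_hasDeriv_right_linear hM hα h (x := fun t => complexify (x t))
    (r := fun t => complexify (r t)) hab hx.complexify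
    (fun t ht => by
      refine (hx' t ht).complexify.congr_deriv ?_
      rw [complexOp_apply, map_mulVec_complexify]
      funext j; simp [complexify])
    (fun t ht => by rw [norm_complexify]; exact hU t ht) hU0
  simpa only [norm_complexify] using this

theorem IsStableMatrix.isUnit_sub {n : ℕ} {A : Matrix (Fin n) (Fin n) ℝ} (hA : IsStableMatrix A)
    {s : ℂ} (hs : 0 ≤ s.re) :
    IsUnit (s • (1 : Matrix (Fin n) (Fin n) ℂ) - A.map Complex.ofReal) := by
  rw [Matrix.isUnit_iff_isUnit_det, isUnit_iff_ne_zero]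
  intro h
  obtain ⟨v, hv, hv'⟩ := Matrix.exists_mulVec_eq_zero_iff.2 h
  rw [Matrix.sub_mulVec, Matrix.smul_mulVec, Matrix.one_mulVec, sub_eq_zero] at hv'
  exact absurd (hA s v hv'.symm hv) (not_lt.2 hs)

theorem IsStableMatrix.transpose {n : ℕ} {A : Matrix (Fin n) (Fin n) ℝ} (hA : IsStableMatrix A) :
    IsStableMatrix Aᵀ := by
  intro s v hv hv0
  by_contra hs
  have h1 := hA.isUnit_sub (not_lt.1 hs)
  rw [← Matrix.isUnit_transpose, Matrix.transpose_sub, Matrix.transpose_smul,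
    Matrix.transpose_one, ← Matrix.transpose_map, Matrix.isUnit_iff_isUnit_det,
    isUnit_iff_ne_zero] at h1
  refine h1 (Matrix.exists_mulVec_eq_zero_iff.1 ⟨v, hv0, ?_⟩)
  rw [Matrix.sub_mulVec, Matrix.smul_mulVec, Matrix.one_mulVec, hv, sub_self]

open scoped Matrix.Norms.L2Operator in
/-- The transfer matrix of a stable system is bounded on the imaginary axis, since the resolvent is
continuous there and vanishes at infinity; so its `H∞` norm is not a junk value. -/
theorem IsStableMatrix.bddAbove_transferMatrix {p n q : ℕ} {A : Matrix (Fin n) (Fin n) ℝ}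
    (hA : IsStableMatrix A) (C : Matrix (Fin p) (Fin n) ℝ) (B : Matrix (Fin n) (Fin q) ℝ) :
    BddAbove (Set.range fun w : ℝ => ‖transferMatrix C A B (Complex.I * (w : ℂ))‖) := by
  set R : ℝ → Matrix (Fin n) (Fin n) ℂ := fun w =>
    resolvent (A.map Complex.ofReal) (Complex.I * (w : ℂ)) with hR
  have hRc : Continuous R := by
    refine continuous_iff_continuousAt.2 fun w => ?_
    have h1 : Complex.I * (w : ℂ) ∈ resolventSet ℂ (A.map Complex.ofReal) := by
      have := hA.isUnit_sub (s := Complex.I * (w : ℂ)) (by simp)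
      rwa [← Algebra.algebraMap_eq_smul_one] at this
    exact (spectrum.hasDerivAt_resolvent_const_left h1).continuousAt.comp
      (f := fun w : ℝ => Complex.I * (w : ℂ)) (by fun_prop)
  have hR0 : Filter.Tendsto R (Filter.cocompact ℝ) (nhds 0) := by
    refine (spectrum.resolvent_tendsto_cobounded (𝕜 := ℂ) (A.map Complex.ofReal)).comp ?_
    rw [← tendsto_norm_atTop_iff_cobounded]
    refine (tendsto_norm_cocompact_atTop (E := ℝ)).congr fun w => ?_
    simp
  have hev : ∀ᶠ w in Filter.cocompact ℝ, ‖R w‖ ≤ 1 := by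
    have := hR0.norm
    rw [norm_zero] at this
    exact this.eventually_le_const one_pos
  obtain ⟨K, hK, hK'⟩ := Filter.mem_cocompact.1 hev
  obtain ⟨c, hc⟩ := hK.exists_bound_of_continuousOn hRc.continuousOn
  have hbound : ∀ w, ‖R w‖ ≤ max c 1 := by
    intro w
    by_cases hw : w ∈ K
    · exact (hc w hw).trans (le_max_left _ _)
    · exact (hK' hw).trans (le_max_right _ _)
  refine ⟨‖C.map Complex.ofReal‖ * max c 1 * ‖B.map Complex.ofReal‖, ?_⟩
  rintro _ ⟨w, rfl⟩
  have h1 : transferMatrix C A B (Complex.I * (w : ℂ))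
      = C.map Complex.ofReal * R w * B.map Complex.ofReal := by
    simp only [transferMatrix, hR, Matrix.nonsing_inv_eq_ringInverse, resolvent,
      Algebra.algebraMap_eq_smul_one]
  simp only [h1]
  refine (Matrix.l2_opNorm_mul _ _).trans (mul_le_mul_of_nonneg_right ?_ (norm_nonneg _))
  exact (Matrix.l2_opNorm_mul _ _).trans (mul_le_mul_of_nonneg_left (hbound w) (norm_nonneg _))

open scoped Matrix.Norms.L2Operator in
/-- The `H∞` norm bounds the response to a harmonic input. -/
theorem IsStableMatrix.sum_sq_le_hInfNorm {p n : ℕ} {A : Matrix (Fin n) (Fin n) ℝ}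
    (hA : IsStableMatrix A) (C : Matrix (Fin p) (Fin n) ℝ) (b : Fin n → ℝ)
    (w : ℝ) (v : Fin n → ℂ) (c : ℂ)
    (hv : (Complex.I * w) • v - A.map Complex.ofReal *ᵥ v = c • complexify b) :
    ∑ k, ‖(C.map Complex.ofReal *ᵥ v) k‖ ^ 2
      ≤ hInfNorm (transferMatrix C A (Matrix.replicateCol (Fin 1) b)) ^ 2 * ‖c‖ ^ 2 := by
  set G := transferMatrix C A (Matrix.replicateCol (Fin 1) b) (Complex.I * (w : ℂ)) with hG
  have hle : ‖G‖ ≤ hInfNorm (transferMatrix C A (Matrix.replicateCol (Fin 1) b)) :=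
    le_ciSup (hA.bddAbove_transferMatrix C (Matrix.replicateCol (Fin 1) b)) w
  have hu := hA.isUnit_sub (s := Complex.I * (w : ℂ)) (by simp)
  rw [Matrix.isUnit_iff_isUnit_det] at hu
  have hv' : v = ((Complex.I * w) • (1 : Matrix (Fin n) (Fin n) ℂ) - A.map Complex.ofReal)⁻¹
      *ᵥ (c • complexify b) := by
    rw [← hv]
    have : (Complex.I * w) • v - A.map Complex.ofReal *ᵥ v
        = ((Complex.I * w) • (1 : Matrix (Fin n) (Fin n) ℂ) - A.map Complex.ofReal) *ᵥ v := by
      rw [Matrix.sub_mulVec, Matrix.smul_mulVec, Matrix.one_mulVec]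
    rw [this, Matrix.mulVec_mulVec, Matrix.nonsing_inv_mul _ hu, Matrix.one_mulVec]
  have hCv : C.map Complex.ofReal *ᵥ v = G *ᵥ fun _ => c := by
    have hb : c • complexify b
        = (Matrix.replicateCol (Fin 1) b).map Complex.ofReal *ᵥ fun _ => c := by
      funext j
      simp [complexify, Matrix.mulVec, dotProduct, mul_comm]
    rw [hv', hb, hG, transferMatrix, Matrix.mulVec_mulVec, Matrix.mulVec_mulVec]
  have h1 := Matrix.l2_opNorm_mulVec G (WithLp.toLp 2 fun _ => c)
  have h2 : ‖(EuclideanSpace.equiv (Fin p) ℂ).symm (G *ᵥ fun _ => c)‖ ^ 2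
      = ∑ k, ‖(C.map Complex.ofReal *ᵥ v) k‖ ^ 2 := by
    rw [EuclideanSpace.norm_sq_eq, hCv]; rfl
  have h3 : ‖(WithLp.toLp 2 fun _ => c : EuclideanSpace ℂ (Fin 1))‖ = ‖c‖ := by
    rw [EuclideanSpace.norm_eq]; simp
  rw [← h2, ← mul_pow]
  refine pow_le_pow_left₀ (norm_nonneg _) (le_trans h1 ?_) 2
  rw [h3]
  exact mul_le_mul_of_nonneg_right hle (norm_nonneg _)

open Set in
/-- The `L²` gain of a stable real system is its `H∞` norm, up to the effect of the initial
value. -/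
theorem IsStableMatrix.exists_integral_sq_le {p n : ℕ} {A : Matrix (Fin n) (Fin n) ℝ}
    (hA : IsStableMatrix A) (C : Matrix (Fin p) (Fin n) ℝ) (b : Fin n → ℝ) (R : ℝ) {δ : ℝ}
    (hδ : 0 < δ) :
    ∃ K : ℝ, ∀ (T : ℝ) (x : ℝ → Fin n → ℝ) (u : ℝ → ℝ), 0 ≤ T → ContinuousOn x (Icc 0 T) →
      ContinuousOn u (Icc 0 T) →
      (∀ t ∈ Ico 0 T, HasDerivWithinAt x (A *ᵥ x t + u t • b) (Ici t) t) → ‖x 0‖ ≤ R →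
      ∫ t in 0..T, ∑ k, (C *ᵥ x t) k ^ 2
        ≤ (1 + δ) * hInfNorm (transferMatrix C A (Matrix.replicateCol (Fin 1) b)) ^ 2
          * (∫ t in 0..T, u t ^ 2) + K := by
  obtain ⟨K, hK⟩ := _root_.exists_integral_sq_le (L := complexOp A) hA (b := complexify b)
    (C := fun k => (ContinuousLinearMap.proj k).comp
      (C.map Complex.ofReal).mulVecLin.toContinuousLinearMap)
    (γ := hInfNorm (transferMatrix C A (Matrix.replicateCol (Fin 1) b)))
    (fun w v c h => hA.sum_sq_le_hInfNorm C b w v c h) R hδ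
  refine ⟨K, fun T x u hT hx hu hx' hxR => ?_⟩
  have := hK T (fun t => complexify (x t)) (fun t => (u t : ℂ)) hT hx.complexify
    (Complex.continuous_ofReal.comp_continuousOn hu)
    (fun t ht => by
      refine (hx' t ht).complexify.congr_deriv ?_
      rw [complexOp_apply, map_mulVec_complexify]
      funext j; simp [complexify])
    (by rw [norm_complexify]; exact hxR)
  have h1 : ∀ (t : ℝ) (k : Fin p), ‖((ContinuousLinearMap.proj k).comp
      (C.map Complex.ofReal).mulVecLin.toContinuousLinearMap : (Fin n → ℂ) →L[ℂ] ℂ)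
        (complexify (x t))‖ ^ 2 = (C *ᵥ x t) k ^ 2 := by
    intro t k
    have : ((ContinuousLinearMap.proj k).comp
      (C.map Complex.ofReal).mulVecLin.toContinuousLinearMap : (Fin n → ℂ) →L[ℂ] ℂ)
        (complexify (x t)) = (C.map Complex.ofReal *ᵥ complexify (x t)) k := rfl
    rw [this, map_mulVec_complexify, complexify, Complex.norm_real, Real.norm_eq_abs, sq_abs]
  simpa only [h1, Complex.norm_real, Real.norm_eq_abs, sq_abs] using this

/-! ### The matrices of the observer -/

theorem obsA_transpose_map_mulVec_zero {n : ℕ} [NeZero n] (a : Fin n → ℝ) (v : Fin n → ℂ) :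
    (((obsA a)ᵀ).map Complex.ofReal *ᵥ v) 0 = -∑ i, (a i : ℂ) * v i := by
  simp [Matrix.mulVec, dotProduct, obsA]

theorem obsA_transpose_map_mulVec_succ {n : ℕ} (a : Fin n → ℝ) (v : Fin n → ℂ) {j : ℕ}
    (hj : j + 1 < n) :
    (((obsA a)ᵀ).map Complex.ofReal *ᵥ v) ⟨j + 1, hj⟩ = v ⟨j, by omega⟩ := by
  simp only [Matrix.mulVec, dotProduct, obsA, Matrix.map_apply, Matrix.transpose_apply,
    Matrix.of_apply]
  rw [Finset.sum_eq_single ⟨j, by omega⟩]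
  · simp
  · intro i _ hi
    have h1 : (i : ℕ) ≠ j := fun h => hi (Fin.ext h)
    simp [h1.symm]
  · simp

/-- An eigenvector of `Aᵀ` is a multiple of `(s ^ (n - 1), …, s, 1)`, so its eigenvalue `s` is a
root of the polynomial with coefficients `a`. -/
theorem IsHurwitzCoeffs.isStableMatrix {n : ℕ} {a : Fin n → ℝ} (ha : IsHurwitzCoeffs a) :
    IsStableMatrix (obsA a) := by
  suffices h : IsStableMatrix (obsA a)ᵀ by simpa using h.transpose
  intro s v hv hv0
  rcases Nat.eq_zero_or_pos n with hn | hn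
  · subst hn
    exact absurd (Subsingleton.elim v 0) hv0
  have : NeZero n := ⟨hn.ne'⟩
  have hpow : ∀ k : ℕ, ∀ hk : k < n, v ⟨n - 1 - k, by omega⟩ = s ^ k * v ⟨n - 1, by omega⟩ := by
    intro k
    induction k with
    | zero => intro hk; simp
    | succ k ih =>
      intro hk
      have h1 := congrFun hv ⟨(n - 1 - (k + 1)) + 1, by omega⟩
      rw [obsA_transpose_map_mulVec_succ] at h1
      rw [h1, Pi.smul_apply, smul_eq_mul, pow_succ', mul_assoc, ← ih (by omega)]
      congr 2
      ext; simp; omega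
  have hpow' : ∀ i : Fin n, v i = s ^ (n - 1 - (i : ℕ)) * v ⟨n - 1, by omega⟩ := by
    intro i
    rw [← hpow (n - 1 - i) (by omega)]
    congr 1
    ext; simp; omega
  have hlast : v ⟨n - 1, by omega⟩ ≠ 0 := by
    intro h
    apply hv0
    funext i
    rw [hpow', h]; simp
  apply ha
  have h0 := congrFun hv 0
  rw [obsA_transpose_map_mulVec_zero, Pi.smul_apply, hpow' 0, smul_eq_mul,
    Finset.sum_congr rfl fun i _ => by rw [hpow' i, ← mul_assoc], ← Finset.sum_mul] at h0
  have h1 : (s ^ n + ∑ j : Fin n, (a j : ℂ) * s ^ (n - 1 - (j : ℕ))) * v ⟨n - 1, by omega⟩ = 0 := by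
    have h2 : s ^ n = s * s ^ (n - 1) := by
      rw [← pow_succ']; congr 1; omega
    simp only [Fin.val_zero, tsub_zero] at h0
    rw [add_mul, h2, mul_assoc, ← h0]; ring
  exact (mul_eq_zero.1 h1).resolve_right hlast

/-- `a 0` is minus the trace of `obsA a`, hence minus a sum of eigenvalues. -/
theorem IsHurwitzCoeffs.nonneg {n : ℕ} [NeZero n] {a : Fin n → ℝ} (ha : IsHurwitzCoeffs a) :
    0 ≤ a 0 := by
  have h1 := Matrix.trace_eq_sum_roots_charpoly ((obsA a).map Complex.ofReal)
  have h2 : ((obsA a).map Complex.ofReal).trace = -(a 0 : ℂ) := by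
    rw [Matrix.trace, Finset.sum_eq_single 0]
    · simp [obsA]
    · intro i _ hi
      simp [obsA, hi]
    · simp
  have h3 : (((obsA a).map Complex.ofReal).charpoly.roots.sum).re ≤ 0 := by
    have h4 : ∀ s ∈ ((obsA a).map Complex.ofReal).charpoly.roots, s.re ≤ 0 := by
      intro s hs
      rw [Polynomial.mem_roots (Matrix.charpoly_monic _).ne_zero,
        ← Matrix.mem_spectrum_iff_isRoot_charpoly] at hs
      by_contra hcon
      have h5 := ha.isStableMatrix.isUnit_sub (s := s) (not_le.1 hcon).le
      rw [← Algebra.algebraMap_eq_smul_one] at h5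
      exact hs h5
    have h6 : ∀ m : Multiset ℂ, (∀ s ∈ m, s.re ≤ 0) → m.sum.re ≤ 0 := by
      intro m
      induction m using Multiset.induction_on with
      | empty => simp
      | cons s m ih =>
        intro h
        rw [Multiset.sum_cons, Complex.add_re]
        exact add_nonpos (h s (Multiset.mem_cons_self _ _))
          (ih fun z hz => h z (Multiset.mem_cons_of_mem hz))
    exact h6 _ h4
  rw [← h1, h2] at h3
  simpa using h3

/-! ### The parameters of the leader -/

/-- The coefficients of `∏ (s² + ω_k²)` are the elementary symmetric functions of the `ω_k²`. -/
theorem leaderTheta_eq {l : ℕ} (ω : Fin l → ℝ) (k : Fin l) :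
    leaderTheta ω k = (∏ j, (Polynomial.X + Polynomial.C (ω j ^ 2) : Polynomial ℝ)).coeff
      (l - ((k : ℕ) + 1)) := by
  have h1 : ∏ j, ((Polynomial.X : Polynomial ℝ) ^ 2 + Polynomial.C (ω j ^ 2))
      = Polynomial.expand ℝ 2 (∏ j, (Polynomial.X + Polynomial.C (ω j ^ 2) : Polynomial ℝ)) := by
    rw [map_prod]
    simp
  rw [leaderTheta, h1, Polynomial.coeff_expand_mul' two_pos]

/-- `θ_k` is the `k`-th elementary symmetric function of the `ω_j²`, hence at most
`(l choose k) ωbar^(2 k)`. -/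
theorem sum_leaderTheta_sq_le {l : ℕ} {ω : Fin l → ℝ} {ωbar : ℝ}
    (hω : ∀ k, 0 < ω k ∧ ω k < ωbar) :
    ∑ k, leaderTheta ω k ^ 2 ≤ thetaBound l ωbar := by
  have h1 : ∀ k : Fin l, leaderTheta ω k ^ 2
      ≤ ((l.choose ((k : ℕ) + 1) : ℕ) : ℝ) ^ 2 * ωbar ^ (4 * ((k : ℕ) + 1)) := by
    intro k
    have hk := k.2
    rw [leaderTheta_eq, Finset.prod_X_add_C_coeff _ _ (by simp)]
    have hcard : (Finset.univ : Finset (Fin l)).card - (l - ((k : ℕ) + 1)) = (k : ℕ) + 1 := by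
      simp; omega
    rw [hcard]
    have h2 : ∀ t ∈ (Finset.univ : Finset (Fin l)).powersetCard ((k : ℕ) + 1),
        ∏ i ∈ t, ω i ^ 2 ≤ ωbar ^ (2 * ((k : ℕ) + 1)) := by
      intro t ht
      rw [Finset.mem_powersetCard] at ht
      rw [pow_mul, ← ht.2, ← Finset.prod_const]
      exact Finset.prod_le_prod (fun i _ => by positivity)
        fun i _ => pow_le_pow_left₀ (hω i).1.le (hω i).2.le 2
    have h3 := Finset.sum_le_sum h2
    rw [Finset.sum_const, Finset.card_powersetCard, Finset.card_univ, Fintype.card_fin,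
      nsmul_eq_mul] at h3
    have h4 : 0 ≤ ∑ t ∈ (Finset.univ : Finset (Fin l)).powersetCard ((k : ℕ) + 1),
        ∏ i ∈ t, ω i ^ 2 :=
      Finset.sum_nonneg fun t _ => Finset.prod_nonneg fun i _ => by positivity
    calc _ ≤ (((l.choose ((k : ℕ) + 1) : ℕ) : ℝ) * ωbar ^ (2 * ((k : ℕ) + 1))) ^ 2 :=
          pow_le_pow_left₀ h4 h3 2
      _ = _ := by rw [mul_pow, ← pow_mul]; ring_nf
  refine (Finset.sum_le_sum fun k _ => h1 k).trans (le_of_eq ?_)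
  rw [Fin.sum_univ_eq_sum_range (fun k => ((l.choose (k + 1) : ℕ) : ℝ) ^ 2 * ωbar ^ (4 * (k + 1))),
    thetaBound, Finset.range_eq_Ico, Finset.sum_Ico_add'
      (fun k => ((l.choose k : ℕ) : ℝ) ^ 2 * ωbar ^ (4 * k))]
  rfl

/-- `i ω_m` is a root of the polynomial `∏ (s² + ω_j²)` with coefficients `θ`. -/
theorem pow_eq_neg_sum_leaderTheta {l : ℕ} (ω : Fin l → ℝ) (m : Fin l) :
    (Complex.I * (ω m : ℂ)) ^ (2 * l)
      = -∑ k : Fin l, (leaderTheta ω k : ℂ) * (Complex.I * (ω m : ℂ)) ^ (2 * (l - 1 - (k : ℕ))) := by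
  set s : ℂ := Complex.I * (ω m : ℂ) with hs
  set Q : Polynomial ℝ := ∏ j, (Polynomial.X + Polynomial.C (ω j ^ 2)) with hQ
  have hmonic : Q.Monic := Polynomial.monic_prod_of_monic _ _ fun j _ => Polynomial.monic_X_add_C _
  have hdeg : Q.natDegree = l := by
    rw [hQ, Polynomial.natDegree_prod_of_monic _ _ fun j _ => Polynomial.monic_X_add_C _]
    simp only [Polynomial.natDegree_X_add_C]
    simp
  have hroot : Polynomial.aeval (s ^ 2) Q = 0 := by
    rw [hQ, map_prod]
    refine Finset.prod_eq_zero (Finset.mem_univ m) ?_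
    simp [hs, mul_pow]
  rw [Polynomial.aeval_eq_sum_range, hdeg, Finset.sum_range_succ, ← hdeg, hmonic.coeff_natDegree,
    hdeg, one_smul, ← Finset.sum_range_reflect] at hroot
  rw [pow_mul, eq_neg_iff_add_eq_zero, ← hroot, add_comm]
  congr 1
  rw [← Fin.sum_univ_eq_sum_range
    (fun j => Q.coeff (l - 1 - j) • (s ^ 2) ^ (l - 1 - j))]
  refine Finset.sum_congr rfl fun k _ => ?_
  rw [leaderTheta_eq, ← hQ, pow_mul, Nat.sub_sub l 1 k, add_comm 1 (k : ℕ)]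
  simp

/-! ### The steady state -/

/-- The steady-state response of `χ` to the input `exp (s t)` is
`(s ^ (n - 1), …, s, 1) / p(s)`. -/
theorem obsA_transpose_mulVec_pow {n : ℕ} [NeZero n] (a : Fin n → ℝ) {s : ℂ}
    (hp : s ^ n + ∑ j : Fin n, (a j : ℂ) * s ^ (n - 1 - (j : ℕ)) ≠ 0) :
    ((obsA a)ᵀ).map Complex.ofReal *ᵥ (fun j : Fin n => s ^ (n - 1 - (j : ℕ))
        / (s ^ n + ∑ j : Fin n, (a j : ℂ) * s ^ (n - 1 - (j : ℕ)))) + complexify (obsE n)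
      = s • fun j : Fin n => s ^ (n - 1 - (j : ℕ))
        / (s ^ n + ∑ j : Fin n, (a j : ℂ) * s ^ (n - 1 - (j : ℕ))) := by
  set p := s ^ n + ∑ j : Fin n, (a j : ℂ) * s ^ (n - 1 - (j : ℕ)) with hpdef
  have hn := NeZero.pos n
  funext i
  obtain ⟨i, hi⟩ := i
  cases i with
  | zero =>
    have h0 : (⟨0, hi⟩ : Fin n) = 0 := rfl
    rw [h0, Pi.add_apply, obsA_transpose_map_mulVec_zero]
    simp only [Pi.smul_apply, smul_eq_mul, complexify, obsE, Fin.val_zero, tsub_zero, if_true,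
      Complex.ofReal_one]
    have h2 : s * s ^ (n - 1) = s ^ n := by rw [← pow_succ']; congr 1; omega
    simp only [← mul_div_assoc, ← Finset.sum_div]
    rw [h2, ← sub_eq_zero]
    field_simp
    rw [hpdef]; ring
  | succ j =>
    rw [Pi.add_apply, obsA_transpose_map_mulVec_succ]
    simp only [Pi.smul_apply, smul_eq_mul, complexify, obsE]
    rw [← mul_div_assoc, ← pow_succ']
    rw [if_neg (Nat.succ_ne_zero j), Complex.ofReal_zero, add_zero]
    congr 2
    omega

/-- With `p` the characteristic polynomial, `s p(s) = s^(n+1) + a₁ p(s) + ∑ s^(n-j) B_j`; this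
is what the definition of `B` is made for. -/
theorem mul_pow_add_sum {n : ℕ} [NeZero n] (a : Fin n → ℝ) (s : ℂ) :
    s * (s ^ n + ∑ j : Fin n, (a j : ℂ) * s ^ (n - 1 - (j : ℕ)))
      = s ^ (n + 1) + (a 0 : ℂ) * (s ^ n + ∑ j : Fin n, (a j : ℂ) * s ^ (n - 1 - (j : ℕ)))
        + ∑ j : Fin n, s ^ (n - 1 - (j : ℕ)) * (obsB a j : ℂ) := by
  obtain ⟨m, rfl⟩ : ∃ m, n = m + 1 := ⟨n - 1, by have := NeZero.pos n; omega⟩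
  have h1 : ∑ j : Fin (m + 1), s ^ (m + 1 - 1 - (j : ℕ)) * (obsB a j : ℂ)
      = (∑ j : Fin m, s ^ (m - (j : ℕ)) * (a j.succ : ℂ))
        - (a 0 : ℂ) * ∑ j : Fin (m + 1), (a j : ℂ) * s ^ (m + 1 - 1 - (j : ℕ)) := by
    have h2 : ∀ j : Fin (m + 1), s ^ (m + 1 - 1 - (j : ℕ)) * (obsB a j : ℂ)
        = s ^ (m - (j : ℕ)) * ((if h : (j : ℕ) + 1 < m + 1 then a ⟨(j : ℕ) + 1, h⟩ else 0 : ℝ) : ℂ)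
          - (a 0 : ℂ) * ((a j : ℂ) * s ^ (m + 1 - 1 - (j : ℕ))) := by
      intro j
      rw [obsB]
      push_cast
      ring
    rw [Finset.sum_congr rfl fun j _ => h2 j, Finset.sum_sub_distrib, ← Finset.mul_sum,
      Fin.sum_univ_castSucc]
    congr 1
    simp [Fin.succ]
  rw [h1, Fin.sum_univ_succ]
  have h3 : s * ∑ j : Fin m, (a j.succ : ℂ) * s ^ (m + 1 - 1 - ((j.succ : Fin (m + 1)) : ℕ))
      = ∑ j : Fin m, s ^ (m - (j : ℕ)) * (a j.succ : ℂ) := by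
    rw [Finset.mul_sum]
    refine Finset.sum_congr rfl fun j _ => ?_
    have hj := j.2
    have : m - (j : ℕ) = (m + 1 - 1 - ((j.succ : Fin (m + 1)) : ℕ)) + 1 := by simp; omega
    rw [this, pow_succ]; ring
  simp only [Fin.val_zero, Nat.add_sub_cancel, tsub_zero] at h3 ⊢
  rw [mul_add, mul_add, h3]
  ring

/-- The harmonic steady state satisfies the filtered representation
`s = Eᵀ η + a₁ + χᵀ Fᵀ θ` when `s = i ω_m`. -/
theorem exists_harmonic_steady_state {l : ℕ} [NeZero l] {a : Fin (2 * l - 1) → ℝ}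
    (ha : IsHurwitzCoeffs a) (ω : Fin l → ℝ) (m : Fin l) :
    ∃ v u : Fin (2 * l - 1) → ℂ,
      (obsA a).map Complex.ofReal *ᵥ v + complexify (obsB a) = (Complex.I * (ω m : ℂ)) • v ∧
      ((obsA a)ᵀ).map Complex.ofReal *ᵥ u + complexify (obsE (2 * l - 1))
        = (Complex.I * (ω m : ℂ)) • u ∧
      v 0 + a 0 + ∑ j, u j * (((obsF l)ᵀ *ᵥ leaderTheta ω) j : ℂ) = Complex.I * (ω m : ℂ) := by
  have hl := NeZero.pos l
  set s : ℂ := Complex.I * (ω m : ℂ) with hs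
  set p := s ^ (2 * l - 1) + ∑ j : Fin (2 * l - 1), (a j : ℂ) * s ^ (2 * l - 1 - 1 - (j : ℕ))
    with hpdef
  have hp : p ≠ 0 := fun h => by
    have := ha s h
    simp [hs] at this
  set u : Fin (2 * l - 1) → ℂ := fun j => s ^ (2 * l - 1 - 1 - (j : ℕ)) / p with hu
  have hu' : ((obsA a)ᵀ).map Complex.ofReal *ᵥ u + complexify (obsE (2 * l - 1)) = s • u :=
    obsA_transpose_mulVec_pow a hp
  have hunit := ha.isStableMatrix.isUnit_sub (s := s) (by simp [hs])
  rw [Matrix.isUnit_iff_isUnit_det] at hunit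
  set v := (s • (1 : Matrix (Fin (2 * l - 1)) (Fin (2 * l - 1)) ℂ)
    - (obsA a).map Complex.ofReal)⁻¹ *ᵥ complexify (obsB a) with hv
  have hv' : s • v - (obsA a).map Complex.ofReal *ᵥ v = complexify (obsB a) := by
    have : s • v - (obsA a).map Complex.ofReal *ᵥ v
        = (s • (1 : Matrix (Fin (2 * l - 1)) (Fin (2 * l - 1)) ℂ)
          - (obsA a).map Complex.ofReal) *ᵥ v := by
      rw [Matrix.sub_mulVec, Matrix.smul_mulVec, Matrix.one_mulVec]
    rw [this, hv, Matrix.mulVec_mulVec, Matrix.mul_nonsing_inv _ hunit, Matrix.one_mulVec]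
  refine ⟨v, u, by rw [← hv']; abel, hu', ?_⟩
  -- pair the two resolvent equations with each other
  have hdual : v 0 = u ⬝ᵥ complexify (obsB a) := by
    have h1 : complexify (obsE (2 * l - 1)) ⬝ᵥ v = v 0 := by
      rw [dotProduct, Finset.sum_eq_single 0]
      · simp [complexify, obsE]
      · intro i _ hi
        have : (i : ℕ) ≠ 0 := fun h => hi (Fin.ext h)
        simp [complexify, obsE, this]
      · simp
    have h2 : complexify (obsE (2 * l - 1)) = s • u - ((obsA a)ᵀ).map Complex.ofReal *ᵥ u := by
      rw [← hu']; abel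
    rw [← h1, h2, ← hv', sub_dotProduct, dotProduct_sub, smul_dotProduct, dotProduct_smul,
      Matrix.transpose_map, Matrix.mulVec_transpose, ← Matrix.dotProduct_mulVec]
  have hF : ∑ j, u j * (((obsF l)ᵀ *ᵥ leaderTheta ω) j : ℂ)
      = -∑ k : Fin l, (leaderTheta ω k : ℂ) * s ^ (2 * (l - 1 - (k : ℕ))) / p := by
    have h1 : ∀ j, u j * (((obsF l)ᵀ *ᵥ leaderTheta ω) j : ℂ)
        = ∑ k : Fin l, if (j : ℕ) = 2 * (k : ℕ) then -(u j * leaderTheta ω k) else 0 := by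
      intro j
      rw [Matrix.mulVec, dotProduct, Complex.ofReal_sum, Finset.mul_sum]
      refine Finset.sum_congr rfl fun k _ => ?_
      simp only [obsF, Matrix.transpose_apply, Matrix.of_apply]
      split_ifs <;> simp
    rw [Finset.sum_congr rfl fun j _ => h1 j, Finset.sum_comm, ← Finset.sum_neg_distrib]
    refine Finset.sum_congr rfl fun k _ => ?_
    have hk := k.2
    rw [Finset.sum_eq_single ⟨2 * (k : ℕ), by omega⟩]
    · have : 2 * (l - 1 - (k : ℕ)) = 2 * l - 1 - 1 - 2 * (k : ℕ) := by omega
      simp only [if_true, hu, this]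
      ring
    · intro j _ hj
      exact if_neg fun h => hj (Fin.ext h)
    · simp
  have hB : u ⬝ᵥ complexify (obsB a)
      = (∑ j : Fin (2 * l - 1), s ^ (2 * l - 1 - 1 - (j : ℕ)) * (obsB a j : ℂ)) / p := by
    rw [dotProduct, Finset.sum_div]
    refine Finset.sum_congr rfl fun j _ => ?_
    simp only [hu, complexify]; ring
  have hsp := mul_pow_add_sum a s
  rw [← hpdef] at hsp
  have hpow := pow_eq_neg_sum_leaderTheta ω m
  rw [← hs] at hpow
  have hn : 2 * l - 1 + 1 = 2 * l := by omega
  rw [hn, hpow] at hsp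
  rw [hdual, hF, hB, ← Finset.sum_div]
  field_simp
  rw [mul_comm p s, hsp]
  ring

/-- A bounded trajectory of the filters driven by `y` that represents `y` without error:
`y' = Eᵀ η + a₁ y + χᵀ Fᵀ θ`. -/
structure IsSteadyState {l : ℕ} [NeZero l] (a : Fin (2 * l - 1) → ℝ) (θ : Fin l → ℝ) (y : ℝ → ℝ)
    (η χ : ℝ → Fin (2 * l - 1) → ℝ) : Prop where
  eta : ∀ t, HasDerivAt η (obsA a *ᵥ η t + y t • obsB a) t
  chi : ∀ t, HasDerivAt χ ((obsA a)ᵀ *ᵥ χ t + y t • obsE (2 * l - 1)) t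
  out : ∀ t, HasDerivAt y
    (obsE (2 * l - 1) ⬝ᵥ η t + a 0 * y t + χ t ⬝ᵥ ((obsF l)ᵀ *ᵥ θ)) t
  bounded : ∃ C, ∀ t, ‖η t‖ ≤ C ∧ ‖χ t‖ ≤ C ∧ ‖y t‖ ≤ C

theorem obsE_dotProduct {n : ℕ} [NeZero n] (x : Fin n → ℝ) : obsE n ⬝ᵥ x = x 0 := by
  rw [dotProduct, Finset.sum_eq_single 0]
  · simp [obsE]
  · intro i _ hi
    have : (i : ℕ) ≠ 0 := fun h => hi (Fin.ext h)
    simp [obsE, this]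
  · simp

/-- The complex harmonic `φ exp (i (ω t + ψ))`. -/
noncomputable def phasor (φ ω ψ : ℝ) (t : ℝ) : ℂ :=
  φ * Complex.exp (Complex.I * (ω * t + ψ))

theorem phasor_im (φ ω ψ t : ℝ) : (phasor φ ω ψ t).im = φ * Real.sin (ω * t + ψ) := by
  have : Complex.I * ((ω : ℂ) * t + ψ) = ((ω * t + ψ : ℝ) : ℂ) * Complex.I := by
    push_cast; ring
  rw [phasor, this, Complex.im_ofReal_mul, Complex.exp_ofReal_mul_I_im]

theorem norm_phasor (φ ω ψ t : ℝ) : ‖phasor φ ω ψ t‖ = |φ| := by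
  have : Complex.I * ((ω : ℂ) * t + ψ) = ((ω * t + ψ : ℝ) : ℂ) * Complex.I := by
    push_cast; ring
  rw [phasor, this, norm_mul, Complex.norm_exp_ofReal_mul_I, mul_one, Complex.norm_real,
    Real.norm_eq_abs]

theorem hasDerivAt_phasor_mul_im (φ ω ψ : ℝ) (z : ℂ) (t : ℝ) :
    HasDerivAt (fun t => (phasor φ ω ψ t * z).im)
      (phasor φ ω ψ t * ((Complex.I * ω) * z)).im t := by
  have h1 : HasDerivAt (fun t : ℝ => Complex.I * ((ω : ℂ) * t + ψ)) (Complex.I * ω) t := by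
    have h := ((Complex.ofRealCLM.hasDerivAt (x := t)).const_mul (ω : ℂ)).add_const (ψ : ℂ)
    simpa using h.const_mul Complex.I
  have h2 := ((h1.cexp).const_mul (φ : ℂ)).mul_const z
  have h3 := Complex.imCLM.hasFDerivAt.comp_hasDerivAt t h2
  refine HasDerivAt.congr_deriv (f := fun t => (phasor φ ω ψ t * z).im) h3 ?_
  simp only [Complex.imCLM_apply, phasor]
  congr 1; ring

/-- The response to a superposition of harmonics. -/
theorem hasDerivAt_sum_phasor {l n : ℕ} (φ ω ψ : Fin l → ℝ) {A : Matrix (Fin n) (Fin n) ℝ}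
    {b : Fin n → ℝ} {v : Fin l → Fin n → ℂ}
    (hv : ∀ k, A.map Complex.ofReal *ᵥ v k + complexify b = (Complex.I * (ω k : ℂ)) • v k) (t : ℝ) :
    HasDerivAt (fun t => fun j => ∑ k, (phasor (φ k) (ω k) (ψ k) t * v k j).im)
      (A *ᵥ (fun j => ∑ k, (phasor (φ k) (ω k) (ψ k) t * v k j).im)
        + leaderSignal φ ω ψ t • b) t := by
  rw [hasDerivAt_pi]
  intro j
  have h1 := HasDerivAt.fun_sum fun k (_ : k ∈ Finset.univ) =>
    hasDerivAt_phasor_mul_im (φ k) (ω k) (ψ k) (v k j) t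
  refine h1.congr_deriv ?_
  have h2 : ∀ k, (phasor (φ k) (ω k) (ψ k) t * ((Complex.I * ω k) * v k j)).im
      = (∑ i, A j i * (phasor (φ k) (ω k) (ψ k) t * v k i).im)
        + φ k * Real.sin (ω k * t + ψ k) * b j := by
    intro k
    have h3 := congrFun (hv k) j
    rw [Pi.smul_apply, smul_eq_mul] at h3
    rw [← h3, ← phasor_im, Pi.add_apply, mul_add, Complex.add_im]
    congr 1
    · rw [Matrix.mulVec, dotProduct, Finset.mul_sum, Complex.im_sum]
      refine Finset.sum_congr rfl fun i _ => ?_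
      rw [Matrix.map_apply, mul_left_comm, Complex.im_ofReal_mul]
    · rw [complexify, mul_comm, Complex.im_ofReal_mul, mul_comm]
  rw [Finset.sum_congr rfl fun k _ => h2 k, Finset.sum_add_distrib, Finset.sum_comm,
    ← Finset.sum_mul]
  simp only [Pi.add_apply, Matrix.mulVec, dotProduct, Finset.mul_sum, Pi.smul_apply, smul_eq_mul,
    leaderSignal]

theorem abs_sum_phasor_le {l n : ℕ} (φ ω ψ : Fin l → ℝ) (v : Fin l → Fin n → ℂ) (t : ℝ) :
    ‖(fun j => ∑ k, (phasor (φ k) (ω k) (ψ k) t * v k j).im : Fin n → ℝ)‖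
      ≤ ∑ k, |φ k| * ‖v k‖ := by
  have h0 : 0 ≤ ∑ k, |φ k| * ‖v k‖ := Finset.sum_nonneg fun k _ => by positivity
  rw [pi_norm_le_iff_of_nonneg h0]
  intro j
  refine (norm_sum_le _ _).trans (Finset.sum_le_sum fun k _ => ?_)
  refine (Complex.abs_im_le_norm _).trans ?_
  rw [norm_mul, norm_phasor]
  exact mul_le_mul_of_nonneg_left (norm_le_pi_norm _ _) (abs_nonneg _)

/-- Superposition of the harmonic steady states. -/
theorem exists_isSteadyState {l : ℕ} [NeZero l] (φ ω ψ : Fin l → ℝ) {a : Fin (2 * l - 1) → ℝ}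
    (ha : IsHurwitzCoeffs a) :
    ∃ η χ, IsSteadyState a (leaderTheta ω) (leaderSignal φ ω ψ) η χ := by
  choose v u hv hu hvu using fun m => exists_harmonic_steady_state ha ω m
  refine ⟨_, _, fun t => hasDerivAt_sum_phasor φ ω ψ hv t,
    fun t => hasDerivAt_sum_phasor φ ω ψ hu t, fun t => ?_,
    max (max (∑ k, |φ k| * ‖v k‖) (∑ k, |φ k| * ‖u k‖)) (∑ k, |φ k|), fun t =>
    ⟨(abs_sum_phasor_le φ ω ψ v t).trans ((le_max_left _ _).trans (le_max_left _ _)),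
      (abs_sum_phasor_le φ ω ψ u t).trans ((le_max_right _ _).trans (le_max_left _ _)),
      le_trans ?_ (le_max_right _ _)⟩⟩
  · have h1 := HasDerivAt.fun_sum fun k (_ : k ∈ Finset.univ) =>
      hasDerivAt_phasor_mul_im (φ k) (ω k) (ψ k) 1 t
    simp only [mul_one, phasor_im] at h1
    refine HasDerivAt.congr_deriv (f := leaderSignal φ ω ψ) h1 ?_
    have h2 : ∀ k, (phasor (φ k) (ω k) (ψ k) t * (Complex.I * ω k)).im
        = (phasor (φ k) (ω k) (ψ k) t * v k 0).im + a 0 * (φ k * Real.sin (ω k * t + ψ k))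
          + ∑ j, (phasor (φ k) (ω k) (ψ k) t * u k j).im
            * ((obsF l)ᵀ *ᵥ leaderTheta ω) j := by
      intro k
      rw [← hvu k, mul_add, mul_add, Complex.add_im, Complex.add_im, ← phasor_im,
        Finset.mul_sum, Complex.im_sum]
      congr 1
      · rw [mul_comm _ (a 0 : ℂ), Complex.im_ofReal_mul]
      · refine Finset.sum_congr rfl fun j _ => ?_
        rw [← mul_assoc, mul_comm _ (((obsF l)ᵀ *ᵥ leaderTheta ω) j : ℂ), Complex.im_ofReal_mul,
          mul_comm]
    rw [Finset.sum_congr rfl fun k _ => h2 k, Finset.sum_add_distrib, Finset.sum_add_distrib,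
      Finset.sum_comm, ← Finset.mul_sum, obsE_dotProduct]
    simp only [dotProduct, Finset.sum_mul, leaderSignal]
  · refine (norm_sum_le _ _).trans (Finset.sum_le_sum fun k _ => ?_)
    rw [norm_mul, Real.norm_eq_abs, Real.norm_eq_abs]
    exact mul_le_of_le_one_right (abs_nonneg _) (Real.abs_sin_le_one _)

/-! ### The error system -/

open Set in
/-- A solution on `[0, T]` of the observer, with right derivatives. -/
structure IsObserverOn {N l : ℕ} [NeZero l] (G : Digraph (Fin (N + 1)))
    (a : Fin N → Fin (2 * l - 1) → ℝ) (κ μ : ℝ) (y : ℝ → ℝ) (T : ℝ)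
    (ηh χh : Fin N → ℝ → Fin (2 * l - 1) → ℝ) (θh : Fin N → ℝ → Fin l → ℝ)
    (yh : Fin N → ℝ → ℝ) : Prop where
  eta_cont : ∀ i, ContinuousOn (ηh i) (Icc 0 T)
  chi_cont : ∀ i, ContinuousOn (χh i) (Icc 0 T)
  theta_cont : ∀ i, ContinuousOn (θh i) (Icc 0 T)
  out_cont : ∀ i, ContinuousOn (yh i) (Icc 0 T)
  eta : ∀ i, ∀ t ∈ Ico 0 T, HasDerivWithinAt (ηh i)
    (obsA (a i) *ᵥ ηh i t + yh i t • obsB (a i)) (Ici t) t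
  chi : ∀ i, ∀ t ∈ Ico 0 T, HasDerivWithinAt (χh i)
    ((obsA (a i))ᵀ *ᵥ χh i t + yh i t • obsE (2 * l - 1)) (Ici t) t
  theta : ∀ i, ∀ t ∈ Ico 0 T, HasDerivWithinAt (θh i)
    ((κ * relativeOutput G (fun j => yh j t) (y t) i) • (obsF l *ᵥ χh i t)) (Ici t) t
  out : ∀ i, ∀ t ∈ Ico 0 T, HasDerivWithinAt (yh i)
    (obsE (2 * l - 1) ⬝ᵥ ηh i t + a i 0 * yh i t + χh i t ⬝ᵥ ((obsF l)ᵀ *ᵥ θh i t)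
      + μ * relativeOutput G (fun j => yh j t) (y t) i) (Ici t) t

open Set in
/-- A solution on `[0, T]` of the error system: `η`, `χ` are the deviations from a steady state
whose second component is `χs`, `ϑ` is the deviation from `θ`, and `e` that of the outputs. -/
structure IsErrorTrajectory {N l : ℕ} [NeZero l] (H : Matrix (Fin N) (Fin N) ℝ)
    (a : Fin N → Fin (2 * l - 1) → ℝ) (κ μ : ℝ) (θ : Fin l → ℝ)
    (χs : Fin N → ℝ → Fin (2 * l - 1) → ℝ) (T : ℝ)
    (η χ : Fin N → ℝ → Fin (2 * l - 1) → ℝ) (ϑ : Fin N → ℝ → Fin l → ℝ)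
    (e : ℝ → Fin N → ℝ) : Prop where
  eta_cont : ∀ i, ContinuousOn (η i) (Icc 0 T)
  chi_cont : ∀ i, ContinuousOn (χ i) (Icc 0 T)
  theta_cont : ∀ i, ContinuousOn (ϑ i) (Icc 0 T)
  err_cont : ContinuousOn e (Icc 0 T)
  eta : ∀ i, ∀ t ∈ Ico 0 T, HasDerivWithinAt (η i)
    (obsA (a i) *ᵥ η i t + e t i • obsB (a i)) (Ici t) t
  chi : ∀ i, ∀ t ∈ Ico 0 T, HasDerivWithinAt (χ i)
    ((obsA (a i))ᵀ *ᵥ χ i t + e t i • obsE (2 * l - 1)) (Ici t) t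
  theta : ∀ i, ∀ t ∈ Ico 0 T, HasDerivWithinAt (ϑ i)
    (-(κ * (H *ᵥ e t) i) • (obsF l *ᵥ (χ i t + χs i t))) (Ici t) t
  err : ∀ i, ∀ t ∈ Ico 0 T, HasDerivWithinAt (fun t => e t i)
    (obsE (2 * l - 1) ⬝ᵥ η i t + a i 0 * e t i + (obsF l *ᵥ χ i t) ⬝ᵥ θ - μ * (H *ᵥ e t) i
      + (obsF l *ᵥ (χ i t + χs i t)) ⬝ᵥ ϑ i t) (Ici t) t

theorem dotProduct_obsF_transpose_mulVec {l : ℕ} (x : Fin (2 * l - 1) → ℝ) (θ : Fin l → ℝ) :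
    x ⬝ᵥ ((obsF l)ᵀ *ᵥ θ) = (obsF l *ᵥ x) ⬝ᵥ θ := by
  rw [Matrix.dotProduct_mulVec, Matrix.vecMul_transpose]

theorem IsObserverOn.isErrorTrajectory {N l : ℕ} [NeZero l] {G : Digraph (Fin (N + 1))}
    (hG : IsLeaderFollowerNetwork G) {a : Fin N → Fin (2 * l - 1) → ℝ} {κ μ : ℝ} {y : ℝ → ℝ}
    {T : ℝ} {ηh χh : Fin N → ℝ → Fin (2 * l - 1) → ℝ} {θh : Fin N → ℝ → Fin l → ℝ}
    {yh : Fin N → ℝ → ℝ} (h : IsObserverOn G a κ μ y T ηh χh θh yh) {θ : Fin l → ℝ}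
    {ηs χs : Fin N → ℝ → Fin (2 * l - 1) → ℝ}
    (hs : ∀ i, IsSteadyState (a i) θ y (ηs i) (χs i)) :
    IsErrorTrajectory (followerMatrix G) a κ μ θ χs T (fun i t => ηh i t - ηs i t)
      (fun i t => χh i t - χs i t) (fun i t => θh i t - θ) (fun t i => yh i t - y t) where
  eta_cont i := (h.eta_cont i).sub fun t _ => ((hs i).eta t).continuousAt.continuousWithinAt
  chi_cont i := (h.chi_cont i).sub fun t _ => ((hs i).chi t).continuousAt.continuousWithinAt
  theta_cont i := (h.theta_cont i).sub continuousOn_const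
  err_cont := continuousOn_pi.2 fun i => (h.out_cont i).sub fun t _ =>
    ((hs i).out t).continuousAt.continuousWithinAt
  eta i t ht := by
    refine ((h.eta i t ht).sub ((hs i).eta t).hasDerivWithinAt).congr_deriv ?_
    rw [Matrix.mulVec_sub, sub_smul]; abel
  chi i t ht := by
    refine ((h.chi i t ht).sub ((hs i).chi t).hasDerivWithinAt).congr_deriv ?_
    rw [Matrix.mulVec_sub, sub_smul]; abel
  theta i t ht := by
    refine ((h.theta i t ht).sub_const θ).congr_deriv ?_
    rw [relativeOutput_eq hG, sub_add_cancel, mul_neg]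
  err i t ht := by
    refine ((h.out i t ht).sub ((hs i).out t).hasDerivWithinAt).congr_deriv ?_
    rw [relativeOutput_eq hG, sub_add_cancel]
    simp only [dotProduct_obsF_transpose_mulVec, dotProduct_sub, Matrix.mulVec_sub,
      sub_dotProduct]
    ring

/-! ### The energy estimate -/

theorem HasDerivWithinAt.dotProduct_vec {n : ℕ} {x z : ℝ → Fin n → ℝ} {x' z' : Fin n → ℝ}
    {s : Set ℝ} {t : ℝ} (hx : HasDerivWithinAt x x' s t) (hz : HasDerivWithinAt z z' s t) :
    HasDerivWithinAt (fun t => x t ⬝ᵥ z t) (x' ⬝ᵥ z t + x t ⬝ᵥ z') s t := by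
  rw [hasDerivWithinAt_pi] at hx hz
  refine (HasDerivWithinAt.fun_sum fun i (_ : i ∈ Finset.univ) =>
    (hx i).mul (hz i)).congr_deriv ?_
  simp only [dotProduct, Finset.sum_add_distrib]

theorem HasDerivWithinAt.const_mulVec {m n : ℕ} (A : Matrix (Fin m) (Fin n) ℝ)
    {x : ℝ → Fin n → ℝ} {x' : Fin n → ℝ} {s : Set ℝ} {t : ℝ} (hx : HasDerivWithinAt x x' s t) :
    HasDerivWithinAt (fun t => A *ᵥ x t) (A *ᵥ x') s t := by
  exact A.mulVecLin.toContinuousLinearMap.hasFDerivAt.comp_hasDerivWithinAt t hx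

theorem ContinuousOn.const_mulVec {m n : ℕ} (A : Matrix (Fin m) (Fin n) ℝ) {x : ℝ → Fin n → ℝ}
    {s : Set ℝ} (hx : ContinuousOn x s) : ContinuousOn (fun t => A *ᵥ x t) s :=
  A.mulVecLin.toContinuousLinearMap.continuous.comp_continuousOn hx

theorem ContinuousOn.dotProduct_vec {n : ℕ} {x z : ℝ → Fin n → ℝ} {s : Set ℝ}
    (hx : ContinuousOn x s) (hz : ContinuousOn z s) : ContinuousOn (fun t => x t ⬝ᵥ z t) s := by
  rw [continuousOn_pi] at hx hz
  exact continuousOn_finsetSum _ fun i _ => (hx i).mul (hz i)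

theorem hInfNorm_nonneg {p q : ℕ} (G : ℂ → Matrix (Fin p) (Fin q) ℂ) : 0 ≤ hInfNorm G := by
  open scoped Matrix.Norms.L2Operator in
  exact Real.iSup_nonneg fun w => norm_nonneg (G (Complex.I * (w : ℂ)))

theorem dotProduct_self_nonneg_real {n : ℕ} (x : Fin n → ℝ) : 0 ≤ x ⬝ᵥ x :=
  Finset.sum_nonneg fun i _ => mul_self_nonneg (x i)

/-- The storage function `½ eᵀ H e + (2 κ)⁻¹ ∑ |ϑ_i|²`. -/
noncomputable def storage {N l : ℕ} (H : Matrix (Fin N) (Fin N) ℝ) (κ : ℝ) (e : Fin N → ℝ)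
    (ϑ : Fin N → Fin l → ℝ) : ℝ :=
  1 / 2 * (e ⬝ᵥ H *ᵥ e) + (2 * κ)⁻¹ * ∑ i, ϑ i ⬝ᵥ ϑ i

/-- The supply rate: what remains of `(H e)ᵀ e'` once the parameter errors cancel. -/
noncomputable def supplyRate {N l : ℕ} [NeZero l] (H : Matrix (Fin N) (Fin N) ℝ)
    (a : Fin N → Fin (2 * l - 1) → ℝ) (μ : ℝ) (θ : Fin l → ℝ)
    (η χ : Fin N → Fin (2 * l - 1) → ℝ) (e : Fin N → ℝ) : ℝ :=
  ∑ i, (H *ᵥ e) i * (obsE (2 * l - 1) ⬝ᵥ η i + a i 0 * e i + (obsF l *ᵥ χ i) ⬝ᵥ θ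
    - μ * (H *ᵥ e) i)

open Set in
/-- Along the error system the storage function has the supply rate as its derivative: the adaptation
law cancels the terms that contain the parameter errors `ϑ`. -/
theorem IsErrorTrajectory.hasDerivWithinAt_storage {N l : ℕ} [NeZero l]
    {H : Matrix (Fin N) (Fin N) ℝ} (hH : H.IsHermitian) {a : Fin N → Fin (2 * l - 1) → ℝ}
    {κ μ : ℝ} (hκ : 0 < κ) {θ : Fin l → ℝ} {χs : Fin N → ℝ → Fin (2 * l - 1) → ℝ} {T : ℝ}
    {η χ : Fin N → ℝ → Fin (2 * l - 1) → ℝ} {ϑ : Fin N → ℝ → Fin l → ℝ} {e : ℝ → Fin N → ℝ}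
    (h : IsErrorTrajectory H a κ μ θ χs T η χ ϑ e) {t : ℝ} (ht : t ∈ Ico 0 T) :
    HasDerivWithinAt (fun t => storage H κ (e t) fun i => ϑ i t)
      (supplyRate H a μ θ (fun i => η i t) (fun i => χ i t) (e t)) (Ici t) t := by
  have he := hasDerivWithinAt_pi.2 fun i => h.err i t ht
  have h1 := (he.dotProduct_vec (he.const_mulVec H)).const_mul (1 / 2)
  have h2 := (HasDerivWithinAt.fun_sum fun i (_ : i ∈ Finset.univ) =>
    (h.theta i t ht).dotProduct_vec (h.theta i t ht)).const_mul (2 * κ)⁻¹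
  refine (h1.add h2).congr_deriv ?_
  have hsymm : ∀ x z : Fin N → ℝ, x ⬝ᵥ H *ᵥ z = (H *ᵥ x) ⬝ᵥ z := by
    intro x z
    have hT : Hᵀ = H := by simpa using hH.eq
    rw [Matrix.dotProduct_mulVec, ← Matrix.mulVec_transpose, hT]
  rw [hsymm (e t), dotProduct_comm _ (H *ᵥ e t), ← two_mul, ← mul_assoc]
  simp only [dotProduct_smul, smul_dotProduct, smul_eq_mul, supplyRate]
  rw [show (1 / 2 * 2 : ℝ) = 1 by norm_num, one_mul, dotProduct, Finset.mul_sum,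
    ← Finset.sum_add_distrib]
  refine Finset.sum_congr rfl fun i _ => ?_
  rw [dotProduct_comm (ϑ i t)]
  field_simp
  ring

/-- The pointwise bound of the supply rate by Young's inequality. -/
theorem supplyRate_le {N l : ℕ} [NeZero l] {H : Matrix (Fin N) (Fin N) ℝ}
    {a : Fin N → Fin (2 * l - 1) → ℝ} {lam abar π : ℝ} (μ : ℝ) {θ : Fin l → ℝ} (hlam : 0 < lam)
    (hH : ∀ e : Fin N → ℝ, lam ^ 2 * (e ⬝ᵥ e) ≤ (H *ᵥ e) ⬝ᵥ (H *ᵥ e))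
    (ha : ∀ i, 0 ≤ a i 0 ∧ a i 0 ≤ abar) (habar : 0 ≤ abar) (hθ : θ ⬝ᵥ θ ≤ π)
    (η χ : Fin N → Fin (2 * l - 1) → ℝ) (e : Fin N → ℝ) :
    supplyRate H a μ θ η χ e
      ≤ (abar / lam + (1 + π) / 2 - μ) * ((H *ᵥ e) ⬝ᵥ (H *ᵥ e))
        + 1 / 2 * ∑ i, (obsE (2 * l - 1) ⬝ᵥ η i) ^ 2
        + 1 / 2 * ∑ i, (obsF l *ᵥ χ i) ⬝ᵥ (obsF l *ᵥ χ i) := by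
  set w := H *ᵥ e with hw
  have hi : ∀ i, w i * (obsE (2 * l - 1) ⬝ᵥ η i + a i 0 * e i + (obsF l *ᵥ χ i) ⬝ᵥ θ - μ * w i)
      ≤ (abar / (2 * lam) + (1 + π) / 2 - μ) * (w i * w i) + abar * lam / 2 * (e i * e i)
        + 1 / 2 * (obsE (2 * l - 1) ⬝ᵥ η i) ^ 2
        + 1 / 2 * ((obsF l *ᵥ χ i) ⬝ᵥ (obsF l *ᵥ χ i)) := by
    intro i
    set p := obsE (2 * l - 1) ⬝ᵥ η i
    set z := obsF l *ᵥ χ i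
    -- the weights `lam` and `lam⁻¹` in `h4` balance its two terms in view of `hH`
    have h1 : 0 ≤ (w i - p) ^ 2 := sq_nonneg _
    have h2 : 0 ≤ (w i • θ - z) ⬝ᵥ (w i • θ - z) := dotProduct_self_nonneg_real _
    rw [sub_dotProduct, dotProduct_sub, dotProduct_sub, smul_dotProduct, smul_dotProduct,
      dotProduct_smul, dotProduct_smul, dotProduct_comm θ z] at h2
    simp only [smul_eq_mul] at h2
    have h3 : w i * w i * (θ ⬝ᵥ θ) ≤ w i * w i * π :=
      mul_le_mul_of_nonneg_left hθ (mul_self_nonneg _)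
    have h4 : a i 0 * (w i * e i) ≤ abar / (2 * lam) * (w i * w i) + abar * lam / 2 * (e i * e i) := by
      have h5 : 0 ≤ (2 * lam)⁻¹ * (w i - lam * e i) ^ 2 := by positivity
      have h6 : (2 * lam)⁻¹ * (w i - lam * e i) ^ 2
          = (2 * lam)⁻¹ * (w i * w i) - w i * e i + lam / 2 * (e i * e i) := by
        field_simp; ring
      have h7 : w i * e i ≤ (2 * lam)⁻¹ * (w i * w i) + lam / 2 * (e i * e i) := by linarith
      have h8 : 0 ≤ (2 * lam)⁻¹ * (w i * w i) + lam / 2 * (e i * e i) :=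
        add_nonneg (mul_nonneg (by positivity) (mul_self_nonneg _))
          (mul_nonneg (by positivity) (mul_self_nonneg _))
      calc a i 0 * (w i * e i) ≤ a i 0 * ((2 * lam)⁻¹ * (w i * w i) + lam / 2 * (e i * e i)) :=
            mul_le_mul_of_nonneg_left h7 (ha i).1
        _ ≤ abar * ((2 * lam)⁻¹ * (w i * w i) + lam / 2 * (e i * e i)) :=
            mul_le_mul_of_nonneg_right (ha i).2 h8
        _ = _ := by ring
    linarith
  have hsum := Finset.sum_le_sum fun i (_ : i ∈ Finset.univ) => hi i
  simp only [Finset.sum_add_distrib, ← Finset.mul_sum] at hsum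
  have hee : abar * lam / 2 * (e ⬝ᵥ e) ≤ abar / (2 * lam) * (w ⬝ᵥ w) := by
    have h1 := mul_le_mul_of_nonneg_left (hH e) (by positivity : 0 ≤ abar / (2 * lam))
    calc _ = abar / (2 * lam) * (lam ^ 2 * (e ⬝ᵥ e)) := by field_simp
      _ ≤ _ := h1
  have hdiv : abar / (2 * lam) = abar / lam / 2 := by field_simp
  simp only [supplyRate, ← hw]
  change _ ≤ (abar / (2 * lam) + (1 + π) / 2 - μ) * (w ⬝ᵥ w) + abar * lam / 2 * (e ⬝ᵥ e) + _ + _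
    at hsum
  rw [hdiv] at hsum hee
  linarith

theorem IsErrorTrajectory.mono {N l : ℕ} [NeZero l]
    {H : Matrix (Fin N) (Fin N) ℝ} {a : Fin N → Fin (2 * l - 1) → ℝ}
    {κ μ : ℝ} {θ : Fin l → ℝ} {χs : Fin N → ℝ → Fin (2 * l - 1) → ℝ} {S T : ℝ} (hST : S ≤ T)
    {η χ : Fin N → ℝ → Fin (2 * l - 1) → ℝ} {ϑ : Fin N → ℝ → Fin l → ℝ} {e : ℝ → Fin N → ℝ}
    (h : IsErrorTrajectory H a κ μ θ χs T η χ ϑ e) :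
    IsErrorTrajectory H a κ μ θ χs S η χ ϑ e where
  eta_cont i := (h.eta_cont i).mono (Set.Icc_subset_Icc le_rfl hST)
  chi_cont i := (h.chi_cont i).mono (Set.Icc_subset_Icc le_rfl hST)
  theta_cont i := (h.theta_cont i).mono (Set.Icc_subset_Icc le_rfl hST)
  err_cont := h.err_cont.mono (Set.Icc_subset_Icc le_rfl hST)
  eta i t ht := h.eta i t (Set.Ico_subset_Ico le_rfl hST ht)
  chi i t ht := h.chi i t (Set.Ico_subset_Ico le_rfl hST ht)
  theta i t ht := h.theta i t (Set.Ico_subset_Ico le_rfl hST ht)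
  err i t ht := h.err i t (Set.Ico_subset_Ico le_rfl hST ht)

open Set in
/-- The energy estimate: the storage function is bounded and the errors are square integrable,
with a bound that depends only on the initial values. -/
theorem exists_storage_bound {N l : ℕ} [NeZero N] [NeZero l]
    {G : Digraph (Fin (N + 1))} (hG : IsLeaderFollowerNetwork G)
    {a : Fin N → Fin (2 * l - 1) → ℝ} (ha : ∀ i, IsHurwitzCoeffs (a i))
    {κ μ ωbar : ℝ} (hκ : 0 < κ) (hμ : gainBound G ωbar a < μ) {θ : Fin l → ℝ}
    (hθ : θ ⬝ᵥ θ ≤ thetaBound l ωbar) (χs : Fin N → ℝ → Fin (2 * l - 1) → ℝ) (R : ℝ) :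
    ∃ c K : ℝ, 0 < c ∧ ∀ (T : ℝ) (η χ : Fin N → ℝ → Fin (2 * l - 1) → ℝ)
      (ϑ : Fin N → ℝ → Fin l → ℝ) (e : ℝ → Fin N → ℝ), 0 ≤ T →
      IsErrorTrajectory (followerMatrix G) a κ μ θ χs T η χ ϑ e →
      (∀ i, ‖η i 0‖ ≤ R) → (∀ i, ‖χ i 0‖ ≤ R) →
      storage (followerMatrix G) κ (e T) (fun i => ϑ i T) + c * (∫ t in 0..T, e t ⬝ᵥ e t)
        ≤ storage (followerMatrix G) κ (e 0) (fun i => ϑ i 0) + K := by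
  set H := followerMatrix G with hHdef
  set lam := lambdaOne G with hlamdef
  have hlam : 0 < lam := lambdaOne_pos hG
  have hHsq : ∀ e : Fin N → ℝ, lam ^ 2 * (e ⬝ᵥ e) ≤ (H *ᵥ e) ⬝ᵥ (H *ᵥ e) := lambdaOne_sq_mul_le hG
  set abar := ⨆ i, a i 0 with habar
  set γ1 := ⨆ i, gammaOne (a i) with hγ1
  set γ2 := ⨆ i, gammaTwo (a i) with hγ2
  set π := thetaBound l ωbar with hπ
  have ha1 : ∀ i, 0 ≤ a i 0 ∧ a i 0 ≤ abar := fun i =>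
    ⟨(ha i).nonneg, le_ciSup (f := fun i => a i 0) (Set.finite_range _).bddAbove i⟩
  have habar0 : 0 ≤ abar := (ha1 0).1.trans (ha1 0).2
  have hg1 : ∀ i, gammaOne (a i) ^ 2 ≤ γ1 ^ 2 := fun i =>
    pow_le_pow_left₀ (hInfNorm_nonneg _)
      (le_ciSup (f := fun i => gammaOne (a i)) (Set.finite_range _).bddAbove i) 2
  have hg2 : ∀ i, gammaTwo (a i) ^ 2 ≤ γ2 ^ 2 := fun i =>
    pow_le_pow_left₀ (hInfNorm_nonneg _)
      (le_ciSup (f := fun i => gammaTwo (a i)) (Set.finite_range _).bddAbove i) 2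
  have hgain : gainBound G ωbar a
      = abar / lam + (1 + π) / 2 + (γ1 ^ 2 + γ2 ^ 2) / (2 * lam ^ 2) := by
    rw [gainBound, ← hlamdef, ← habar, ← hγ1, ← hγ2, ← hπ]
    field_simp
    ring
  -- half of the slack in the gain pays for the factor `1 + δ` of the `L²` gains
  set ρ := μ - gainBound G ωbar a with hρ
  have hρ0 : 0 < ρ := sub_pos.2 hμ
  set Γ := (γ1 ^ 2 + γ2 ^ 2) / (2 * lam ^ 2) with hΓ
  have hΓ0 : 0 ≤ Γ := by positivity
  set δ := ρ / (2 * (Γ + 1)) with hδdef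
  have hδ : 0 < δ := by positivity
  have hδΓ : δ * Γ ≤ ρ / 2 := by
    have h1 : δ * (Γ + 1) = ρ / 2 := by rw [hδdef]; field_simp
    nlinarith
  choose K1 hK1 using fun i => (ha i).isStableMatrix.exists_integral_sq_le
    (Matrix.replicateRow (Fin 1) (obsE (2 * l - 1))) (obsB (a i)) R hδ
  choose K2 hK2 using fun i => (ha i).isStableMatrix.transpose.exists_integral_sq_le
    (obsF l) (obsE (2 * l - 1)) R hδ
  refine ⟨ρ / 2 * lam ^ 2, 1 / 2 * ∑ i, K1 i + 1 / 2 * ∑ i, K2 i, by positivity,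
    fun T η χ ϑ e hT h hη hχ => ?_⟩
  have hcI : uIcc 0 T = Icc 0 T := uIcc_of_le hT
  have hei : ∀ i, ContinuousOn (fun t => e t i) (Icc 0 T) := fun i => continuousOn_pi.1 h.err_cont i
  have hw : ContinuousOn (fun t => H *ᵥ e t) (Icc 0 T) := h.err_cont.const_mulVec H
  have hF : ∀ i, ContinuousOn (fun t => obsF l *ᵥ χ i t) (Icc 0 T) := fun i =>
    (h.chi_cont i).const_mulVec _
  have hE : ∀ i, ContinuousOn (fun t => obsE (2 * l - 1) ⬝ᵥ η i t) (Icc 0 T) := fun i =>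
    continuousOn_const.dotProduct_vec (h.eta_cont i)
  have hVc : ContinuousOn (fun t => storage H κ (e t) fun i => ϑ i t) (Icc 0 T) :=
    (continuousOn_const.mul (h.err_cont.dotProduct_vec hw)).add (continuousOn_const.mul
      (continuousOn_finsetSum _ fun i _ => (h.theta_cont i).dotProduct_vec (h.theta_cont i)))
  have hSc : ContinuousOn (fun t => supplyRate H a μ θ (fun i => η i t) (fun i => χ i t) (e t))
      (Icc 0 T) := by
    refine continuousOn_finsetSum _ fun i _ => ?_
    have hwi := continuousOn_pi.1 hw i
    exact hwi.mul ((((hE i).add (continuousOn_const.mul (hei i))).add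
      ((hF i).dotProduct_vec continuousOn_const)).sub (continuousOn_const.mul hwi))
  have hint : ∀ {f : ℝ → ℝ}, ContinuousOn f (Icc 0 T) →
      IntervalIntegrable f MeasureTheory.volume 0 T := fun hf =>
    ContinuousOn.intervalIntegrable (by rwa [hcI])
  have hFTC : ∫ t in 0..T, supplyRate H a μ θ (fun i => η i t) (fun i => χ i t) (e t)
      = storage H κ (e T) (fun i => ϑ i T) - storage H κ (e 0) (fun i => ϑ i 0) := by
    refine intervalIntegral.integral_eq_sub_of_hasDeriv_right
      (f := fun t => storage H κ (e t) fun i => ϑ i t) (by rwa [hcI]) ?_ (hint hSc)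
    intro t ht
    rw [min_eq_left hT, max_eq_right hT] at ht
    exact (h.hasDerivWithinAt_storage (followerMatrix_isHermitian hG) hκ ⟨ht.1.le, ht.2⟩).mono
      Ioi_subset_Ici_self
  have hw2 : ContinuousOn (fun t => (H *ᵥ e t) ⬝ᵥ (H *ᵥ e t)) (Icc 0 T) := hw.dotProduct_vec hw
  have hE2 : ContinuousOn (fun t => ∑ i, (obsE (2 * l - 1) ⬝ᵥ η i t) ^ 2) (Icc 0 T) :=
    continuousOn_finsetSum _ fun i _ => (hE i).pow 2
  have hF2 : ContinuousOn (fun t => ∑ i, (obsF l *ᵥ χ i t) ⬝ᵥ (obsF l *ᵥ χ i t)) (Icc 0 T) :=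
    continuousOn_finsetSum _ fun i _ => (hF i).dotProduct_vec (hF i)
  have hee : ContinuousOn (fun t => e t ⬝ᵥ e t) (Icc 0 T) := h.err_cont.dotProduct_vec h.err_cont
  set W := ∫ t in 0..T, (H *ᵥ e t) ⬝ᵥ (H *ᵥ e t) with hW
  set Q := ∫ t in 0..T, e t ⬝ᵥ e t with hQ
  have hei2 : ∀ i, ContinuousOn (fun t => e t i ^ 2) (Icc 0 T) := fun i => (hei i).pow 2
  have hEi2 : ∀ i, ContinuousOn (fun t => (obsE (2 * l - 1) ⬝ᵥ η i t) ^ 2) (Icc 0 T) := fun i =>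
    (hE i).pow 2
  have hQi : Q = ∑ i, ∫ t in 0..T, e t i ^ 2 := by
    rw [hQ, ← intervalIntegral.integral_finsetSum fun i _ => hint (hei2 i)]
    simp only [dotProduct, sq]
  have hQW : lam ^ 2 * Q ≤ W := by
    rw [hQ, ← intervalIntegral.integral_const_mul]
    exact intervalIntegral.integral_mono_on hT (hint (continuousOn_const.mul hee)) (hint hw2)
      fun t _ => hHsq (e t)
  have hQ0 : 0 ≤ Q := intervalIntegral.integral_nonneg hT fun t _ => dotProduct_self_nonneg_real _
  have hI1 : ∫ t in 0..T, ∑ i, (obsE (2 * l - 1) ⬝ᵥ η i t) ^ 2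
      ≤ (1 + δ) * γ1 ^ 2 * Q + ∑ i, K1 i := by
    rw [intervalIntegral.integral_finsetSum fun i _ => hint (hEi2 i), hQi, Finset.mul_sum,
      ← Finset.sum_add_distrib]
    refine Finset.sum_le_sum fun i _ => ?_
    have h1 := hK1 i T (η i) (fun t => e t i) hT (h.eta_cont i) (hei i) (h.eta i) (hη i)
    have h2 : ∀ t, ∑ k, (Matrix.replicateRow (Fin 1) (obsE (2 * l - 1)) *ᵥ η i t) k ^ 2
        = (obsE (2 * l - 1) ⬝ᵥ η i t) ^ 2 := fun t => by
      simp [Matrix.mulVec, dotProduct]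
    simp only [h2] at h1
    refine h1.trans (add_le_add (mul_le_mul_of_nonneg_right
      (mul_le_mul_of_nonneg_left (hg1 i) (by positivity)) ?_) le_rfl)
    exact intervalIntegral.integral_nonneg hT fun t _ => sq_nonneg _
  have hI2 : ∫ t in 0..T, ∑ i, (obsF l *ᵥ χ i t) ⬝ᵥ (obsF l *ᵥ χ i t)
      ≤ (1 + δ) * γ2 ^ 2 * Q + ∑ i, K2 i := by
    rw [intervalIntegral.integral_finsetSum fun i _ => hint ((hF i).dotProduct_vec (hF i)), hQi,
      Finset.mul_sum, ← Finset.sum_add_distrib]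
    refine Finset.sum_le_sum fun i _ => ?_
    have h1 := hK2 i T (χ i) (fun t => e t i) hT (h.chi_cont i) (hei i) (h.chi i) (hχ i)
    have h2 : ∀ t, ∑ k, (obsF l *ᵥ χ i t) k ^ 2
        = (obsF l *ᵥ χ i t) ⬝ᵥ (obsF l *ᵥ χ i t) := fun t => by
      simp only [dotProduct, sq]
    simp only [h2] at h1
    refine h1.trans (add_le_add (mul_le_mul_of_nonneg_right
      (mul_le_mul_of_nonneg_left (hg2 i) (by positivity)) ?_) le_rfl)
    exact intervalIntegral.integral_nonneg hT fun t _ => sq_nonneg _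
  have hcw : ContinuousOn (fun t => (abar / lam + (1 + π) / 2 - μ) * ((H *ᵥ e t) ⬝ᵥ (H *ᵥ e t)))
      (Icc 0 T) := continuousOn_const.mul hw2
  have hcE : ContinuousOn (fun t => 1 / 2 * ∑ i, (obsE (2 * l - 1) ⬝ᵥ η i t) ^ 2) (Icc 0 T) :=
    continuousOn_const.mul hE2
  have hcF : ContinuousOn (fun t => 1 / 2 * ∑ i, (obsF l *ᵥ χ i t) ⬝ᵥ (obsF l *ᵥ χ i t))
      (Icc 0 T) := continuousOn_const.mul hF2
  have hS : ∫ t in 0..T, supplyRate H a μ θ (fun i => η i t) (fun i => χ i t) (e t)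
      ≤ (abar / lam + (1 + π) / 2 - μ) * W
        + 1 / 2 * (∫ t in 0..T, ∑ i, (obsE (2 * l - 1) ⬝ᵥ η i t) ^ 2)
        + 1 / 2 * ∫ t in 0..T, ∑ i, (obsF l *ᵥ χ i t) ⬝ᵥ (obsF l *ᵥ χ i t) := by
    rw [hW, ← intervalIntegral.integral_const_mul, ← intervalIntegral.integral_const_mul,
      ← intervalIntegral.integral_const_mul,
      ← intervalIntegral.integral_add (hint hcw) (hint hcE),
      ← intervalIntegral.integral_add ((hint hcw).add (hint hcE)) (hint hcF)]
    exact intervalIntegral.integral_mono_on hT (hint hSc)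
      (((hint hcw).add (hint hcE)).add (hint hcF))
      fun t _ => supplyRate_le μ hlam hHsq ha1 habar0 hθ _ _ _
  rw [hFTC] at hS
  -- the coefficient of `∫ |H e|²` is negative, so `λ₁² ∫ |e|² ≤ ∫ |H e|²` reduces everything to
  -- `∫ |e|²`, where `(ρ + Γ) - (Γ + ρ / 2) = ρ / 2` is left over
  have hcoef : abar / lam + (1 + π) / 2 - μ = -(ρ + Γ) := by rw [hρ, hgain]; ring
  have hΓQ : 1 / 2 * ((1 + δ) * γ1 ^ 2 * Q) + 1 / 2 * ((1 + δ) * γ2 ^ 2 * Q)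
      = (1 + δ) * Γ * (lam ^ 2 * Q) := by rw [hΓ]; field_simp
  have h1 : (1 + δ) * Γ * (lam ^ 2 * Q) ≤ (Γ + ρ / 2) * (lam ^ 2 * Q) :=
    mul_le_mul_of_nonneg_right (by linarith) (by positivity)
  have h2 : (ρ + Γ) * (lam ^ 2 * Q) ≤ (ρ + Γ) * W :=
    mul_le_mul_of_nonneg_left hQW (by positivity)
  rw [hcoef] at hS
  linarith

/-! ### Global existence for ordinary differential equations -/

open Set Metric in
/-- A `C¹` vector field is Lipschitz in the state, uniformly for bounded times, on every ball. -/
theorem ContDiff.exists_lipschitzOnWith_slice {E : Type*} [NormedAddCommGroup E] [NormedSpace ℝ E]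
    [FiniteDimensional ℝ E] {f : ℝ × E → E} (hf : ContDiff ℝ 1 f) (T : ℝ) (x₀ : E) (r : ℝ) :
    ∃ K, ∀ t ∈ Icc 0 T, LipschitzOnWith K (fun x => f (t, x)) (closedBall x₀ r) := by
  have : ProperSpace E := FiniteDimensional.proper ℝ E
  obtain ⟨K, hK⟩ := (hf.locallyLipschitz.locallyLipschitzOn
    (s := Icc 0 T ×ˢ closedBall x₀ r)).exists_lipschitzOnWith_of_compact
      (isCompact_Icc.prod (isCompact_closedBall x₀ r))
  refine ⟨K, fun t ht x hx z hz => ?_⟩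
  have h := hK (x := (t, x)) ⟨ht, hx⟩ (y := (t, z)) ⟨ht, hz⟩
  simpa [Prod.edist_eq] using h

open Set Metric in
/-- An a priori bound `B` yields a solution on `[0, T]`: the field is cut off outside a ball larger
than `B`, so that the Picard–Lindelöf theorem applies on all of `[0, T]`, and the bound keeps the
solution of the cut-off equation away from the region where the field was changed. -/
theorem exists_solution_Icc {E : Type*} [NormedAddCommGroup E] [NormedSpace ℝ E]
    [FiniteDimensional ℝ E] {f : ℝ × E → E} (hf : ContDiff ℝ 1 f) (x₀ : E) (B : ℝ)
    (hB : ∀ (T : ℝ) (x : ℝ → E), 0 ≤ T → x 0 = x₀ → ContinuousOn x (Icc 0 T) →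
      (∀ t ∈ Ico 0 T, HasDerivWithinAt x (f (t, x t)) (Ici t) t) → ‖x T‖ ≤ B) {T : ℝ} (hT : 0 ≤ T) :
    ∃ x : ℝ → E, x 0 = x₀ ∧ (∀ t ∈ Icc 0 T, ‖x t‖ ≤ B) ∧
      ∀ t ∈ Icc 0 T, HasDerivWithinAt x (f (t, x t)) (Icc 0 T) t := by
  have : ProperSpace E := FiniteDimensional.proper ℝ E
  have : CompleteSpace E := FiniteDimensional.complete ℝ E
  have hB0 : 0 ≤ B := (norm_nonneg _).trans (hB 0 (fun _ => x₀) le_rfl rfl continuousOn_const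
    fun t ht => absurd ht.2 (not_lt.2 ht.1))
  let β : ContDiffBump (0 : E) := ⟨B + 1, B + 2, by linarith, by linarith⟩
  set g : ℝ × E → E := fun p => β p.2 • f p with hg
  have hgc : ContDiff ℝ 1 g := (β.contDiff.comp contDiff_snd).smul hf
  have hgin : ∀ t x, ‖x‖ ≤ B + 1 → g (t, x) = f (t, x) := by
    intro t x hx
    have : β x = 1 := β.one_of_mem_closedBall (by simpa [β] using hx)
    simp [hg, this]
  obtain ⟨M, hM⟩ := (isCompact_Icc.prod (isCompact_closedBall (0 : E) (B + 2))
    |>.exists_bound_of_continuousOn (s := Icc 0 T ×ˢ closedBall (0 : E) (B + 2))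
      hgc.continuous.continuousOn)
  have hM' : ∀ t ∈ Icc 0 T, ∀ x, ‖g (t, x)‖ ≤ max M 0 := by
    intro t ht x
    by_cases hx : ‖x‖ ≤ B + 2
    · exact (hM (t, x) ⟨ht, by simpa using hx⟩).trans (le_max_left _ _)
    · have : β x = 0 := β.zero_of_le_dist (by simpa [β] using (not_le.1 hx).le)
      simp [hg, this]
  let L : NNReal := ⟨max M 0, le_max_right _ _⟩
  let τ : NNReal := ⟨T, hT⟩
  obtain ⟨K, hK⟩ := hgc.exists_lipschitzOnWith_slice T x₀ ((L * τ : NNReal) : ℝ)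
  have hPL : IsPicardLindelof (fun t x => g (t, x)) (tmin := 0) (tmax := T) ⟨0, le_rfl, hT⟩ x₀
      (L * τ) 0 L K :=
    { lipschitzOnWith := hK
      continuousOn := fun x _ => (hgc.continuous.comp (by fun_prop)).continuousOn
      norm_le := fun t ht x _ => hM' t ht x
      mul_max_le := by
        simp only [sub_zero, sub_self, max_eq_left hT, NNReal.coe_mul, NNReal.coe_zero]
        exact le_rfl }
  obtain ⟨x, hx0, hx⟩ := hPL.exists_eq_forall_mem_Icc_hasDerivWithinAt₀
  have hxc : ContinuousOn x (Icc 0 T) := fun t ht => (hx t ht).continuousWithinAt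
  have hbound : ∀ s ∈ Icc 0 T, (∀ t ∈ Ico 0 s, ‖x t‖ ≤ B + 1) → ‖x s‖ ≤ B := by
    intro s hs hlt
    refine hB s x hs.1 hx0 (hxc.mono (Icc_subset_Icc le_rfl hs.2)) fun t ht => ?_
    have h1 := hx t ⟨ht.1, ht.2.le.trans hs.2⟩
    rw [hgin t (x t) (hlt t ht)] at h1
    refine h1.mono_of_mem_nhdsWithin ?_
    exact Filter.mem_of_superset (Icc_mem_nhdsGE_of_mem ⟨le_rfl, ht.2.trans_le hs.2⟩)
      (Icc_subset_Icc ht.1 le_rfl)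
  have hall : ∀ t ∈ Icc 0 T, ‖x t‖ < B + 1 := by
    by_contra hcon
    push Not at hcon
    -- the first time at which the norm reaches `B + 1`
    set S := Icc 0 T ∩ {t | B + 1 ≤ ‖x t‖} with hS
    have hScl : IsClosed S := by
      have := hxc.norm.preimage_isClosed_of_isClosed isClosed_Icc (isClosed_Ici (a := B + 1))
      exact this
    have hSne : S.Nonempty := by obtain ⟨t, ht, ht'⟩ := hcon; exact ⟨t, ht, ht'⟩
    have hSb : BddBelow S := ⟨0, fun t ht => ht.1.1⟩
    have hmem := hScl.csInf_mem hSne hSb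
    have h1 := hbound (sInf S) hmem.1 fun t ht => by
      by_contra h
      exact absurd (csInf_le hSb ⟨⟨ht.1, ht.2.le.trans hmem.1.2⟩, (not_le.1 h).le⟩)
        (not_le.2 ht.2)
    have h2 : B + 1 ≤ ‖x (sInf S)‖ := hmem.2
    linarith
  refine ⟨x, hx0, fun t ht => hbound t ht fun s hs => (hall s ⟨hs.1, hs.2.le.trans ht.2⟩).le,
    fun t ht => ?_⟩
  have h1 := hx t ht
  rwa [hgin t (x t) (hall t ht).le] at h1

open Set Metric in
/-- A differential equation with a `C¹` right-hand side and an a priori bound has a solution on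
`[0, ∞)`. -/
theorem exists_global_solution {E : Type*} [NormedAddCommGroup E] [NormedSpace ℝ E]
    [FiniteDimensional ℝ E] {f : ℝ × E → E} (hf : ContDiff ℝ 1 f) (x₀ : E) (B : ℝ)
    (hB : ∀ (T : ℝ) (x : ℝ → E), 0 ≤ T → x 0 = x₀ → ContinuousOn x (Icc 0 T) →
      (∀ t ∈ Ico 0 T, HasDerivWithinAt x (f (t, x t)) (Ici t) t) → ‖x T‖ ≤ B) :
    ∃ x : ℝ → E, x 0 = x₀ ∧ ∀ t, 0 ≤ t → HasDerivWithinAt x (f (t, x t)) (Ici 0) t := by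
  choose! X hX0 hXB hX' using fun (T : ℝ) (hT : 0 ≤ T) => exists_solution_Icc hf x₀ B hB hT
  have hright : ∀ S T, 0 ≤ S → S ≤ T → ∀ t ∈ Ico 0 S,
      HasDerivWithinAt (X T) (f (t, X T t)) (Ici t) t := by
    intro S T hS hST t ht
    refine (hX' T (hS.trans hST) t ⟨ht.1, ht.2.le.trans hST⟩).mono_of_mem_nhdsWithin ?_
    exact Filter.mem_of_superset (Icc_mem_nhdsGE_of_mem ⟨le_rfl, ht.2.trans_le hST⟩)
      (Icc_subset_Icc ht.1 le_rfl)
  have huniq : ∀ S T, 0 ≤ S → S ≤ T → ∀ t ∈ Icc 0 S, X S t = X T t := by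
    intro S T hS hST
    have hT := hS.trans hST
    obtain ⟨K, hK⟩ := hf.exists_lipschitzOnWith_slice S (0 : E) B
    refine ODE_solution_unique_of_mem_Icc_right (v := fun t x => f (t, x))
      (s := fun _ => closedBall 0 B) (fun t ht => hK t (Ico_subset_Icc_self ht))
      (fun t ht => (hX' S hS t ht).continuousWithinAt) (hright S S hS le_rfl)
      (fun t ht => by simpa using hXB S hS t (Ico_subset_Icc_self ht))
      (fun t ht => (hX' T hT t (Icc_subset_Icc le_rfl hST ht)).continuousWithinAt.mono
        (Icc_subset_Icc le_rfl hST)) (hright S T hS hST)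
      (fun t ht => by simpa using hXB T hT t ⟨ht.1, ht.2.le.trans hST⟩) ?_
    rw [hX0 S hS, hX0 T hT]
  -- by uniqueness the solutions on `[0, T]` agree; the evaluation at `T = t + 1` leaves room to the
  -- right of `t`
  refine ⟨fun t => X (t + 1) t, by simpa using hX0 1 zero_le_one, fun t ht => ?_⟩
  have hev : ∀ s ∈ Icc 0 (t + 1), X (s + 1) s = X (t + 2) s := fun s hs =>
    huniq (s + 1) (t + 2) (by linarith [hs.1]) (by linarith [hs.2]) s ⟨hs.1, by linarith⟩
  have hnhds : Icc 0 (t + 1) ∈ nhdsWithin t (Ici 0) := by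
    rw [← Ici_inter_Iic]
    exact Filter.inter_mem self_mem_nhdsWithin
      (mem_nhdsWithin_of_mem_nhds (Iic_mem_nhds (by linarith)))
  have htt : X (t + 1) t = X (t + 2) t := hev t ⟨ht, by linarith⟩
  have h1 := hX' (t + 2) (by linarith) t ⟨ht, by linarith⟩
  rw [← htt] at h1
  refine (h1.mono_of_mem_nhdsWithin (Filter.mem_of_superset hnhds
    (Icc_subset_Icc le_rfl (by linarith)))).congr_of_eventuallyEq ?_ htt
  exact Filter.mem_of_superset hnhds hev

/-! ### A priori bounds and existence -/

theorem norm_le_one_add_dotProduct_self {n : ℕ} (x : Fin n → ℝ) : ‖x‖ ≤ 1 + x ⬝ᵥ x := by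
  have h0 := dotProduct_self_nonneg_real x
  rw [pi_norm_le_iff_of_nonneg (by linarith)]
  intro i
  have h1 : x i * x i ≤ x ⬝ᵥ x :=
    Finset.single_le_sum (f := fun i => x i * x i) (fun i _ => mul_self_nonneg _)
      (Finset.mem_univ i)
  rw [Real.norm_eq_abs]
  nlinarith [sq_abs (x i), sq_nonneg (|x i| - 1), abs_nonneg (x i)]

open Set in
/-- All components of the error system are bounded, uniformly in the length of the time
interval. -/
theorem exists_error_bound {N l : ℕ} [NeZero N] [NeZero l]
    {G : Digraph (Fin (N + 1))} (hG : IsLeaderFollowerNetwork G)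
    {a : Fin N → Fin (2 * l - 1) → ℝ} (ha : ∀ i, IsHurwitzCoeffs (a i))
    {κ μ ωbar : ℝ} (hκ : 0 < κ) (hμ : gainBound G ωbar a < μ) {θ : Fin l → ℝ}
    (hθ : θ ⬝ᵥ θ ≤ thetaBound l ωbar) (χs : Fin N → ℝ → Fin (2 * l - 1) → ℝ)
    (η₀ χ₀ : Fin N → Fin (2 * l - 1) → ℝ) (ϑ₀ : Fin N → Fin l → ℝ) (e₀ : Fin N → ℝ) :
    ∃ B : ℝ, ∀ (T : ℝ) (η χ : Fin N → ℝ → Fin (2 * l - 1) → ℝ)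
      (ϑ : Fin N → ℝ → Fin l → ℝ) (e : ℝ → Fin N → ℝ), 0 ≤ T →
      IsErrorTrajectory (followerMatrix G) a κ μ θ χs T η χ ϑ e →
      (∀ i, η i 0 = η₀ i) → (∀ i, χ i 0 = χ₀ i) → (∀ i, ϑ i 0 = ϑ₀ i) → e 0 = e₀ →
      (∀ i, ‖η i T‖ ≤ B) ∧ (∀ i, ‖χ i T‖ ≤ B) ∧ (∀ i, ‖ϑ i T‖ ≤ B) ∧ ‖e T‖ ≤ B ∧
        ∫ t in 0..T, e t ⬝ᵥ e t ≤ B := by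
  set R : ℝ := max ‖η₀‖ ‖χ₀‖ with hR
  have hηR : ∀ i, ‖η₀ i‖ ≤ R := fun i => (norm_le_pi_norm η₀ i).trans (le_max_left _ _)
  have hχR : ∀ i, ‖χ₀ i‖ ≤ R := fun i => (norm_le_pi_norm χ₀ i).trans (le_max_right _ _)
  have hR0 : 0 ≤ R := (norm_nonneg _).trans (le_max_left _ _)
  have hlam := lambdaOne_pos hG
  obtain ⟨c, K, hc, hK⟩ := exists_storage_bound hG ha hκ hμ hθ χs R
  set V := storage (followerMatrix G) κ e₀ ϑ₀ + K with hV
  choose M1 α1 hM1 hα1 hS1 using fun i => (ha i).isStableMatrix.exists_norm_le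
  choose M2 α2 hM2 hα2 hS2 using fun i => (ha i).isStableMatrix.transpose.exists_norm_le
  set Be := 1 + 2 * V / lambdaOne G with hBe
  have hstep : ∀ (T : ℝ) (η χ : Fin N → ℝ → Fin (2 * l - 1) → ℝ)
      (ϑ : Fin N → ℝ → Fin l → ℝ) (e : ℝ → Fin N → ℝ), 0 ≤ T →
      IsErrorTrajectory (followerMatrix G) a κ μ θ χs T η χ ϑ e →
      (∀ i, η i 0 = η₀ i) → (∀ i, χ i 0 = χ₀ i) → (∀ i, ϑ i 0 = ϑ₀ i) → e 0 = e₀ →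
      (∀ i, ‖ϑ i T‖ ≤ 1 + 2 * κ * V) ∧ ‖e T‖ ≤ Be ∧ ∫ t in 0..T, e t ⬝ᵥ e t ≤ V / c := by
    intro T η χ ϑ e hT h hη hχ hϑ he
    have h1 := hK T η χ ϑ e hT h (fun i => by rw [hη]; exact hηR i) fun i => by
      rw [hχ]; exact hχR i
    simp only [hϑ, he] at h1
    change _ ≤ V at h1
    have hI : 0 ≤ c * ∫ t in 0..T, e t ⬝ᵥ e t := mul_nonneg hc.le
      (intervalIntegral.integral_nonneg hT fun t _ => dotProduct_self_nonneg_real _)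
    have h2 := lambdaOne_mul_le hG (e T)
    have h3 : 0 ≤ lambdaOne G * (e T ⬝ᵥ e T) :=
      mul_nonneg hlam.le (dotProduct_self_nonneg_real _)
    have h4 : 0 ≤ ∑ i, ϑ i T ⬝ᵥ ϑ i T := Finset.sum_nonneg fun i _ => dotProduct_self_nonneg_real _
    have h4' : 0 ≤ (2 * κ)⁻¹ * ∑ i, ϑ i T ⬝ᵥ ϑ i T := mul_nonneg (by positivity) h4
    rw [storage] at h1
    refine ⟨fun i => (norm_le_one_add_dotProduct_self _).trans ?_,
      (norm_le_one_add_dotProduct_self _).trans ?_, ?_⟩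
    · have h5 : ϑ i T ⬝ᵥ ϑ i T ≤ ∑ i, ϑ i T ⬝ᵥ ϑ i T :=
        Finset.single_le_sum (f := fun i => ϑ i T ⬝ᵥ ϑ i T)
          (fun i _ => dotProduct_self_nonneg_real _) (Finset.mem_univ i)
      have h6 : (2 * κ)⁻¹ * ∑ i, ϑ i T ⬝ᵥ ϑ i T ≤ V := by linarith
      rw [inv_mul_le_iff₀ (by positivity)] at h6
      linarith
    · have h5 : e T ⬝ᵥ e T ≤ 2 * V / lambdaOne G := by
        rw [le_div_iff₀ hlam]; linarith
      rw [hBe]; linarith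
    · rw [le_div_iff₀ hc]; linarith
  -- the filters are driven by the bounded error
  set Bη : Fin N → ℝ := fun i => M1 i * R + M1 i * (Be * ‖obsB (a i)‖) / α1 i with hBη
  set Bχ : Fin N → ℝ := fun i => M2 i * R + M2 i * (Be * ‖obsE (2 * l - 1)‖) / α2 i with hBχ
  refine ⟨max (max ‖Bη‖ ‖Bχ‖) (max (1 + 2 * κ * V) (max Be (V / c))),
    fun T η χ ϑ e hT h hη hχ hϑ he => ?_⟩
  obtain ⟨g1, g2, g3⟩ := hstep T η χ ϑ e hT h hη hχ hϑ he
  have hBe0 : 0 ≤ Be := (norm_nonneg _).trans g2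
  have het : ∀ t ∈ Ico 0 T, ∀ i, |e t i| ≤ Be := fun t ht i =>
    (norm_le_pi_norm (e t) i).trans
      (hstep t η χ ϑ e ht.1 (h.mono ht.2.le) hη hχ hϑ he).2.1
  have hexp : ∀ α : ℝ, 0 < α → Real.exp (-(α * (T - 0))) ≤ 1 := fun α hα => by
    rw [Real.exp_le_one_iff]
    have : 0 ≤ α * (T - 0) := mul_nonneg hα.le (by linarith)
    linarith
  refine ⟨fun i => ?_, fun i => ?_, fun i => (g1 i).trans ?_, g2.trans ?_, g3.trans ?_⟩
  · have h1 := hS1 i (η i) (fun t => e t i • obsB (a i)) 0 T (Be * ‖obsB (a i)‖) hT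
      (h.eta_cont i) (h.eta i) (fun t ht => by
        rw [norm_smul]; exact mul_le_mul_of_nonneg_right (het t ht i) (norm_nonneg _))
      (by positivity)
    have h2 : M1 i * Real.exp (-(α1 i * (T - 0))) * ‖η i 0‖ ≤ M1 i * 1 * R := by
      rw [hη]
      exact mul_le_mul (mul_le_mul_of_nonneg_left (hexp _ (hα1 i)) (hM1 i).le) (hηR i)
        (norm_nonneg _) (by have := (hM1 i).le; positivity)
    have h3 : ‖η i T‖ ≤ Bη i := by rw [hBη]; simp only; linarith
    exact h3.trans (((le_abs_self _).trans (norm_le_pi_norm Bη i)).trans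
      ((le_max_left _ _).trans (le_max_left _ _)))
  · have h1 := hS2 i (χ i) (fun t => e t i • obsE (2 * l - 1)) 0 T (Be * ‖obsE (2 * l - 1)‖) hT
      (h.chi_cont i) (h.chi i) (fun t ht => by
        rw [norm_smul]; exact mul_le_mul_of_nonneg_right (het t ht i) (norm_nonneg _))
      (by positivity)
    have h2 : M2 i * Real.exp (-(α2 i * (T - 0))) * ‖χ i 0‖ ≤ M2 i * 1 * R := by
      rw [hχ]
      exact mul_le_mul (mul_le_mul_of_nonneg_left (hexp _ (hα2 i)) (hM2 i).le) (hχR i)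
        (norm_nonneg _) (by have := (hM2 i).le; positivity)
    have h3 : ‖χ i T‖ ≤ Bχ i := by rw [hBχ]; simp only; linarith
    exact h3.trans (((le_abs_self _).trans (norm_le_pi_norm Bχ i)).trans
      ((le_max_right _ _).trans (le_max_left _ _)))
  · exact (le_max_left _ _).trans (le_max_right _ _)
  · exact (le_max_left _ _).trans ((le_max_right _ _).trans (le_max_right _ _))
  · exact (le_max_right _ _).trans ((le_max_right _ _).trans (le_max_right _ _))

/-- The state of the observer: `(η̂, χ̂, θ̂, ŷ)`. -/
abbrev ObserverState (N l : ℕ) : Type :=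
  (Fin N → Fin (2 * l - 1) → ℝ) × (Fin N → Fin (2 * l - 1) → ℝ) × (Fin N → Fin l → ℝ) × (Fin N → ℝ)

/-- The right-hand side of the observer as a time-dependent vector field. -/
noncomputable def observerField {N l : ℕ} [NeZero l] (G : Digraph (Fin (N + 1)))
    (a : Fin N → Fin (2 * l - 1) → ℝ) (κ μ : ℝ) (y : ℝ → ℝ)
    (p : ℝ × ObserverState N l) : ObserverState N l :=
  (fun i => obsA (a i) *ᵥ p.2.1 i + p.2.2.2.2 i • obsB (a i),
    fun i => (obsA (a i))ᵀ *ᵥ p.2.2.1 i + p.2.2.2.2 i • obsE (2 * l - 1),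
    fun i => (κ * relativeOutput G (fun j => p.2.2.2.2 j) (y p.1) i) • (obsF l *ᵥ p.2.2.1 i),
    fun i => obsE (2 * l - 1) ⬝ᵥ p.2.1 i + a i 0 * p.2.2.2.2 i
      + p.2.2.1 i ⬝ᵥ ((obsF l)ᵀ *ᵥ p.2.2.2.1 i)
      + μ * relativeOutput G (fun j => p.2.2.2.2 j) (y p.1) i)

theorem contDiff_leaderSignal {l : ℕ} (φ ω ψ : Fin l → ℝ) :
    ContDiff ℝ 1 (leaderSignal φ ω ψ) := by
  unfold leaderSignal
  fun_prop

theorem contDiff_observerField {N l : ℕ} [NeZero l] {G : Digraph (Fin (N + 1))}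
    (hG : IsLeaderFollowerNetwork G) (a : Fin N → Fin (2 * l - 1) → ℝ) (κ μ : ℝ) {y : ℝ → ℝ}
    (hy : ContDiff ℝ 1 y) : ContDiff ℝ 1 (observerField G a κ μ y) := by
  have hrel : ∀ i, ContDiff ℝ 1 fun p : ℝ × ObserverState N l =>
      relativeOutput G (fun j => p.2.2.2.2 j) (y p.1) i := by
    intro i
    simp only [relativeOutput_eq hG, Matrix.mulVec, dotProduct]
    fun_prop
  unfold observerField
  refine ContDiff.prodMk ?_ (ContDiff.prodMk ?_ (ContDiff.prodMk ?_ ?_))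
  · refine contDiff_pi.2 fun i => contDiff_pi.2 fun j => ?_
    simp only [Pi.add_apply, Pi.smul_apply, Matrix.mulVec, dotProduct]
    fun_prop
  · refine contDiff_pi.2 fun i => contDiff_pi.2 fun j => ?_
    simp only [Pi.add_apply, Pi.smul_apply, Matrix.mulVec, dotProduct]
    fun_prop
  · refine contDiff_pi.2 fun i => contDiff_pi.2 fun j => ?_
    have := hrel i
    simp only [Pi.smul_apply, Matrix.mulVec, dotProduct]
    fun_prop
  · refine contDiff_pi.2 fun i => ?_
    have := hrel i
    simp only [Matrix.mulVec, dotProduct]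
    fun_prop

theorem HasDerivWithinAt.prod_comp {E F : Type*} [NormedAddCommGroup E] [NormedSpace ℝ E]
    [NormedAddCommGroup F] [NormedSpace ℝ F] {x : ℝ → E × F} {x' : E × F} {s : Set ℝ} {t : ℝ}
    (h : HasDerivWithinAt x x' s t) :
    HasDerivWithinAt (fun t => (x t).1) x'.1 s t ∧ HasDerivWithinAt (fun t => (x t).2) x'.2 s t :=
  ⟨(ContinuousLinearMap.fst ℝ E F).hasFDerivAt.comp_hasDerivWithinAt t h,
    (ContinuousLinearMap.snd ℝ E F).hasFDerivAt.comp_hasDerivWithinAt t h⟩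

open Set in
theorem exists_isObserverTrajectory {N l : ℕ} [NeZero N] [NeZero l]
    {G : Digraph (Fin (N + 1))} (hG : IsLeaderFollowerNetwork G)
    {a : Fin N → Fin (2 * l - 1) → ℝ} (ha : ∀ i, IsHurwitzCoeffs (a i))
    {κ μ ωbar : ℝ} (hκ : 0 < κ) (hμ : gainBound G ωbar a < μ) {θ : Fin l → ℝ}
    (hθ : θ ⬝ᵥ θ ≤ thetaBound l ωbar) {y : ℝ → ℝ} (hy : ContDiff ℝ 1 y)
    {ηs χs : Fin N → ℝ → Fin (2 * l - 1) → ℝ} (hs : ∀ i, IsSteadyState (a i) θ y (ηs i) (χs i))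
    (ηh₀ χh₀ : Fin N → Fin (2 * l - 1) → ℝ) (θh₀ : Fin N → Fin l → ℝ) (yh₀ : Fin N → ℝ) :
    ∃ (ηh χh : Fin N → ℝ → Fin (2 * l - 1) → ℝ) (θh : Fin N → ℝ → Fin l → ℝ)
        (yh : Fin N → ℝ → ℝ), IsObserverTrajectory G a κ μ y ηh χh θh yh ∧
        ∀ i, ηh i 0 = ηh₀ i ∧ χh i 0 = χh₀ i ∧ θh i 0 = θh₀ i ∧ yh i 0 = yh₀ i := by
  obtain ⟨B, hB⟩ := exists_error_bound hG ha hκ hμ hθ χs (fun i => ηh₀ i - ηs i 0)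
    (fun i => χh₀ i - χs i 0) (fun i => θh₀ i - θ) (fun i => yh₀ i - y 0)
  choose C hC using fun i => (hs i).bounded
  have hC0 : ∀ i, 0 ≤ C i := fun i => (norm_nonneg _).trans (hC i 0).1
  have hCle : ∀ i, C i ≤ ‖C‖ := fun i => (le_abs_self _).trans (norm_le_pi_norm C i)
  set D := B + (‖C‖ + ‖θ‖) with hD
  obtain ⟨x, hx0, hx⟩ := exists_global_solution (contDiff_observerField hG a κ μ hy)
    (ηh₀, χh₀, θh₀, yh₀) D fun T x hT hx0 hxc hx => by
      have hobs : IsObserverOn G a κ μ y T (fun i t => (x t).1 i) (fun i t => (x t).2.1 i)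
          (fun i t => (x t).2.2.1 i) (fun i t => (x t).2.2.2 i) :=
        { eta_cont := fun i => continuousOn_pi.1 hxc.fst i
          chi_cont := fun i => continuousOn_pi.1 hxc.snd.fst i
          theta_cont := fun i => continuousOn_pi.1 hxc.snd.snd.fst i
          out_cont := fun i => continuousOn_pi.1 hxc.snd.snd.snd i
          eta := fun i t ht => hasDerivWithinAt_pi.1 (hx t ht).prod_comp.1 i
          chi := fun i t ht => hasDerivWithinAt_pi.1 (hx t ht).prod_comp.2.prod_comp.1 i
          theta := fun i t ht =>
            hasDerivWithinAt_pi.1 (hx t ht).prod_comp.2.prod_comp.2.prod_comp.1 i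
          out := fun i t ht =>
            hasDerivWithinAt_pi.1 (hx t ht).prod_comp.2.prod_comp.2.prod_comp.2 i }
      obtain ⟨b1, b2, b3, b4, -⟩ := hB T _ _ _ _ hT (hobs.isErrorTrajectory hG hs)
        (fun i => by simp [hx0]) (fun i => by simp [hx0]) (fun i => by simp [hx0])
        (by simp [hx0])
      have hB0 : 0 ≤ B := (norm_nonneg _).trans b4
      have hD0 : 0 ≤ D := by positivity
      have hC0' := norm_nonneg C
      have hθ0 := norm_nonneg θ
      have key : ∀ {F : Type} [NormedAddCommGroup F] (u v : F) {c : ℝ}, ‖u - v‖ ≤ B → ‖v‖ ≤ c →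
          c ≤ ‖C‖ + ‖θ‖ → ‖u‖ ≤ D := fun u v c h1 h2 h3 => by
        have := norm_add_le (u - v) v
        rw [sub_add_cancel] at this
        linarith
      rw [Prod.norm_def, Prod.norm_def, Prod.norm_def]
      refine max_le ?_ (max_le ?_ (max_le ?_ ?_))
      · exact (pi_norm_le_iff_of_nonneg hD0).2 fun i => key _ _ (b1 i) (hC i T).1
          (by linarith [hCle i])
      · exact (pi_norm_le_iff_of_nonneg hD0).2 fun i => key _ _ (b2 i) (hC i T).2.1
          (by linarith [hCle i])
      · exact (pi_norm_le_iff_of_nonneg hD0).2 fun i => key _ _ (b3 i) le_rfl (by linarith)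
      · refine (pi_norm_le_iff_of_nonneg hD0).2 fun i => key _ _ ?_ (hC i T).2.2
          (by linarith [hCle i])
        exact (norm_le_pi_norm (fun i => (x T).2.2.2 i - y T) i).trans b4
  refine ⟨fun i t => (x t).1 i, fun i t => (x t).2.1 i, fun i t => (x t).2.2.1 i,
    fun i t => (x t).2.2.2 i, ⟨?_, ?_, ?_, ?_⟩, fun i => by simp [hx0]⟩
  · exact fun i t ht => hasDerivWithinAt_pi.1 (hx t ht).prod_comp.1 i
  · exact fun i t ht => hasDerivWithinAt_pi.1 (hx t ht).prod_comp.2.prod_comp.1 i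
  · exact fun i t ht => hasDerivWithinAt_pi.1 (hx t ht).prod_comp.2.prod_comp.2.prod_comp.1 i
  · exact fun i t ht => hasDerivWithinAt_pi.1 (hx t ht).prod_comp.2.prod_comp.2.prod_comp.2 i

/-! ### Bounded Lipschitz functions and Barbalat's lemma -/

theorem BoundedOnNonneg.add {E : Type*} [SeminormedAddCommGroup E] {f g : ℝ → E}
    (hf : BoundedOnNonneg f) (hg : BoundedOnNonneg g) : BoundedOnNonneg fun t => f t + g t := by
  obtain ⟨C, hC⟩ := hf
  obtain ⟨D, hD⟩ := hg
  exact ⟨C + D, fun t ht => (norm_add_le _ _).trans (add_le_add (hC t ht) (hD t ht))⟩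

theorem boundedOnNonneg_const {E : Type*} [Norm E] (c : E) : BoundedOnNonneg fun _ : ℝ => c :=
  ⟨‖c‖, fun _ _ => le_rfl⟩

theorem BoundedOnNonneg.mul {f g : ℝ → ℝ} (hf : BoundedOnNonneg f) (hg : BoundedOnNonneg g) :
    BoundedOnNonneg fun t => f t * g t := by
  obtain ⟨C, hC⟩ := hf
  obtain ⟨D, hD⟩ := hg
  exact ⟨C * D, fun t ht => (norm_mul_le _ _).trans
    (mul_le_mul (hC t ht) (hD t ht) (norm_nonneg _) ((norm_nonneg _).trans (hC t ht)))⟩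

theorem BoundedOnNonneg.sum {ι : Type*} {s : Finset ι} {f : ι → ℝ → ℝ}
    (h : ∀ i ∈ s, BoundedOnNonneg (f i)) : BoundedOnNonneg fun t => ∑ i ∈ s, f i t := by
  classical
  induction s using Finset.induction_on with
  | empty => simpa using boundedOnNonneg_const (0 : ℝ)
  | insert i s hi ih =>
    simp only [Finset.sum_insert hi]
    exact (h i (Finset.mem_insert_self _ _)).add
      (ih fun j hj => h j (Finset.mem_insert_of_mem hj))

theorem BoundedOnNonneg.apply {n : ℕ} {f : ℝ → Fin n → ℝ} (hf : BoundedOnNonneg f) (i : Fin n) :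
    BoundedOnNonneg fun t => f t i := by
  obtain ⟨C, hC⟩ := hf
  exact ⟨C, fun t ht => (norm_le_pi_norm (f t) i).trans (hC t ht)⟩

theorem BoundedOnNonneg.dotProduct {n : ℕ} {f g : ℝ → Fin n → ℝ} (hf : BoundedOnNonneg f)
    (hg : BoundedOnNonneg g) : BoundedOnNonneg fun t => f t ⬝ᵥ g t :=
  BoundedOnNonneg.sum fun i _ => (hf.apply i).mul (hg.apply i)

theorem BoundedOnNonneg.mulVec {m n : ℕ} (A : Matrix (Fin m) (Fin n) ℝ) {f : ℝ → Fin n → ℝ}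
    (hf : BoundedOnNonneg f) (i : Fin m) : BoundedOnNonneg fun t => (A *ᵥ f t) i :=
  (boundedOnNonneg_const (A i)).dotProduct hf

/-- `f` is bounded and Lipschitz on `[0, ∞)`. -/
def BoundedLipschitz (f : ℝ → ℝ) : Prop :=
  BoundedOnNonneg f ∧ ∃ C : ℝ, ∀ s t, 0 ≤ s → s ≤ t → |f t - f s| ≤ C * (t - s)

theorem boundedLipschitz_const (c : ℝ) : BoundedLipschitz fun _ : ℝ => c :=
  ⟨boundedOnNonneg_const c, 0, fun s t _ _ => by simp⟩

theorem BoundedLipschitz.add {f g : ℝ → ℝ} (hf : BoundedLipschitz f) (hg : BoundedLipschitz g) :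
    BoundedLipschitz fun t => f t + g t := by
  obtain ⟨hf0, C, hC⟩ := hf
  obtain ⟨hg0, D, hD⟩ := hg
  refine ⟨hf0.add hg0, C + D, fun s t hs hst => ?_⟩
  have h1 := abs_add_le (f t - f s) (g t - g s)
  have h2 := hC s t hs hst
  have h3 := hD s t hs hst
  have h4 : f t + g t - (f s + g s) = (f t - f s) + (g t - g s) := by ring
  rw [h4]
  linarith

theorem BoundedLipschitz.mul {f g : ℝ → ℝ} (hf : BoundedLipschitz f) (hg : BoundedLipschitz g) :
    BoundedLipschitz fun t => f t * g t := by
  obtain ⟨hf0, C, hC⟩ := hf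
  obtain ⟨hg0, D, hD⟩ := hg
  refine ⟨hf0.mul hg0, ?_⟩
  obtain ⟨P, hP⟩ := hf0
  obtain ⟨Q, hQ⟩ := hg0
  refine ⟨P * D + Q * C, fun s t hs hst => ?_⟩
  have ht := hs.trans hst
  have h1 : f t * g t - f s * g s = f t * (g t - g s) + g s * (f t - f s) := by ring
  have h2 : |f t * (g t - g s)| ≤ P * (D * (t - s)) := by
    rw [abs_mul]
    exact mul_le_mul (hP t ht) (hD s t hs hst) (abs_nonneg _) ((norm_nonneg _).trans (hP t ht))
  have h3 : |g s * (f t - f s)| ≤ Q * (C * (t - s)) := by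
    rw [abs_mul]
    exact mul_le_mul (hQ s hs) (hC s t hs hst) (abs_nonneg _) ((norm_nonneg _).trans (hQ s hs))
  rw [h1]
  have := abs_add_le (f t * (g t - g s)) (g s * (f t - f s))
  linarith

theorem BoundedLipschitz.sum {ι : Type*} {s : Finset ι} {f : ι → ℝ → ℝ}
    (h : ∀ i ∈ s, BoundedLipschitz (f i)) : BoundedLipschitz fun t => ∑ i ∈ s, f i t := by
  classical
  induction s using Finset.induction_on with
  | empty => simpa using boundedLipschitz_const 0
  | insert i s hi ih =>
    simp only [Finset.sum_insert hi]
    exact (h i (Finset.mem_insert_self _ _)).add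
      (ih fun j hj => h j (Finset.mem_insert_of_mem hj))

theorem BoundedLipschitz.dotProduct {n : ℕ} {f g : ℝ → Fin n → ℝ}
    (hf : ∀ i, BoundedLipschitz fun t => f t i) (hg : ∀ i, BoundedLipschitz fun t => g t i) :
    BoundedLipschitz fun t => f t ⬝ᵥ g t :=
  BoundedLipschitz.sum fun i _ => (hf i).mul (hg i)

theorem BoundedLipschitz.mulVec {m n : ℕ} (A : Matrix (Fin m) (Fin n) ℝ) {f : ℝ → Fin n → ℝ}
    (hf : ∀ i, BoundedLipschitz fun t => f t i) (i : Fin m) :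
    BoundedLipschitz fun t => (A *ᵥ f t) i :=
  BoundedLipschitz.dotProduct (fun j => boundedLipschitz_const (A i j)) hf

open Set in
theorem BoundedOnNonneg.boundedLipschitz {f f' : ℝ → ℝ} (hf : BoundedOnNonneg f)
    (hfc : ContinuousOn f (Ici 0)) (hf' : ∀ t, 0 ≤ t → HasDerivWithinAt f (f' t) (Ici t) t)
    (hb : BoundedOnNonneg f') : BoundedLipschitz f := by
  obtain ⟨C, hC⟩ := hb
  refine ⟨hf, C, fun s t hs hst => ?_⟩
  exact norm_image_sub_le_of_norm_deriv_right_le_segment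
    (hfc.mono fun r hr => hs.trans hr.1) (fun r hr => hf' r (hs.trans hr.1))
    (fun r hr => hC r (hs.trans hr.1)) t ⟨hst, le_rfl⟩

open Set Filter Topology in
/-- **Barbalat's lemma**: if `F` converges and its derivative is Lipschitz, the derivative tends to
zero. -/
theorem BoundedLipschitz.tendsto_zero {F f : ℝ → ℝ} (hf : BoundedLipschitz f)
    (hFc : ContinuousOn F (Ici 0)) (hF : ∀ t, 0 ≤ t → HasDerivWithinAt F (f t) (Ici t) t) {c : ℝ}
    (hlim : Tendsto F atTop (𝓝 c)) : Tendsto f atTop (𝓝 0) := by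
  obtain ⟨-, C, hC⟩ := hf
  have hC0 : 0 ≤ C := by
    have := (abs_nonneg _).trans (hC 0 1 le_rfl zero_le_one)
    linarith
  have key : ∀ t h, 0 ≤ t → 0 ≤ h → |F (t + h) - F t - h * f t| ≤ C * h * h := by
    intro t h ht hh
    have h1 := norm_image_sub_le_of_norm_deriv_right_le_segment
      (f := fun s => F s - s * f t) (f' := fun s => f s - f t) (a := t) (b := t + h) (C := C * h)
      ((hFc.mono fun r hr => ht.trans hr.1).sub (by fun_prop))
      (fun r hr => by
        have h2 : HasDerivWithinAt (fun s => s * f t) (f t) (Ici r) r := by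
          simpa using ((hasDerivAt_id r).mul_const (f t)).hasDerivWithinAt
        exact (hF r (ht.trans hr.1)).sub h2)
      (fun r hr => (hC t r ht hr.1).trans
        (mul_le_mul_of_nonneg_left (by linarith [hr.2]) hC0))
      (t + h) ⟨by linarith, le_rfl⟩
    rw [Real.norm_eq_abs] at h1
    have h3 : F (t + h) - F t - h * f t = F (t + h) - (t + h) * f t - (F t - t * f t) := by ring
    rw [h3]
    simpa using h1
  rw [Metric.tendsto_nhds]
  intro ε hε
  -- over steps of this length `F` is affine up to an error of `h ε / 2`
  set h := ε / (2 * (C + 1)) with hh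
  have hh0 : 0 < h := by positivity
  have hCh : C * h ≤ ε / 2 := by
    have : (C + 1) * h = ε / 2 := by rw [hh]; field_simp
    nlinarith
  have hdiff : Tendsto (fun t => F (t + h) - F t) atTop (𝓝 0) := by
    have := (hlim.comp (tendsto_atTop_add_const_right atTop h tendsto_id)).sub hlim
    rw [sub_self] at this
    exact this
  have hev := (Metric.tendsto_nhds.1 hdiff) (h * (ε / 2)) (by positivity)
  filter_upwards [hev, eventually_ge_atTop 0] with t ht ht0
  rw [Real.dist_eq, sub_zero] at ht ⊢
  have h1 := key t h ht0 hh0.le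
  have h2 : h * |f t| ≤ |F (t + h) - F t - h * f t| + |F (t + h) - F t| := by
    have h3 := abs_sub (F (t + h) - F t) (F (t + h) - F t - h * f t)
    rw [sub_sub_cancel, abs_mul, abs_of_pos hh0] at h3
    linarith
  have h4 : h * |f t| < h * ε := by
    calc h * |f t| < C * h * h + h * (ε / 2) := by linarith
      _ ≤ ε / 2 * h + h * (ε / 2) := by gcongr
      _ = h * ε := by ring
  exact lt_of_mul_lt_mul_left h4 hh0.le

open Set Filter Topology MeasureTheory in
/-- A nonnegative Lipschitz function with bounded integrals tends to zero. -/
theorem BoundedLipschitz.tendsto_zero_of_integral_le {f : ℝ → ℝ} (hf : BoundedLipschitz f)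
    (hfc : ContinuousOn f (Ici 0)) (hf0 : ∀ t, 0 ≤ f t) {B : ℝ}
    (hB : ∀ T, 0 ≤ T → ∫ t in 0..T, f t ≤ B) : Tendsto f atTop (𝓝 0) := by
  have hint : ∀ s t, 0 ≤ s → s ≤ t → IntervalIntegrable f volume s t := fun s t hs hst =>
    ContinuousOn.intervalIntegrable (hfc.mono (by
      rw [uIcc_of_le hst]; exact fun r hr => hs.trans hr.1))
  have hder : ∀ t, 0 ≤ t → HasDerivWithinAt (fun T => ∫ s in 0..T, f s) (f t) (Ici t) t := by
    intro t ht
    refine intervalIntegral.integral_hasDerivWithinAt_right (hint 0 t le_rfl ht) ?_ ?_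
      (t := Ioi t)
    · refine ⟨Ioi t, self_mem_nhdsWithin, ?_⟩
      exact (hfc.mono fun r hr => ht.trans (le_of_lt hr)).aestronglyMeasurable measurableSet_Ioi
    · exact (hfc t ht).mono fun r hr => ht.trans (le_of_lt hr)
  have hcont : ContinuousOn (fun T => ∫ s in 0..T, f s) (Ici 0) := by
    intro t ht
    have h1 := intervalIntegral.continuousOn_primitive_interval'
      (hint 0 (t + 1) le_rfl (by linarith [mem_Ici.1 ht])) (left_mem_uIcc)
    rw [uIcc_of_le (by linarith [mem_Ici.1 ht])] at h1
    refine (h1 t ⟨ht, by linarith⟩).mono_of_mem_nhdsWithin ?_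
    rw [← Ici_inter_Iic]
    exact inter_mem self_mem_nhdsWithin (mem_nhdsWithin_of_mem_nhds (Iic_mem_nhds (by linarith)))
  -- the cut-off at `0` makes the primitive monotone on all of `ℝ`
  have hmono : Monotone fun T : ℝ => ∫ s in 0..max T 0, f s := by
    intro S T hST
    exact intervalIntegral.integral_mono_interval le_rfl (le_max_right _ _)
      (max_le_max hST le_rfl) (Eventually.of_forall hf0) (hint _ _ le_rfl (le_max_right _ _))
  have hbdd : BddAbove (range fun T : ℝ => ∫ s in 0..max T 0, f s) := by
    refine ⟨B, ?_⟩
    rintro _ ⟨T, rfl⟩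
    exact hB _ (le_max_right _ _)
  refine hf.tendsto_zero hcont hder ((tendsto_atTop_ciSup hmono hbdd).congr' ?_)
  filter_upwards [eventually_ge_atTop 0] with T hT
  rw [max_eq_left hT]

open Set Filter Topology in
/-- A stable linear system maps vanishing inputs to vanishing states. -/
theorem IsStableMatrix.tendsto_zero {n : ℕ} {A : Matrix (Fin n) (Fin n) ℝ} (hA : IsStableMatrix A)
    {x r : ℝ → Fin n → ℝ} (hxc : ContinuousOn x (Ici 0))
    (hx : ∀ t, 0 ≤ t → HasDerivWithinAt x (A *ᵥ x t + r t) (Ici t) t)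
    (hr : Tendsto r atTop (𝓝 0)) : Tendsto x atTop (𝓝 0) := by
  obtain ⟨M, α, hM, hα, h⟩ := hA.exists_norm_le
  rw [Metric.tendsto_nhds]
  intro ε hε
  set U := ε * α / (2 * M) with hU
  have hU0 : 0 < U := by positivity
  obtain ⟨τ, hτ⟩ := eventually_atTop.1 ((Metric.tendsto_nhds.1 hr) U hU0)
  set σ := max τ 0 with hσ
  have htend : Tendsto (fun t : ℝ => M * Real.exp (-(α * (t - σ))) * ‖x σ‖) atTop (𝓝 0) := by
    have h1 : Tendsto (fun t : ℝ => -(α * (t - σ))) atTop atBot :=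
      tendsto_neg_atTop_atBot.comp
        ((tendsto_atTop_add_const_right atTop (-σ) tendsto_id).const_mul_atTop hα)
    simpa using ((Real.tendsto_exp_atBot.comp h1).const_mul M).mul_const ‖x σ‖
  filter_upwards [htend.eventually_lt_const (half_pos hε), eventually_ge_atTop σ] with t ht htσ
  have hσ0 : 0 ≤ σ := le_max_right _ _
  have h1 := h x r σ t U htσ (hxc.mono fun s hs => hσ0.trans hs.1)
    (fun s hs => hx s (hσ0.trans hs.1))
    (fun s hs => by
      have := hτ s ((le_max_left _ _).trans hs.1)
      rw [dist_zero_right] at this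
      exact this.le) hU0.le
  have h2 : M * U / α = ε / 2 := by rw [hU]; field_simp
  rw [dist_zero_right]
  linarith

/-! ### Convergence -/

open Set in
theorem IsObserverTrajectory.isObserverOn {N l : ℕ} [NeZero l] {G : Digraph (Fin (N + 1))}
    {a : Fin N → Fin (2 * l - 1) → ℝ} {κ μ : ℝ} {y : ℝ → ℝ}
    {ηh χh : Fin N → ℝ → Fin (2 * l - 1) → ℝ} {θh : Fin N → ℝ → Fin l → ℝ}
    {yh : Fin N → ℝ → ℝ} (h : IsObserverTrajectory G a κ μ y ηh χh θh yh) (T : ℝ) :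
    IsObserverOn G a κ μ y T ηh χh θh yh where
  eta_cont i t ht := (h.eta i t ht.1).continuousWithinAt.mono Icc_subset_Ici_self
  chi_cont i t ht := (h.chi i t ht.1).continuousWithinAt.mono Icc_subset_Ici_self
  theta_cont i t ht := (h.theta i t ht.1).continuousWithinAt.mono Icc_subset_Ici_self
  out_cont i t ht := (h.out i t ht.1).continuousWithinAt.mono Icc_subset_Ici_self
  eta i t ht := (h.eta i t ht.1).mono (Ici_subset_Ici.2 ht.1)
  chi i t ht := (h.chi i t ht.1).mono (Ici_subset_Ici.2 ht.1)
  theta i t ht := (h.theta i t ht.1).mono (Ici_subset_Ici.2 ht.1)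
  out i t ht := (h.out i t ht.1).mono (Ici_subset_Ici.2 ht.1)

open Set in
theorem continuousOn_Ici_of_forall_Icc {E : Type*} [TopologicalSpace E] {f : ℝ → E}
    (h : ∀ T, ContinuousOn f (Icc 0 T)) : ContinuousOn f (Ici 0) := by
  intro t ht
  refine (h (t + 1) t ⟨ht, by linarith⟩).mono_of_mem_nhdsWithin ?_
  rw [← Ici_inter_Iic]
  exact Filter.inter_mem self_mem_nhdsWithin
    (mem_nhdsWithin_of_mem_nhds (Iic_mem_nhds (by linarith)))

open Set Filter Topology in
/-- Boundedness and convergence of the error system: the outputs converge by Barbalat's lemma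
applied to `∫ |e|²`, the filters follow, and Barbalat's lemma applied to `e_i` gives the
convergence of `e_i'`, hence of its only remaining term. -/
theorem IsErrorTrajectory.convergence {N l : ℕ} [NeZero N] [NeZero l]
    {G : Digraph (Fin (N + 1))} (hG : IsLeaderFollowerNetwork G)
    {a : Fin N → Fin (2 * l - 1) → ℝ} (ha : ∀ i, IsHurwitzCoeffs (a i))
    {κ μ ωbar : ℝ} (hκ : 0 < κ) (hμ : gainBound G ωbar a < μ) {θ : Fin l → ℝ}
    (hθ : θ ⬝ᵥ θ ≤ thetaBound l ωbar) {χs : Fin N → ℝ → Fin (2 * l - 1) → ℝ}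
    (hχs : ∀ i j, BoundedLipschitz fun t => χs i t j)
    {η χ : Fin N → ℝ → Fin (2 * l - 1) → ℝ} {ϑ : Fin N → ℝ → Fin l → ℝ} {e : ℝ → Fin N → ℝ}
    (h : ∀ T, IsErrorTrajectory (followerMatrix G) a κ μ θ χs T η χ ϑ e) :
    BoundedOnNonneg e ∧ (∀ i, BoundedOnNonneg (η i)) ∧ (∀ i, BoundedOnNonneg (χ i)) ∧
      (∀ i, BoundedOnNonneg (ϑ i)) ∧ Tendsto e atTop (𝓝 0) ∧ (∀ i, Tendsto (η i) atTop (𝓝 0)) ∧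
      (∀ i, Tendsto (χ i) atTop (𝓝 0)) ∧
      ∀ i, Tendsto (fun t => (obsF l *ᵥ (χ i t + χs i t)) ⬝ᵥ ϑ i t) atTop (𝓝 0) := by
  obtain ⟨B, hB⟩ := exists_error_bound hG ha hκ hμ hθ χs (fun i => η i 0) (fun i => χ i 0)
    (fun i => ϑ i 0) (e 0)
  have hB' := fun T hT => hB T η χ ϑ e hT (h T) (fun _ => rfl) (fun _ => rfl) (fun _ => rfl) rfl
  have hηb : ∀ i, BoundedOnNonneg (η i) := fun i => ⟨B, fun t ht => (hB' t ht).1 i⟩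
  have hχb : ∀ i, BoundedOnNonneg (χ i) := fun i => ⟨B, fun t ht => (hB' t ht).2.1 i⟩
  have hϑb : ∀ i, BoundedOnNonneg (ϑ i) := fun i => ⟨B, fun t ht => (hB' t ht).2.2.1 i⟩
  have heb : BoundedOnNonneg e := ⟨B, fun t ht => (hB' t ht).2.2.2.1⟩
  have hηc := fun i => continuousOn_Ici_of_forall_Icc fun T => (h T).eta_cont i
  have hχc := fun i => continuousOn_Ici_of_forall_Icc fun T => (h T).chi_cont i
  have hϑc := fun i => continuousOn_Ici_of_forall_Icc fun T => (h T).theta_cont i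
  have hec := continuousOn_Ici_of_forall_Icc fun T => (h T).err_cont
  have hmem : ∀ {t : ℝ}, 0 ≤ t → t ∈ Ico 0 (t + 1) := fun ht => ⟨ht, by linarith⟩
  have hη' := fun i t (ht : 0 ≤ t) => (h (t + 1)).eta i t (hmem ht)
  have hχ' := fun i t (ht : 0 ≤ t) => (h (t + 1)).chi i t (hmem ht)
  have hϑ' := fun i t (ht : 0 ≤ t) => (h (t + 1)).theta i t (hmem ht)
  have he' := fun i t (ht : 0 ≤ t) => (h (t + 1)).err i t (hmem ht)
  have hub : ∀ i, BoundedOnNonneg fun t => χ i t + χs i t := by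
    intro i
    refine (hχb i).add ?_
    choose C hC using fun j => (hχs i j).1
    refine ⟨‖C‖, fun t ht => (pi_norm_le_iff_of_nonneg (norm_nonneg _)).2 fun j => ?_⟩
    exact (hC j t ht).trans ((le_abs_self _).trans (norm_le_pi_norm C j))
  have hFub : ∀ i, BoundedOnNonneg fun t => (obsF l *ᵥ (χ i t + χs i t)) ⬝ᵥ ϑ i t := fun i =>
    BoundedOnNonneg.sum fun k _ => ((hub i).mulVec (obsF l) k).mul ((hϑb i).apply k)
  -- every component is bounded with a bounded derivative
  have hηL : ∀ i j, BoundedLipschitz fun t => η i t j := fun i j =>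
    ((hηb i).apply j).boundedLipschitz (continuousOn_pi.1 (hηc i) j)
      (fun t ht => hasDerivWithinAt_pi.1 (hη' i t ht) j)
      (((hηb i).mulVec _ j).add ((heb.apply i).mul (boundedOnNonneg_const _)))
  have hχL : ∀ i j, BoundedLipschitz fun t => χ i t j := fun i j =>
    ((hχb i).apply j).boundedLipschitz (continuousOn_pi.1 (hχc i) j)
      (fun t ht => hasDerivWithinAt_pi.1 (hχ' i t ht) j)
      (((hχb i).mulVec _ j).add ((heb.apply i).mul (boundedOnNonneg_const _)))
  have hϑL : ∀ i j, BoundedLipschitz fun t => ϑ i t j := fun i j =>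
    ((hϑb i).apply j).boundedLipschitz (continuousOn_pi.1 (hϑc i) j)
      (fun t ht => hasDerivWithinAt_pi.1 (hϑ' i t ht) j)
      ((by simpa using ((boundedOnNonneg_const (-κ)).mul (heb.mulVec (followerMatrix G) i)) :
        BoundedOnNonneg fun t => -(κ * (followerMatrix G *ᵥ e t) i)).mul
          ((hub i).mulVec (obsF l) j))
  have hFχb : ∀ i, BoundedOnNonneg fun t => (obsF l *ᵥ χ i t) ⬝ᵥ θ := fun i =>
    BoundedOnNonneg.sum fun k _ => ((hχb i).mulVec (obsF l) k).mul (boundedOnNonneg_const _)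
  have hEηb : ∀ i, BoundedOnNonneg fun t => obsE (2 * l - 1) ⬝ᵥ η i t := fun i =>
    (boundedOnNonneg_const _).dotProduct (hηb i)
  have heL : ∀ i, BoundedLipschitz fun t => e t i := fun i =>
    (heb.apply i).boundedLipschitz (continuousOn_pi.1 hec i) (fun t ht => he' i t ht)
      (by
        have := ((((hEηb i).add ((boundedOnNonneg_const (a i 0)).mul (heb.apply i))).add
          (hFχb i)).add ((boundedOnNonneg_const (-μ)).mul (heb.mulVec (followerMatrix G) i))).add
          (hFub i)
        simpa [sub_eq_add_neg] using this)
  have hgL : ∀ i, BoundedLipschitz fun t => obsE (2 * l - 1) ⬝ᵥ η i t + a i 0 * e t i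
      + (obsF l *ᵥ χ i t) ⬝ᵥ θ - μ * (followerMatrix G *ᵥ e t) i
      + (obsF l *ᵥ (χ i t + χs i t)) ⬝ᵥ ϑ i t := fun i => by
    have := ((((BoundedLipschitz.dotProduct (f := fun _ => obsE (2 * l - 1))
        (fun j => boundedLipschitz_const _) (hηL i)).add
      ((boundedLipschitz_const (a i 0)).mul (heL i))).add
      (BoundedLipschitz.dotProduct (g := fun _ => θ) (BoundedLipschitz.mulVec (obsF l) (hχL i))
        (fun j => boundedLipschitz_const _))).add
      ((boundedLipschitz_const (-μ)).mul (BoundedLipschitz.mulVec (followerMatrix G) heL i))).add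
      (BoundedLipschitz.dotProduct
        (BoundedLipschitz.mulVec (obsF l) fun j => (hχL i j).add (hχs i j)) (hϑL i))
    simp only [neg_mul, ← sub_eq_add_neg] at this
    exact this
  have hee : Tendsto (fun t => e t ⬝ᵥ e t) atTop (𝓝 0) :=
    (BoundedLipschitz.dotProduct heL heL).tendsto_zero_of_integral_le
      (hec.dotProduct_vec hec) (fun t => dotProduct_self_nonneg_real _)
      fun T hT => (hB' T hT).2.2.2.2
  have he0i : ∀ i, Tendsto (fun t => e t i) atTop (𝓝 0) := by
    intro i
    have h1 : Tendsto (fun t => e t i ^ 2) atTop (𝓝 0) := by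
      refine squeeze_zero (fun t => sq_nonneg _) (fun t => ?_) hee
      rw [sq]
      exact Finset.single_le_sum (f := fun i => e t i * e t i) (fun i _ => mul_self_nonneg _)
        (Finset.mem_univ i)
    have h2 := h1.sqrt
    simp only [Real.sqrt_sq_eq_abs, Real.sqrt_zero] at h2
    exact (tendsto_zero_iff_abs_tendsto_zero _).2 h2
  have he0 : Tendsto e atTop (𝓝 0) := tendsto_pi_nhds.2 he0i
  have hη0 : ∀ i, Tendsto (η i) atTop (𝓝 0) := fun i =>
    (ha i).isStableMatrix.tendsto_zero (hηc i) (hη' i)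
      (by simpa using (he0i i).smul_const (obsB (a i)))
  have hχ0 : ∀ i, Tendsto (χ i) atTop (𝓝 0) := fun i =>
    (ha i).isStableMatrix.transpose.tendsto_zero (hχc i) (hχ' i)
      (by simpa using (he0i i).smul_const (obsE (2 * l - 1)))
  refine ⟨heb, hηb, hχb, hϑb, he0, hη0, hχ0, fun i => ?_⟩
  have hg0 := (hgL i).tendsto_zero (continuousOn_pi.1 hec i) (he' i) (he0i i)
  have hcm : ∀ {m n : ℕ} (A : Matrix (Fin m) (Fin n) ℝ) {x : ℝ → Fin n → ℝ},
      Tendsto x atTop (𝓝 0) → Tendsto (fun t => A *ᵥ x t) atTop (𝓝 0) := by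
    intro m n A x hx
    have h1 : Continuous fun v : Fin n → ℝ => A *ᵥ v := by fun_prop
    have := (h1.tendsto 0).comp hx
    rwa [Matrix.mulVec_zero] at this
  have h1 : Tendsto (fun t => obsE (2 * l - 1) ⬝ᵥ η i t) atTop (𝓝 0) := by
    simp only [obsE_dotProduct]
    exact tendsto_pi_nhds.1 (hη0 i) 0
  have h2 : Tendsto (fun t => (obsF l *ᵥ χ i t) ⬝ᵥ θ) atTop (𝓝 0) := by
    have := tendsto_finsetSum Finset.univ fun k (_ : k ∈ Finset.univ) =>
      (tendsto_pi_nhds.1 (hcm (obsF l) (hχ0 i)) k).mul_const (θ k)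
    simpa [dotProduct] using this
  have h3 := tendsto_pi_nhds.1 (hcm (followerMatrix G) he0) i
  have h4 := hg0.sub (((h1.add ((he0i i).const_mul (a i 0))).add h2).sub (h3.const_mul μ))
  simpa using h4

theorem IsSteadyState.boundedLipschitz_chi {l : ℕ} [NeZero l] {a : Fin (2 * l - 1) → ℝ}
    {θ : Fin l → ℝ} {y : ℝ → ℝ} {η χ : ℝ → Fin (2 * l - 1) → ℝ} (h : IsSteadyState a θ y η χ)
    (j : Fin (2 * l - 1)) : BoundedLipschitz fun t => χ t j := by
  obtain ⟨C, hC⟩ := h.bounded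
  have hχ : BoundedOnNonneg χ := ⟨C, fun t _ => (hC t).2.1⟩
  have hy : BoundedOnNonneg y := ⟨C, fun t _ => (hC t).2.2⟩
  exact (hχ.apply j).boundedLipschitz
    (fun t _ => (hasDerivAt_pi.1 (h.chi t) j).continuousAt.continuousWithinAt)
    (fun t _ => (hasDerivAt_pi.1 (h.chi t) j).hasDerivWithinAt)
    ((hχ.mulVec _ j).add (hy.mul (boundedOnNonneg_const _)))

open Set Filter Topology in
/-- Two trajectories of a stable system with the same input converge to each other. -/
theorem IsStableMatrix.tendsto_sub_zero {n : ℕ} {A : Matrix (Fin n) (Fin n) ℝ}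
    (hA : IsStableMatrix A) {x z r : ℝ → Fin n → ℝ}
    (hx : ∀ t, 0 ≤ t → HasDerivWithinAt x (A *ᵥ x t + r t) (Ici 0) t)
    (hz : ∀ t, HasDerivAt z (A *ᵥ z t + r t) t) :
    Tendsto (fun t => x t - z t) atTop (𝓝 0) := by
  have hd : ∀ t, 0 ≤ t → HasDerivWithinAt (fun t => x t - z t) (A *ᵥ (x t - z t) + 0) (Ici 0) t :=
    fun t ht => by
      refine ((hx t ht).sub (hz t).hasDerivWithinAt).congr_deriv ?_
      rw [Matrix.mulVec_sub]; abel
  exact hA.tendsto_zero (r := fun _ => 0) (fun t ht => (hd t ht).continuousWithinAt)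
    (fun t ht => (hd t ht).mono (Ici_subset_Ici.2 ht)) tendsto_const_nhds

open Set Filter Topology in
theorem boundedOnNonneg_of_tendsto {n : ℕ} {f : ℝ → Fin n → ℝ} (hf : ContinuousOn f (Ici 0))
    (h : Tendsto f atTop (𝓝 0)) : BoundedOnNonneg f := by
  obtain ⟨T, hT⟩ := eventually_atTop.1 ((Metric.tendsto_nhds.1 h) 1 one_pos)
  obtain ⟨C, hC⟩ := (isCompact_Icc (a := (0 : ℝ)) (b := T)).exists_bound_of_continuousOn
    (hf.mono Icc_subset_Ici_self)
  refine ⟨max C 1, fun t ht => ?_⟩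
  rcases le_total t T with htT | htT
  · exact (hC t ⟨ht, htT⟩).trans (le_max_left _ _)
  · have := hT t htT
    rw [dist_zero_right] at this
    exact this.le.trans (le_max_right _ _)

theorem lemma1 {N l : ℕ} [NeZero N] [NeZero l]
    (G : Digraph (Fin (N + 1))) (hG : IsLeaderFollowerNetwork G)
    (φ ω ψ : Fin l → ℝ) (ωbar : ℝ) (hω : ∀ k, 0 < ω k ∧ ω k < ωbar)
    (a : Fin N → Fin (2 * l - 1) → ℝ) (ha : ∀ i, IsHurwitzCoeffs (a i))
    (κ μ : ℝ) (hκ : 0 < κ) (hμ : gainBound G ωbar a < μ)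
    (η χ : Fin N → ℝ → Fin (2 * l - 1) → ℝ)
    (hηχ : ∀ i, IsFilterTrajectory (a i) (leaderSignal φ ω ψ) (η i) (χ i))
    (ηh₀ χh₀ : Fin N → Fin (2 * l - 1) → ℝ) (θh₀ : Fin N → Fin l → ℝ) (yh₀ : Fin N → ℝ) :
    (∃ (ηh χh : Fin N → ℝ → Fin (2 * l - 1) → ℝ) (θh : Fin N → ℝ → Fin l → ℝ)
        (yh : Fin N → ℝ → ℝ),
      IsObserverTrajectory G a κ μ (leaderSignal φ ω ψ) ηh χh θh yh ∧
        ∀ i, ηh i 0 = ηh₀ i ∧ χh i 0 = χh₀ i ∧ θh i 0 = θh₀ i ∧ yh i 0 = yh₀ i) ∧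
    (∀ (ηh χh : Fin N → ℝ → Fin (2 * l - 1) → ℝ) (θh : Fin N → ℝ → Fin l → ℝ)
        (yh : Fin N → ℝ → ℝ),
      IsObserverTrajectory G a κ μ (leaderSignal φ ω ψ) ηh χh θh yh →
      (∀ i, ηh i 0 = ηh₀ i ∧ χh i 0 = χh₀ i ∧ θh i 0 = θh₀ i ∧ yh i 0 = yh₀ i) →
      ∀ i,
        BoundedOnNonneg (yh i) ∧
        BoundedOnNonneg (ηh i) ∧
        BoundedOnNonneg (fun t => ηh i t - η i t) ∧
        BoundedOnNonneg (χh i) ∧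
        BoundedOnNonneg (θh i) ∧
        Filter.Tendsto (fun t => ηh i t - η i t) Filter.atTop (nhds 0) ∧
        Filter.Tendsto (fun t => χh i t - χ i t) Filter.atTop (nhds 0) ∧
        Filter.Tendsto (fun t => yh i t - leaderSignal φ ω ψ t) Filter.atTop (nhds 0) ∧
        Filter.Tendsto
          (fun t => χh i t ⬝ᵥ ((obsF l)ᵀ *ᵥ (θh i t - leaderTheta ω)))
          Filter.atTop (nhds 0)) := by
  have hθ : leaderTheta ω ⬝ᵥ leaderTheta ω ≤ thetaBound l ωbar := by
    simpa only [dotProduct, sq] using sum_leaderTheta_sq_le hω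
  choose ηs χs hs using fun i => exists_isSteadyState φ ω ψ (ha i)
  refine ⟨exists_isObserverTrajectory hG ha hκ hμ hθ (contDiff_leaderSignal φ ω ψ) hs
    ηh₀ χh₀ θh₀ yh₀, fun ηh χh θh yh hobs _ i => ?_⟩
  obtain ⟨heb, hηb, hχb, hϑb, he0, hη0, hχ0, hlast⟩ :=
    IsErrorTrajectory.convergence hG ha hκ hμ hθ (fun i j => (hs i).boundedLipschitz_chi j)
      fun T => (hobs.isObserverOn T).isErrorTrajectory hG hs
  obtain ⟨C, hC⟩ := (hs i).bounded
  have hηs : BoundedOnNonneg (ηs i) := ⟨C, fun t _ => (hC t).1⟩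
  have hχs : BoundedOnNonneg (χs i) := ⟨C, fun t _ => (hC t).2.1⟩
  have hys : BoundedOnNonneg (leaderSignal φ ω ψ) := ⟨C, fun t _ => (hC t).2.2⟩
  -- the given filter trajectories forget their initial values
  have hη : Filter.Tendsto (fun t => η i t - ηs i t) Filter.atTop (nhds 0) :=
    (ha i).isStableMatrix.tendsto_sub_zero (hηχ i).eta (hs i).eta
  have hχ : Filter.Tendsto (fun t => χ i t - χs i t) Filter.atTop (nhds 0) :=
    (ha i).isStableMatrix.transpose.tendsto_sub_zero (hηχ i).chi (hs i).chi
  have hη' : Filter.Tendsto (fun t => ηh i t - η i t) Filter.atTop (nhds 0) := by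
    simpa using (hη0 i).sub hη
  have hχ' : Filter.Tendsto (fun t => χh i t - χ i t) Filter.atTop (nhds 0) := by
    simpa using (hχ0 i).sub hχ
  refine ⟨?_, ?_, ?_, ?_, ?_, hη', hχ', tendsto_pi_nhds.1 he0 i, ?_⟩
  · simpa using (heb.apply i).add hys
  · simpa using (hηb i).add hηs
  · exact boundedOnNonneg_of_tendsto (fun t ht =>
      ((hobs.eta i t ht).sub ((hηχ i).eta t ht)).continuousWithinAt) hη'
  · simpa using (hχb i).add hχs
  · simpa using (hϑb i).add (boundedOnNonneg_const (leaderTheta ω))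
  · simpa only [dotProduct_obsF_transpose_mulVec, sub_add_cancel] using hlast i
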